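/- Let $n\ge 1$ and let $K\subset\mathbb{R}^n$ be a convex body (compact, convex, with non-empty interior) that is symmetric ($K=-K$), has volume $|K|=1$, and is of class $C^2_+$, i.e. its boundary $\partial K$ is $C^2$ with everywhere strictly positive Gauss curvature $\kappa$. For a set $C\subset\mathbb{R}^n$ let $h_C(u)=\sup_{x\in C}\langle x,u\rangle$ be its support function and $C^\circ=\{y:\langle x,y\rangle\le 1\ \text{for all }x\in C\}$ its polar. For real $p\ge 1$ let $Z_p(K)$ be the $L_p$ centroid body of $K$, that is, the convex body with support function $$h_{Z_p(K)}(\theta)=\Big(\int_K|\langle x,\theta\rangle|^p\,dx\Big)^{1/p},$$ and write $Z_p^\circ(K)$ for its polar. Let $N(x)$ be the outer unit normal of $K$ at $x\in\partial K$, $\mu$ the surface area measure on $\partial K$, $\sigma$ the (unnormalized) surface measure on the unit sphere $S^{n-1}$, and $f_K(u)$ the reciprocal of the Gauss curvature at the point of $\partial K$ with outer unit normal $u$. Then all volumes and integrals below are finite, and (i) $$\lim_{p\to\infty}\frac{p}{\log p}\big(|Z_p^\circ(K)|-|K^\circ|\big)=\frac{n(n+1)}{2}\,|K^\circ|;$$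 (ii) $$\lim_{p\to\infty}p\Big(|Z_p^\circ(K)|-|K^\circ|-\frac{n(n+1)}{2p}\log p\;|Z_p^\circ(K)|\Big)=\lim_{p\to\infty}p\Big(|Z_p^\circ(K)|-|K^\circ|-\frac{n(n+1)}{2p}\log p\;|K^\circ|\Big)$$ $$=-\frac12\int_{S^{n-1}}h_K(u)^{-n}\log\!\big(2^{n+1}\pi^{n-1}h_K(u)^{n+1}f_K(u)\big)\,d\sigma(u)=\frac12\int_{\partial K}\frac{\kappa(x)}{\langle x,N(x)\rangle^n}\log\!\Big(\frac{\kappa(x)}{2^{n+1}\pi^{n-1}\langle x,N(x)\rangle^{n+1}}\Big)\,d\mu(x),$$ where both limits exist. -/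

import Mathlib

open MeasureTheory Filter Topology Set
open scoped RealInnerProductSpace

noncomputable section

namespace CentroidBody

variable {n : ℕ}

/-- The support function `h_K(u) = max {⟨x, u⟩ : x ∈ K}`. -/
def supportFn (K : Set (EuclideanSpace ℝ (Fin n))) (u : EuclideanSpace ℝ (Fin n)) : ℝ :=
  sSup ((fun x => ⟪x, u⟫) '' K)

/-- The polar body `K° = {y : ⟨x, y⟩ ≤ 1 for all x ∈ K}`. -/
def polarBody (K : Set (EuclideanSpace ℝ (Fin n))) : Set (EuclideanSpace ℝ (Fin n)) :=
  {y | ∀ x ∈ K, ⟪x, y⟫ ≤ 1}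

/-- The function `θ ↦ (∫_K |⟨x, θ⟩|^p dx)^(1/p)`. -/
def moment (p : ℝ) (K : Set (EuclideanSpace ℝ (Fin n))) (θ : EuclideanSpace ℝ (Fin n)) : ℝ :=
  (∫ x in K, |⟪x, θ⟫| ^ p) ^ (1 / p)

/-- The `L_p` centroid body `Z_p(K)`: the convex body whose support function is
`θ ↦ (∫_K |⟨x, θ⟩|^p dx)^(1/p)`, given as the intersection of the half-spaces which that function
prescribes. For `p ≥ 1` it does have this support function, see `supportFn_Zp`. -/
def Zp (p : ℝ) (K : Set (EuclideanSpace ℝ (Fin n))) : Set (EuclideanSpace ℝ (Fin n)) :=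
  {x | ∀ θ, ⟪x, θ⟫ ≤ moment p K θ}

/-- The outer unit normal `N_K(x)` at a boundary point `x`: the unit vector `u` such that `K` lies
in the half-space `{y : ⟨y, u⟩ ≤ ⟨x, u⟩}` (unique when the boundary is smooth). -/
def outerNormal (K : Set (EuclideanSpace ℝ (Fin n))) (x : EuclideanSpace ℝ (Fin n)) :
    EuclideanSpace ℝ (Fin n) :=
  Classical.epsilon fun u => ‖u‖ = 1 ∧ ∀ y ∈ K, ⟪y, u⟫ ≤ ⟪x, u⟫

/-- The Weingarten map at `x`: the differential of the Gauss map `N_K : ∂K → S^{n-1}`, as an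
endomorphism of the tangent space `N_K(x)^⊥` (the projection is the identity on its range). -/
def weingarten (K : Set (EuclideanSpace ℝ (Fin n))) (x : EuclideanSpace ℝ (Fin n)) :
    ((ℝ ∙ outerNormal K x)ᗮ : Submodule ℝ (EuclideanSpace ℝ (Fin n))) →ₗ[ℝ]
      ((ℝ ∙ outerNormal K x)ᗮ : Submodule ℝ (EuclideanSpace ℝ (Fin n))) :=
  ((ℝ ∙ outerNormal K x)ᗮ.orthogonalProjectionOnto ∘L
    fderivWithin ℝ (outerNormal K) (frontier K) x ∘L (ℝ ∙ outerNormal K x)ᗮ.subtypeL :)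

/-- The Gauss curvature `κ_K(x)`. -/
def gaussCurvature (K : Set (EuclideanSpace ℝ (Fin n))) (x : EuclideanSpace ℝ (Fin n)) : ℝ :=
  LinearMap.det (weingarten K x)

/-- The boundary of `K` is of class `C^2`: near each of its boundary points, `K` is a sublevel set
`{φ ≤ 0}` of a `C^2` function with non-vanishing differential. -/
def HasC2Boundary (K : Set (EuclideanSpace ℝ (Fin n))) : Prop :=
  ∀ x ∈ frontier K, ∃ (U : Set (EuclideanSpace ℝ (Fin n))) (φ : EuclideanSpace ℝ (Fin n) → ℝ),
    IsOpen U ∧ x ∈ U ∧ ContDiffOn ℝ 2 φ U ∧ fderiv ℝ φ x ≠ 0 ∧ K ∩ U = {y ∈ U | φ y ≤ 0}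

/-- `K ∈ C^2_+`: the boundary is `C^2` with everywhere strictly positive Gauss curvature. -/
structure IsC2Plus (K : Set (EuclideanSpace ℝ (Fin n))) : Prop where
  c2 : HasC2Boundary K
  curvature_pos : ∀ x ∈ frontier K, 0 < gaussCurvature K x

/-- The curvature function `f_K(u)`: the reciprocal of the Gauss curvature at the boundary point
that has outer unit normal `u`. -/
def curvatureFn (K : Set (EuclideanSpace ℝ (Fin n))) (u : EuclideanSpace ℝ (Fin n)) : ℝ :=
  (gaussCurvature K (Function.invFunOn (outerNormal K) (frontier K) u))⁻¹

/-- The surface area measure `μ_K`: the `(n-1)`-dimensional Hausdorff measure on `∂K`, in the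
normalization that agrees with Lebesgue measure on Euclidean `(n-1)`-space. -/
def surfaceMeasure (K : Set (EuclideanSpace ℝ (Fin n))) : Measure (EuclideanSpace ℝ (Fin n)) :=
  (Measure.euclideanHausdorffMeasure (n - 1)).restrict (frontier K)

/-- The rotation invariant surface measure `σ` on `S^{n-1}`, of total mass `n |B_2^n|`. -/
def sphereMeasure (n : ℕ) : Measure (Metric.sphere (0 : EuclideanSpace ℝ (Fin n)) 1) :=
  (volume : Measure (EuclideanSpace ℝ (Fin n))).toSphere

/-- `u ↦ h_K(u)^{-n} log (2^{n+1} π^{n-1} h_K(u)^{n+1} f_K(u))`. -/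
def sphereIntegrand (K : Set (EuclideanSpace ℝ (Fin n))) (u : EuclideanSpace ℝ (Fin n)) : ℝ :=
  (supportFn K u ^ n)⁻¹ *
    Real.log (2 ^ (n + 1) * Real.pi ^ (n - 1) * supportFn K u ^ (n + 1) * curvatureFn K u)

/-- `x ↦ κ(x) / ⟨x, N(x)⟩^n * log (κ(x) / (2^{n+1} π^{n-1} ⟨x, N(x)⟩^{n+1}))`. -/
def boundaryIntegrand (K : Set (EuclideanSpace ℝ (Fin n))) (x : EuclideanSpace ℝ (Fin n)) : ℝ :=
  gaussCurvature K x / ⟪x, outerNormal K x⟫ ^ n *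
    Real.log (gaussCurvature K x /
      (2 ^ (n + 1) * Real.pi ^ (n - 1) * ⟪x, outerNormal K x⟫ ^ (n + 1)))

lemma moment_eq_lpNorm {p : ℝ} (hp : 1 ≤ p) (K : Set (EuclideanSpace ℝ (Fin n)))
    (hK : IsCompact K) (θ : EuclideanSpace ℝ (Fin n)) :
    MemLp (fun x => ⟪x, θ⟫) (ENNReal.ofReal p) (volume.restrict K) ∧
    moment p K θ = (eLpNorm (fun x => ⟪x, θ⟫) (ENNReal.ofReal p) (volume.restrict K)).toReal := by
  have hp0 : 0 < p := by linarith
  have hfin : IsFiniteMeasure (volume.restrict K) :=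
    isFiniteMeasure_restrict.2 hK.measure_lt_top.ne
  have hc : Continuous fun x : EuclideanSpace ℝ (Fin n) => ⟪x, θ⟫ := by fun_prop
  have hm : MemLp (fun x => ⟪x, θ⟫) (ENNReal.ofReal p) (volume.restrict K) := by
    obtain ⟨C, hC⟩ := hK.exists_bound_of_continuousOn hc.continuousOn
    exact MemLp.of_bound hc.aestronglyMeasurable C
      ((ae_restrict_iff' hK.measurableSet).2 (Eventually.of_forall hC))
  refine ⟨hm, ?_⟩
  rw [hm.eLpNorm_eq_integral_rpow_norm (by simpa using hp0) ENNReal.ofReal_ne_top,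
    ENNReal.toReal_ofReal hp0.le, ENNReal.toReal_ofReal (by positivity)]
  simp [moment, Real.norm_eq_abs]

lemma moment_add_le {p : ℝ} (hp : 1 ≤ p) (K : Set (EuclideanSpace ℝ (Fin n)))
    (hK : IsCompact K) (θ η : EuclideanSpace ℝ (Fin n)) :
    moment p K (θ + η) ≤ moment p K θ + moment p K η := by
  obtain ⟨h1, e1⟩ := moment_eq_lpNorm hp K hK θ
  obtain ⟨h2, e2⟩ := moment_eq_lpNorm hp K hK η
  rw [(moment_eq_lpNorm hp K hK (θ + η)).2, e1, e2,
    ← ENNReal.toReal_add h1.eLpNorm_ne_top h2.eLpNorm_ne_top]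
  refine ENNReal.toReal_mono (ENNReal.add_ne_top.2 ⟨h1.eLpNorm_ne_top, h2.eLpNorm_ne_top⟩) ?_
  simp_rw [inner_add_right]
  exact eLpNorm_add_le h1.1 h2.1 (by simpa using hp)

lemma moment_smul {p : ℝ} (hp : 1 ≤ p) (K : Set (EuclideanSpace ℝ (Fin n)))
    (c : ℝ) (θ : EuclideanSpace ℝ (Fin n)) :
    moment p K (c • θ) = |c| * moment p K θ := by
  have hp0 : p ≠ 0 := by linarith
  unfold moment
  simp_rw [inner_smul_right, abs_mul, Real.mul_rpow (abs_nonneg c) (abs_nonneg _)]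
  rw [integral_const_mul, Real.mul_rpow (by positivity) (by positivity), one_div,
    Real.rpow_rpow_inv (abs_nonneg c) hp0]

/-- `Z_p(K)` has the support function `θ ↦ (∫_K |⟨x, θ⟩|^p dx)^(1/p)`. -/
theorem supportFn_Zp {p : ℝ} (hp : 1 ≤ p) (K : Set (EuclideanSpace ℝ (Fin n)))
    (hK : IsCompact K) (θ : EuclideanSpace ℝ (Fin n)) :
    supportFn (Zp p K) θ = (∫ x in K, |⟪x, θ⟫| ^ p) ^ (1 / p) := by
  change _ = moment p K θ
  have h0 : 0 ≤ moment p K θ := by unfold moment; positivity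
  have hz : moment p K 0 = 0 := by simpa using moment_smul hp K 0 0
  suffices h : ∃ x ∈ Zp p K, ⟪x, θ⟫ = moment p K θ by
    obtain ⟨x, hx, e⟩ := h
    refine IsGreatest.csSup_eq ⟨⟨x, hx, e⟩, ?_⟩
    rintro _ ⟨y, hy, rfl⟩
    exact hy θ
  obtain ⟨g, hg, hgN⟩ := exists_extension_of_le_sublinear
    (LinearPMap.mkSpanSingleton' θ (moment p K θ) (by
      intro c hc
      rcases smul_eq_zero.1 hc with h | h
      · simp [h]
      · simp [h, hz]))
    (moment p K) (fun c hc x => by rw [moment_smul hp, abs_of_pos hc])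
    (moment_add_le hp K hK) (by
      rintro ⟨x, hx⟩
      obtain ⟨c, rfl⟩ := Submodule.mem_span_singleton.1 hx
      rw [LinearPMap.mkSpanSingleton'_apply, moment_smul hp, smul_eq_mul]
      exact mul_le_mul_of_nonneg_right (le_abs_self c) h0)
  refine ⟨(InnerProductSpace.toDual ℝ _).symm (LinearMap.toContinuousLinearMap g), ?_, ?_⟩
  · intro η
    simpa using hgN η
  · have h := (hg ⟨θ, Submodule.mem_span_singleton_self θ⟩).trans
      (LinearPMap.mkSpanSingleton'_apply_self _ _ _ _)
    simpa using h

end CentroidBody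

end

open CentroidBody

/-! In polar coordinates the volume of a polar body is 1/n times the integral of h^{-n} over the
sphere, so the theorem follows from an expansion of h_{Z_p}(u)^{-n}, controlled uniformly in u. Put
R_p(u) = p^{(n+1)/2} ∫_K (|⟨x, u⟩| / h_K(u))^p dx, which is `scaledMoment`. Then h_{Z_p}^{-n} =
h_K^{-n} exp ε with ε = (n/p) ((n+1)/2 · log p - log R_p) (`inv_moment_pow`). If R_p lies between
positive constants, uniformly in u for large p, then ε = O(log p / p) and p (exp ε - 1 - ε) = O(log²
p / p) (`exists_remainder_bound`). Hence p (h_{Z_p}^{-n} - h_K^{-n}) is n(n+1)/2 · log p · h_K^{-n}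
- n h_K^{-n} log R_p up to o(1). Integration over the sphere gives (i) and (ii); exchanging |K°| for
|Z_p°| in the correction term changes it only by O(log² p / p).

The core is Laplace's method for R_p. By symmetry the half of K where ⟨x, u⟩ > 0 counts twice, and
its mass concentrates at the boundary point x₀ with normal u. In the coordinates x = x₀ + z/√p -
(s/p) u the integrand is (1 - s/(hp))^p, which tends to e^{-s/h}, the body opens up to the region
½⟨Tz, z⟩ ≤ s with T the Weingarten map, and the Jacobian cancels the power of p. The limit is the
Gaussian value 2h √((2πh)^{n-1}/κ) (`tendsto_scaledMoment`). Positive curvature and compactness make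
K uniformly strongly convex at its boundary; this provides the dominating function and the upper
bound `exists_scaledMoment_le`. Paraboloids of uniform shape inside K give the lower bound
`exists_le_scaledMoment`.

The boundary form of the integral rests on the fact that the Gauss map carries κ dμ to dσ
(`sphereContactMeasure_eq`). This is deduced from the distortion of n-dimensional volume under
nearly linear maps: a piece of ∂K and its set of normals are thickened by δ, one thickening is
mapped onto the other by a map close to a linear one of determinant κ, and δ tends to 0. -/

noncomputable section

namespace CentroidBody

/-! ### Second order Taylor expansion with a variable base point. -/

section Taylor

variable {E : Type*} [NormedAddCommGroup E] [NormedSpace ℝ E]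

/-- Second order Taylor expansion, uniform with respect to the base point. -/
theorem exists_ball_taylor_two {φ : E → ℝ} {x₀ : E} {B : E →L[ℝ] E →L[ℝ] ℝ}
    (hφ : ∀ᶠ x in 𝓝 x₀, DifferentiableAt ℝ φ x) (hB : HasStrictFDerivAt (fderiv ℝ φ) B x₀)
    {ε : ℝ} (hε : 0 < ε) :
    ∃ r > 0, ∀ x ∈ Metric.ball x₀ r, ∀ y ∈ Metric.ball x₀ r,
      |φ y - φ x - fderiv ℝ φ x (y - x) - 1 / 2 * B (y - x) (y - x)| ≤ ε * ‖y - x‖ ^ 2 := by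
  have h1 := hB.isLittleO.bound hε
  rw [nhds_prod_eq] at h1
  obtain ⟨r₁, hr₁, h1⟩ := Metric.eventually_nhds_iff_ball.1 (nhds_prod_eq (x := x₀) (y := x₀) ▸ h1)
  obtain ⟨r₂, hr₂, h2⟩ := Metric.eventually_nhds_iff_ball.1 hφ
  refine ⟨min r₁ r₂, lt_min hr₁ hr₂, fun x hx y hy => ?_⟩
  set v := y - x with hv
  have hmem : ∀ t ∈ Icc (0 : ℝ) 1, x + t • v ∈ Metric.ball x₀ (min r₁ r₂) := by
    intro t ht
    have := (convex_ball x₀ (min r₁ r₂)).add_smul_sub_mem hx hy ht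
    simpa [hv] using this
  -- The Taylor remainder is the increment over [0, 1] of this function, so a bound on its
  -- derivative suffices.
  have hd : ∀ t ∈ Icc (0 : ℝ) 1, HasDerivWithinAt
      (fun t : ℝ => φ (x + t • v) - t * fderiv ℝ φ x v - 1 / 2 * t ^ 2 * B v v)
      (fderiv ℝ φ (x + t • v) v - fderiv ℝ φ x v - t * B v v) (Icc 0 1) t := by
    intro t ht
    have hφd := (h2 _ (Metric.ball_subset_ball (min_le_right _ _) (hmem t ht))).hasFDerivAt
    have hl : HasDerivAt (fun t : ℝ => x + t • v) v t := by
      simpa using ((hasDerivAt_id t).smul_const v).const_add x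
    have h3 := hφd.comp_hasDerivAt t hl
    have h4 := (h3.sub ((hasDerivAt_id t).mul_const (fderiv ℝ φ x v))).sub
      ((((hasDerivAt_id t).pow 2).const_mul (1 / 2 : ℝ)).mul_const (B v v))
    refine HasDerivAt.hasDerivWithinAt ?_
    convert h4 using 1
    · ext t
      simp
    · simp only [id_eq]
      push_cast
      ring
  have hb : ∀ t ∈ Icc (0 : ℝ) 1,
      ‖fderiv ℝ φ (x + t • v) v - fderiv ℝ φ x v - t * B v v‖ ≤ ε * ‖v‖ ^ 2 := by
    intro t ht
    -- Strict differentiability compares two arbitrary points near x₀; taking x itself as the second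
    -- one makes the bound uniform in the base point.
    have hp : (x + t • v, x) ∈ Metric.ball (x₀, x₀) r₁ := by
      rw [← ball_prod_same]
      exact ⟨Metric.ball_subset_ball (min_le_left _ _) (hmem t ht),
        Metric.ball_subset_ball (min_le_left _ _) hx⟩
    have h5 := h1 _ hp
    simp only [add_sub_cancel_left, map_smul] at h5
    calc ‖fderiv ℝ φ (x + t • v) v - fderiv ℝ φ x v - t * B v v‖
        = ‖(fderiv ℝ φ (x + t • v) - fderiv ℝ φ x - t • B v) v‖ := by simp
      _ ≤ ‖fderiv ℝ φ (x + t • v) - fderiv ℝ φ x - t • B v‖ * ‖v‖ :=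
        ContinuousLinearMap.le_opNorm _ _
      _ ≤ (ε * ‖t • v‖) * ‖v‖ := by gcongr
      _ ≤ (ε * (1 * ‖v‖)) * ‖v‖ := by
        rw [norm_smul, Real.norm_of_nonneg ht.1]
        gcongr
        exact ht.2
      _ = ε * ‖v‖ ^ 2 := by ring
  have h6 := (convex_Icc (0 : ℝ) 1).norm_image_sub_le_of_norm_hasDerivWithin_le hd hb
    (left_mem_Icc.2 zero_le_one) (right_mem_Icc.2 zero_le_one)
  have h7 : x + v = y := by simp [hv]
  simp only [one_smul, zero_smul, add_zero, h7, Real.norm_eq_abs] at h6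
  norm_num at h6 ⊢
  convert h6 using 2
  ring

end Taylor

/-! ### Orthogonal coordinates along a unit vector and its complement. -/

section Split

variable {E : Type*} [NormedAddCommGroup E] [InnerProductSpace ℝ E]

/-- The coordinates `(z, s) ↦ z - s u` on a Euclidean space given by a unit vector `u`. -/
def splitEquiv (u : E) (hu : ‖u‖ = 1) : ((ℝ ∙ u)ᗮ × ℝ) ≃ₗ[ℝ] E where
  toFun q := (q.1 : E) - q.2 • u
  map_add' p q := by simp only [Prod.fst_add, Prod.snd_add, Submodule.coe_add]; module
  map_smul' c q := by
    simp only [Prod.smul_fst, Prod.smul_snd, Submodule.coe_smul, RingHom.id_apply, smul_eq_mul]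
    module
  invFun v := ((ℝ ∙ u)ᗮ.orthogonalProjectionOnto v, -⟪u, v⟫)
  left_inv q := by
    have h : ⟪u, (q.1 : E)⟫ = 0 := Submodule.mem_orthogonal_singleton_iff_inner_right.1 q.1.2
    have h2 : (ℝ ∙ u)ᗮ.orthogonalProjectionOnto u = 0 :=
      Submodule.orthogonalProjectionOnto_orthogonalComplement_singleton_eq_zero u
    ext1
    · simp [h2]
    · simp [inner_sub_right, inner_smul_right, h, hu]
  right_inv v := by
    have := Submodule.starProjection_add_starProjection_orthogonal (K := ℝ ∙ u) v
    rw [Submodule.starProjection_unit_singleton ℝ hu] at this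
    simp only [neg_smul, sub_neg_eq_add]
    rw [add_comm]
    exact this

@[simp]
theorem splitEquiv_apply (u : E) (hu : ‖u‖ = 1) (q : (ℝ ∙ u)ᗮ × ℝ) :
    splitEquiv u hu q = (q.1 : E) - q.2 • u := rfl

theorem norm_sq_splitEquiv (u : E) (hu : ‖u‖ = 1) (q : (ℝ ∙ u)ᗮ × ℝ) :
    ‖splitEquiv u hu q‖ ^ 2 = ‖q.1‖ ^ 2 + q.2 ^ 2 := by
  have h : ⟪(q.1 : E), u⟫ = 0 := Submodule.mem_orthogonal_singleton_iff_inner_left.1 q.1.2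
  rw [splitEquiv_apply, norm_sub_sq_real, inner_smul_right, h, norm_smul, hu]
  simp

theorem inner_splitEquiv (u : E) (hu : ‖u‖ = 1) (q : (ℝ ∙ u)ᗮ × ℝ) :
    ⟪splitEquiv u hu q, u⟫ = -q.2 := by
  have h : ⟪(q.1 : E), u⟫ = 0 := Submodule.mem_orthogonal_singleton_iff_inner_left.1 q.1.2
  rw [splitEquiv_apply, inner_sub_left, inner_smul_left, h]
  simp [hu]

variable [FiniteDimensional ℝ E]

theorem continuous_splitEquiv (u : E) (hu : ‖u‖ = 1) : Continuous (splitEquiv u hu) :=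
  (splitEquiv u hu).toContinuousLinearEquiv.continuous

theorem finrank_orthogonal_unit (u : E) (hu : ‖u‖ = 1) :
    Module.finrank ℝ (ℝ ∙ u)ᗮ + 1 = Module.finrank ℝ E := by
  have h1 : u ≠ 0 := by rintro rfl; simp at hu
  have h2 := Submodule.finrank_add_finrank_orthogonal (ℝ ∙ u)
  rw [finrank_span_singleton h1] at h2
  omega

/-- The determinant of an endomorphism that fixes the unit vector `u` and preserves `uᗮ`. -/
theorem det_eq_det_compression (u : E) (hu : ‖u‖ = 1) (L : E →ₗ[ℝ] E)
    (T : (ℝ ∙ u)ᗮ →ₗ[ℝ] (ℝ ∙ u)ᗮ) (hT : ∀ z : (ℝ ∙ u)ᗮ, L z = T z) (hL : L u = u) :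
    LinearMap.det L = LinearMap.det T := by
  have h : L = (splitEquiv u hu : ((ℝ ∙ u)ᗮ × ℝ) →ₗ[ℝ] E) ∘ₗ
      (LinearMap.prodMap T LinearMap.id) ∘ₗ ((splitEquiv u hu).symm : E →ₗ[ℝ] _) := by
    ext1 v
    obtain ⟨q, rfl⟩ := (splitEquiv u hu).surjective v
    have hs : (splitEquiv u hu).symm ((q.1 : E) - q.2 • u) = q :=
      (splitEquiv u hu).symm_apply_apply q
    rw [splitEquiv_apply, LinearMap.comp_apply, LinearMap.comp_apply, LinearEquiv.coe_coe,
      LinearEquiv.coe_coe, hs, map_sub, map_smul, hT, hL]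
    simp
  rw [h, LinearMap.det_conj, LinearMap.det_prodMap]
  simp

/-- The map is a composition of volume preserving ones: a sign change, the isometry of ℝ with the
line of u, a swap, the passage to the L² product and the orthogonal sum. -/
theorem measurePreserving_splitEquiv [MeasurableSpace E] [BorelSpace E] (u : E) (hu : ‖u‖ = 1) :
    MeasurePreserving (splitEquiv u hu) volume volume := by
  have h1 : MeasurePreserving (Prod.map (id : (ℝ ∙ u)ᗮ → (ℝ ∙ u)ᗮ) (fun s : ℝ => -s))
      volume volume :=
    (MeasurePreserving.id volume).prod (Measure.measurePreserving_neg volume)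
  have h2 : MeasurePreserving (Prod.map (id : (ℝ ∙ u)ᗮ → (ℝ ∙ u)ᗮ)
      (LinearIsometryEquiv.toSpanUnitSingleton u hu)) volume volume :=
    (MeasurePreserving.id volume).prod
      (LinearIsometryEquiv.toSpanUnitSingleton u hu).measurePreserving
  have h3 : MeasurePreserving (Prod.swap : (ℝ ∙ u)ᗮ × (ℝ ∙ u) → (ℝ ∙ u) × (ℝ ∙ u)ᗮ)
      volume volume := Measure.measurePreserving_swap
  have h4 := WithLp.volume_preserving_toLp (ℝ ∙ u) (ℝ ∙ u)ᗮ
  have h5 := (ℝ ∙ u).orthogonalDecomposition.symm.measurePreserving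
  have h6 := h5.comp (h4.comp (h3.comp (h2.comp h1)))
  refine (congrArg (fun f => MeasurePreserving f volume volume) (funext fun q => ?_)).mpr h6
  simp only [splitEquiv_apply, Function.comp_apply,
    Submodule.orthogonalDecomposition_symm_apply]
  rw [sub_eq_neg_add]
  simp

theorem measurableEmbedding_splitEquiv [MeasurableSpace E] [BorelSpace E] (u : E) (hu : ‖u‖ = 1) :
    MeasurableEmbedding (splitEquiv u hu) :=
  (splitEquiv u hu).toContinuousLinearEquiv.toHomeomorph.measurableEmbedding

end Split

/-! ### Gaussian integrals of quadratic forms and over epigraphs. -/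

section Gaussian

variable {F : Type*} [NormedAddCommGroup F] [InnerProductSpace ℝ F] [FiniteDimensional ℝ F]
  [MeasurableSpace F] [BorelSpace F]

/-- In an orthonormal eigenbasis of T the integrand is a product of one-dimensional Gaussians, and
the product of the eigenvalues is the determinant. -/
theorem integral_exp_neg_quadratic {T : F →ₗ[ℝ] F} (hT : T.IsSymmetric)
    (hpos : ∀ v, v ≠ 0 → 0 < ⟪T v, v⟫) {b : ℝ} (hb : 0 < b) :
    ∫ z : F, Real.exp (-(b * ⟪T z, z⟫)) =
      √((Real.pi / b) ^ (Module.finrank ℝ F) / LinearMap.det T) := by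
  set d := Module.finrank ℝ F with hd
  set e := hT.eigenvectorBasis hd.symm with he
  set ev := hT.eigenvalues hd.symm with hev
  have hev_pos : ∀ i, 0 < ev i := by
    intro i
    have h1 := hpos (e i) (e.orthonormal.ne_zero i)
    rw [he, hT.apply_eigenvectorBasis hd.symm i, inner_smul_left, real_inner_self_eq_norm_sq,
      ← he, e.orthonormal.1 i] at h1
    simpa using h1
  have hq : ∀ y : EuclideanSpace ℝ (Fin d), ⟪T (e.repr.symm y), e.repr.symm y⟫ =
      ∑ i, ev i * y i ^ 2 := by
    intro y
    have h1 : ∀ i, e.repr (T (e.repr.symm y)) i = ev i * y i := by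
      intro i
      have := hT.eigenvectorBasis_apply_self_apply hd.symm (e.repr.symm y) i
      rw [← he] at this
      simpa using this
    rw [← e.repr.inner_map_map, PiLp.inner_apply]
    refine Finset.sum_congr rfl fun i _ => ?_
    rw [h1]
    simp
    ring
  have hint : ∫ z : F, Real.exp (-(b * ⟪T z, z⟫)) =
      ∫ y : Fin d → ℝ, ∏ i, Real.exp (-(b * ev i) * y i ^ 2) := by
    rw [← e.measurePreserving_repr_symm.integral_comp
      e.repr.symm.toHomeomorph.measurableEmbedding,
      ← (EuclideanSpace.volume_preserving_symm_measurableEquiv_toLp (Fin d)).symm.integral_comp']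
    congr 1
    ext y
    rw [← Real.exp_sum]
    congr 1
    have := hq (WithLp.toLp 2 y)
    simp only [neg_mul, Finset.sum_neg_distrib, mul_assoc, ← Finset.mul_sum]
    rw [← this]
    rfl
  rw [hint, integral_fintype_prod_volume_eq_prod (fun i (t : ℝ) => Real.exp (-(b * ev i) * t ^ 2))]
  simp_rw [integral_gaussian]
  rw [hT.det_eq_prod_eigenvalues hd.symm]
  have h0 : ∀ i, 0 ≤ Real.pi / (b * ev i) := fun i =>
    div_nonneg Real.pi_pos.le (mul_pos hb (hev_pos i)).le
  simp_rw [Real.sqrt_eq_rpow]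
  rw [Real.finsetProd_rpow _ _ (fun i _ => h0 i)]
  congr 1
  simp_rw [← div_div]
  rw [Finset.prod_div_distrib]
  simp [← hev, div_pow]

theorem integrable_exp_neg_sq {b : ℝ} (hb : 0 < b) :
    Integrable (fun z : F => Real.exp (-(b * ‖z‖ ^ 2))) := by
  have := GaussianFourier.integrable_cexp_neg_mul_sq_norm_add (b := (b : ℂ)) (by simpa using hb) 0
    (0 : F)
  have := this.norm
  simpa [Complex.norm_exp, ← Complex.ofReal_pow] using this

/-- The region above the graph of `q`, weighted by `e^{-s/h}`. -/
theorem integral_epigraph_exp {q : F → ℝ} (hq : Continuous q) {c h : ℝ} (hc : 0 < c) (hh : 0 < h)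
    (hqc : ∀ z, c * ‖z‖ ^ 2 ≤ q z) :
    Integrable (indicator {w : F × ℝ | q w.1 ≤ w.2} fun w => Real.exp (-(w.2 / h))) ∧
    ∫ w : F × ℝ, indicator {w : F × ℝ | q w.1 ≤ w.2} (fun w => Real.exp (-(w.2 / h))) w =
      h * ∫ z : F, Real.exp (-(h⁻¹ * q z)) := by
  have hmeas : MeasurableSet {w : F × ℝ | q w.1 ≤ w.2} :=
    (isClosed_le (by fun_prop) (by fun_prop)).measurableSet
  -- Each vertical section is the half-line from q z upwards, whose exponential integral is
  -- elementary.
  have hsec : ∀ z : F, (fun s : ℝ => indicator {w : F × ℝ | q w.1 ≤ w.2}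
      (fun w => Real.exp (-(w.2 / h))) (z, s)) =
      indicator (Ici (q z)) fun s => Real.exp (-h⁻¹ * s) := by
    intro z
    ext s
    simp only [indicator, mem_ofPred_eq, mem_Ici]
    split_ifs
    · congr 1; field_simp
    · rfl
  have hi1 : ∀ z : F, Integrable (indicator (Ici (q z)) fun s => Real.exp (-h⁻¹ * s)) := by
    intro z
    rw [integrable_indicator_iff measurableSet_Ici, integrableOn_Ici_iff_integrableOn_Ioi]
    exact integrableOn_exp_mul_Ioi (by simpa using hh) _
  have hi2 : ∀ z : F, ∫ s, (indicator (Ici (q z)) fun s => Real.exp (-h⁻¹ * s)) s =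
      h * Real.exp (-(h⁻¹ * q z)) := by
    intro z
    rw [integral_indicator measurableSet_Ici, integral_Ici_eq_integral_Ioi,
      integral_exp_mul_Ioi (by simpa using hh)]
    field_simp
  have hint : Integrable (fun z : F => Real.exp (-(h⁻¹ * q z))) := by
    refine (integrable_exp_neg_sq (F := F) (mul_pos (inv_pos.2 hh) hc)).mono'
      (by fun_prop) (Eventually.of_forall fun z => ?_)
    rw [Real.norm_of_nonneg (Real.exp_pos _).le, Real.exp_le_exp, neg_le_neg_iff, mul_assoc]
    exact mul_le_mul_of_nonneg_left (hqc z) (inv_pos.2 hh).le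
  have hI : Integrable (indicator {w : F × ℝ | q w.1 ≤ w.2} fun w => Real.exp (-(w.2 / h))) := by
    rw [Measure.volume_eq_prod, integrable_prod_iff]
    · refine ⟨Eventually.of_forall fun z => by rw [hsec]; exact hi1 z, ?_⟩
      have : ∀ z : F, ∫ s, ‖indicator {w : F × ℝ | q w.1 ≤ w.2}
          (fun w => Real.exp (-(w.2 / h))) (z, s)‖ = h * Real.exp (-(h⁻¹ * q z)) := by
        intro z
        rw [← hi2 z, ← hsec]
        congr 1
        ext s
        exact Real.norm_of_nonneg (indicator_nonneg (fun _ _ => (Real.exp_pos _).le) _)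
      simp_rw [this]
      exact hint.const_mul h
    · exact ((by fun_prop : Continuous fun w : F × ℝ =>
        Real.exp (-(w.2 / h))).measurable.indicator hmeas).aestronglyMeasurable
  refine ⟨hI, ?_⟩
  rw [Measure.volume_eq_prod] at hI ⊢
  rw [integral_prod _ hI, ← integral_const_mul]
  congr 1
  ext z
  rw [hsec, hi2]

end Gaussian

/-! ### Local defining functions and the outer normal. -/

section LocalGeometry

variable {n : ℕ} {K U : Set (EuclideanSpace ℝ (Fin n))} {φ : EuclideanSpace ℝ (Fin n) → ℝ}
  {x : EuclideanSpace ℝ (Fin n)}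

/-- On the open set `U`, the set `K` is `{φ ≤ 0}` for a `C^2` function without critical points. -/
structure IsLocalDefiningFn (K U : Set (EuclideanSpace ℝ (Fin n)))
    (φ : EuclideanSpace ℝ (Fin n) → ℝ) : Prop where
  isOpen : IsOpen U
  contDiffOn : ContDiffOn ℝ 2 φ U
  fderiv_ne : ∀ x ∈ U, fderiv ℝ φ x ≠ 0
  inter_eq : K ∩ U = {y ∈ U | φ y ≤ 0}

/-- The definition of a C² boundary excludes a critical point only at x; by continuity of the
differential a smaller neighbourhood has none. -/
theorem HasC2Boundary.exists_isLocalDefiningFn (hK : HasC2Boundary K) (hx : x ∈ frontier K) :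
    ∃ U φ, x ∈ U ∧ IsLocalDefiningFn K U φ := by
  obtain ⟨U, φ, hU, hxU, hφ, hd, he⟩ := hK x hx
  have hc : ContinuousOn (fderiv ℝ φ) U := hφ.continuousOn_fderiv_of_isOpen hU (by norm_num)
  refine ⟨U ∩ fderiv ℝ φ ⁻¹' {0}ᶜ, φ, ⟨hxU, hd⟩,
    hc.isOpen_inter_preimage hU isOpen_compl_singleton, hφ.mono inter_subset_left,
    fun y hy => hy.2, ?_⟩
  rw [← inter_assoc, he]
  ext y
  simp only [mem_inter_iff, mem_ofPred_eq]
  tauto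

/-- The normalized gradient of `φ`. -/
def unitGradient (φ : EuclideanSpace ℝ (Fin n) → ℝ) (x : EuclideanSpace ℝ (Fin n)) :
    EuclideanSpace ℝ (Fin n) :=
  ‖gradient φ x‖⁻¹ • gradient φ x

namespace IsLocalDefiningFn

theorem gradient_ne (h : IsLocalDefiningFn K U φ) (hx : x ∈ U) : gradient φ x ≠ 0 := by
  intro h0
  exact h.fderiv_ne x hx (by simpa [gradient] using h0)

theorem norm_unitGradient (h : IsLocalDefiningFn K U φ) (hx : x ∈ U) :
    ‖unitGradient φ x‖ = 1 := by
  rw [unitGradient, norm_smul, norm_inv, norm_norm,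
    inv_mul_cancel₀ (norm_ne_zero_iff.2 (h.gradient_ne hx))]

theorem fderiv_apply (h : IsLocalDefiningFn K U φ) (hx : x ∈ U) (v : EuclideanSpace ℝ (Fin n)) :
    fderiv ℝ φ x v = ‖gradient φ x‖ * ⟪unitGradient φ x, v⟫ := by
  have h0 := norm_ne_zero_iff.2 (h.gradient_ne hx)
  rw [unitGradient, inner_smul_left]
  simp only [gradient, conj_trivial, InnerProductSpace.toDual_symm_apply,
    LinearIsometryEquiv.norm_map] at h0 ⊢
  field_simp

theorem differentiableAt (h : IsLocalDefiningFn K U φ) (hx : x ∈ U) : DifferentiableAt ℝ φ x :=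
  (h.contDiffOn.contDiffAt (h.isOpen.mem_nhds hx)).differentiableAt (by norm_num)

theorem contDiffOn_gradient (h : IsLocalDefiningFn K U φ) : ContDiffOn ℝ 1 (gradient φ) U :=
  (InnerProductSpace.toDual ℝ _).symm.contDiff.comp_contDiffOn
    (h.contDiffOn.fderiv_of_isOpen h.isOpen (by norm_num))

theorem contDiffOn_unitGradient (h : IsLocalDefiningFn K U φ) :
    ContDiffOn ℝ 1 (unitGradient φ) U :=
  ((h.contDiffOn_gradient.norm ℝ fun _ hx => h.gradient_ne hx).inv
    fun _ hx => norm_ne_zero_iff.2 (h.gradient_ne hx)).smul h.contDiffOn_gradient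

theorem mem_iff (h : IsLocalDefiningFn K U φ) (hx : x ∈ U) : x ∈ K ↔ φ x ≤ 0 := by
  have := Set.ext_iff.1 h.inter_eq x
  simp only [mem_inter_iff, mem_ofPred_eq] at this
  tauto

theorem apply_eq_zero (h : IsLocalDefiningFn K U φ) (hc : IsClosed K) (hx : x ∈ U)
    (hxK : x ∈ frontier K) : φ x = 0 := by
  refine le_antisymm ((h.mem_iff hx).1 (hc.frontier_subset hxK)) (not_lt.1 fun hlt => hxK.2 ?_)
  have h1 : ∀ᶠ y in 𝓝 x, φ y < 0 :=
    (h.differentiableAt hx).continuousAt.eventually_lt continuousAt_const hlt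
  rw [mem_interior_iff_mem_nhds]
  filter_upwards [h1, h.isOpen.mem_nhds hx] with y hy hyU
  exact (h.mem_iff hyU).2 hy.le

theorem eventually_line_mem (h : IsLocalDefiningFn K U φ) (hx : x ∈ U)
    (v : EuclideanSpace ℝ (Fin n)) : ∀ᶠ t : ℝ in 𝓝[>] 0, x + t • v ∈ U := by
  have h1 : Tendsto (fun t : ℝ => x + t • v) (𝓝 0) (𝓝 x) := by
    have : Continuous fun t : ℝ => x + t • v := by fun_prop
    simpa using this.tendsto 0
  exact (h1.mono_left nhdsWithin_le_nhds).eventually (h.isOpen.mem_nhds hx)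

theorem hasDerivAt_line (h : IsLocalDefiningFn K U φ) (hx : x ∈ U)
    (v : EuclideanSpace ℝ (Fin n)) :
    HasDerivAt (fun t : ℝ => φ (x + t • v)) (fderiv ℝ φ x v) 0 := by
  have h1 : HasDerivAt (fun t : ℝ => x + t • v) v 0 := by
    simpa using ((hasDerivAt_id (0 : ℝ)).smul_const v).const_add x
  have h2 : HasFDerivAt φ (fderiv ℝ φ x) (x + (0 : ℝ) • v) := by
    simpa using (h.differentiableAt hx).hasFDerivAt
  exact h2.comp_hasDerivAt 0 h1

theorem tendsto_div_line (h : IsLocalDefiningFn K U φ) (hx : x ∈ U) (h0 : φ x = 0)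
    (v : EuclideanSpace ℝ (Fin n)) :
    Tendsto (fun t : ℝ => φ (x + t • v) / t) (𝓝[>] 0) (𝓝 (fderiv ℝ φ x v)) := by
  have h1 := (hasDerivWithinAt_iff_tendsto_slope' (notMem_Ioi.2 le_rfl)).1
    (h.hasDerivAt_line hx v).hasDerivWithinAt
  refine h1.congr fun t => ?_
  rw [slope_def_field]
  simp [h0]

/-- Directions of decrease of `φ` point into `K`. -/
theorem eventually_mem_of_fderiv_neg (h : IsLocalDefiningFn K U φ) (hc : IsClosed K) (hx : x ∈ U)
    (hxK : x ∈ frontier K) {v : EuclideanSpace ℝ (Fin n)} (hv : fderiv ℝ φ x v < 0) :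
    ∀ᶠ t : ℝ in 𝓝[>] 0, x + t • v ∈ K := by
  have h1 := h.tendsto_div_line hx (h.apply_eq_zero hc hx hxK) v
  filter_upwards [h1.eventually (gt_mem_nhds hv), h.eventually_line_mem hx v,
    self_mem_nhdsWithin] with t ht htU (ht0 : 0 < t)
  rw [h.mem_iff htU]
  by_contra hcon
  exact absurd (div_pos (not_le.1 hcon) ht0) ht.not_gt

/-- Moving along the gradient makes φ positive, so points outside K accumulate at x. -/
theorem mem_frontier (h : IsLocalDefiningFn K U φ) (hx : x ∈ U) (h0 : φ x = 0) :
    x ∈ frontier K := by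
  refine ⟨subset_closure ((h.mem_iff hx).2 h0.le), fun hint => ?_⟩
  have hg : 0 < fderiv ℝ φ x (gradient φ x) := by
    have := norm_pos_iff.2 (h.gradient_ne hx)
    rw [h.fderiv_apply hx, unitGradient, inner_smul_left, real_inner_self_eq_norm_sq]
    simp only [conj_trivial]
    positivity
  have h1 := h.tendsto_div_line hx h0 (gradient φ x)
  have hline : Tendsto (fun t : ℝ => x + t • gradient φ x) (𝓝[>] 0) (𝓝 x) := by
    have : Continuous fun t : ℝ => x + t • gradient φ x := by fun_prop
    simpa using (this.tendsto 0).mono_left (nhdsWithin_le_nhds (s := Ioi 0))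
  obtain ⟨t, ht, htU, ht0, htK⟩ := (((h1.eventually (lt_mem_nhds hg)).and
    ((h.eventually_line_mem hx (gradient φ x)).and (eventually_mem_nhdsWithin.and
      (hline.eventually (mem_interior_iff_mem_nhds.1 hint)))))).exists
  have h3 := (h.mem_iff htU).1 htK
  exact absurd ht (div_nonpos_of_nonpos_of_nonneg h3 (le_of_lt ht0)).not_gt

/-- The segment from x to y stays in K, where φ ≤ 0, while φ vanishes at x; hence the derivative of
φ in the direction y - x is not positive. -/
theorem inner_unitGradient_le (h : IsLocalDefiningFn K U φ) (hc : IsClosed K) (hK : Convex ℝ K)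
    (hx : x ∈ U) (hxK : x ∈ frontier K) {y : EuclideanSpace ℝ (Fin n)} (hy : y ∈ K) :
    ⟪y, unitGradient φ x⟫ ≤ ⟪x, unitGradient φ x⟫ := by
  have h1 := h.tendsto_div_line hx (h.apply_eq_zero hc hx hxK) (y - x)
  have h2 : fderiv ℝ φ x (y - x) ≤ 0 := by
    refine le_of_tendsto h1 ?_
    have h3 : ∀ᶠ t : ℝ in 𝓝[>] 0, t ≤ 1 := nhdsWithin_le_nhds (eventually_le_nhds one_pos)
    filter_upwards [h.eventually_line_mem hx (y - x), self_mem_nhdsWithin, h3] with t htU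
      (ht0 : 0 < t) ht1
    refine div_nonpos_of_nonpos_of_nonneg ((h.mem_iff htU).1 ?_) ht0.le
    exact hK.add_smul_sub_mem (hc.frontier_subset hxK) hy ⟨ht0.le, ht1⟩
  rw [h.fderiv_apply hx] at h2
  have h4 := norm_pos_iff.2 (h.gradient_ne hx)
  have h5 : ⟪unitGradient φ x, y - x⟫ ≤ 0 := by
    by_contra hcon
    exact absurd (mul_pos h4 (not_le.1 hcon)) h2.not_gt
  rw [real_inner_comm, real_inner_comm _ x]
  rw [inner_sub_right] at h5
  linarith

/-- If u differed from the unit gradient w, then ⟨w, u⟩ < 1 would make u - w a direction of decrease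
of φ, so K would contain points x + t (u - w) on which ⟨·, u⟩ exceeds its supposed maximum. This
uniqueness pins down the choice made in `outerNormal`. -/
theorem eq_unitGradient (h : IsLocalDefiningFn K U φ) (hc : IsClosed K) (hx : x ∈ U)
    (hxK : x ∈ frontier K) {u : EuclideanSpace ℝ (Fin n)} (hu : ‖u‖ = 1)
    (hsup : ∀ y ∈ K, ⟪y, u⟫ ≤ ⟪x, u⟫) : u = unitGradient φ x := by
  have hn := h.norm_unitGradient hx
  set w := unitGradient φ x with hw
  by_contra hne
  have h1 : ⟪w, u⟫ < 1 := inner_lt_one_iff_real_of_norm_eq_one hn hu |>.2 (Ne.symm hne)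
  have hneg : fderiv ℝ φ x (u - w) < 0 := by
    rw [h.fderiv_apply hx, ← hw, inner_sub_right, real_inner_self_eq_norm_sq, hn]
    exact mul_neg_of_pos_of_neg (norm_pos_iff.2 (h.gradient_ne hx)) (by linarith)
  obtain ⟨t, htK, ht0⟩ :=
    ((h.eventually_mem_of_fderiv_neg hc hx hxK hneg).and eventually_mem_nhdsWithin).exists
  have h2 := hsup _ htK
  rw [inner_add_left, inner_smul_left, inner_sub_left, real_inner_self_eq_norm_sq, hu] at h2
  simp only [conj_trivial] at h2
  have h3 : 0 < t * (1 - ⟪w, u⟫) := mul_pos ht0 (by linarith)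
  linarith

theorem outerNormal_eq (h : IsLocalDefiningFn K U φ) (hc : IsClosed K) (hK : Convex ℝ K)
    (hx : x ∈ U) (hxK : x ∈ frontier K) : outerNormal K x = unitGradient φ x := by
  have hs : ‖outerNormal K x‖ = 1 ∧ ∀ y ∈ K, ⟪y, outerNormal K x⟫ ≤ ⟪x, outerNormal K x⟫ :=
    Classical.epsilon_spec (p := fun u => ‖u‖ = 1 ∧ ∀ y ∈ K, ⟪y, u⟫ ≤ ⟪x, u⟫)
      ⟨unitGradient φ x, h.norm_unitGradient hx, fun y hy =>
        h.inner_unitGradient_le hc hK hx hxK hy⟩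
  exact h.eq_unitGradient hc hx hxK hs.1 hs.2

end IsLocalDefiningFn

end LocalGeometry

/-! ### The Weingarten map as the tangential Hessian of a defining function. -/

section Curvature

variable {n : ℕ} {K U : Set (EuclideanSpace ℝ (Fin n))} {φ : EuclideanSpace ℝ (Fin n) → ℝ}
  {x : EuclideanSpace ℝ (Fin n)}

namespace IsLocalDefiningFn

theorem hasStrictFDerivAt_unitGradient (h : IsLocalDefiningFn K U φ) (hx : x ∈ U) :
    HasStrictFDerivAt (unitGradient φ) (fderiv ℝ (unitGradient φ) x) x :=
  (h.contDiffOn_unitGradient.contDiffAt (h.isOpen.mem_nhds hx)).hasStrictFDerivAt (by norm_num)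

theorem hasStrictFDerivAt_fderiv (h : IsLocalDefiningFn K U φ) (hx : x ∈ U) :
    HasStrictFDerivAt (fderiv ℝ φ) (fderiv ℝ (fderiv ℝ φ) x) x :=
  ((h.contDiffOn.fderiv_of_isOpen h.isOpen (m := 1) (by norm_num)).contDiffAt
    (h.isOpen.mem_nhds hx)).hasStrictFDerivAt (by norm_num)

theorem hasFDerivWithinAt_outerNormal (h : IsLocalDefiningFn K U φ) (hc : IsClosed K)
    (hK : Convex ℝ K) (hx : x ∈ U) (hxK : x ∈ frontier K) :
    HasFDerivWithinAt (outerNormal K) (fderiv ℝ (unitGradient φ) x) (frontier K) x := by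
  refine (h.hasStrictFDerivAt_unitGradient hx).hasFDerivAt.hasFDerivWithinAt.congr_of_eventuallyEq
    ?_ (h.outerNormal_eq hc hK hx hxK)
  filter_upwards [mem_nhdsWithin_of_mem_nhds (h.isOpen.mem_nhds hx), self_mem_nhdsWithin]
    with y hyU hy
  exact h.outerNormal_eq hc hK hyU hy

/-- The derivative of the Gauss map is determined on the tangent space. -/
theorem fderivWithin_outerNormal_apply (h : IsLocalDefiningFn K U φ) (hc : IsClosed K)
    (hK : Convex ℝ K) (hx : x ∈ U) (hxK : x ∈ frontier K) {v : EuclideanSpace ℝ (Fin n)}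
    (hv : ⟪unitGradient φ x, v⟫ = 0) :
    fderivWithin ℝ (outerNormal K) (frontier K) x v = fderiv ℝ (unitGradient φ) x v := by
  have hφ : HasStrictFDerivAt φ (fderiv ℝ φ x) x :=
    (h.contDiffOn.contDiffAt (h.isOpen.mem_nhds hx)).hasStrictFDerivAt (by norm_num)
  have hr : (fderiv ℝ φ x).range = ⊤ := by
    refine LinearMap.range_eq_top.2 ?_
    exact LinearMap.surjective (f := (fderiv ℝ φ x : EuclideanSpace ℝ (Fin n) →ₗ[ℝ] ℝ))
      (fun h0 => h.fderiv_ne x hx (ContinuousLinearMap.coe_injective h0))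
  -- A chart of the level set over the tangent space, whose derivative at 0 is the inclusion of the
  -- kernel.
  set g := hφ.implicitFunction φ (fderiv ℝ φ x) hr (φ x) with hg
  have hg0 : g 0 = x := hφ.implicitFunction_apply_image hr
  have hgd : HasFDerivAt g (fderiv ℝ φ x).ker.subtypeL 0 :=
    (hφ.to_implicitFunction hr).hasFDerivAt
  have hgc : Tendsto g (𝓝 0) (𝓝 x) := by simpa [hg0] using hgd.continuousAt.tendsto
  have hgφ : ∀ᶠ w in 𝓝 0, φ (g w) = φ x := by
    have h1 := hφ.map_implicitFunction_eq hr
    have h2 : Tendsto (fun w : (fderiv ℝ φ x).ker => (φ x, w)) (𝓝 0) (𝓝 (φ x, 0)) :=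
      tendsto_const_nhds.prodMk_nhds tendsto_id
    exact h2.eventually h1
  have hgK : ∀ᶠ w in 𝓝 0, g w ∈ U ∧ g w ∈ frontier K := by
    filter_upwards [hgφ, hgc.eventually (h.isOpen.mem_nhds hx)] with w hw hwU
    exact ⟨hwU, h.mem_frontier hwU (hw.trans (h.apply_eq_zero hc hx hxK))⟩
  have hD := (h.hasFDerivWithinAt_outerNormal hc hK hx hxK).differentiableWithinAt.hasFDerivWithinAt
  -- A derivative within the hypersurface is not unique in the normal direction. Composed with the
  -- chart it becomes an ordinary derivative at 0, which is unique and records exactly its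
  -- restriction to the tangent space.
  have key : ∀ D : EuclideanSpace ℝ (Fin n) →L[ℝ] EuclideanSpace ℝ (Fin n),
      HasFDerivWithinAt (outerNormal K) D (frontier K) x →
      HasFDerivAt (outerNormal K ∘ g) (D ∘L (fderiv ℝ φ x).ker.subtypeL) 0 := by
    intro D hDD
    have hDD' : HasFDerivWithinAt (outerNormal K) D (frontier K) (g 0) := by rwa [hg0]
    have h3 := hDD'.comp_of_tendsto (x := (0 : (fderiv ℝ φ x).ker)) (s := univ)
      hgd.hasFDerivWithinAt (tendsto_nhdsWithin_iff.2
        ⟨by rw [nhdsWithin_univ, hg0]; exact hgc, by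
          rw [nhdsWithin_univ]; exact hgK.mono fun w hw => hw.2⟩)
    exact hasFDerivWithinAt_univ.1 h3
  have huniq := (key _ hD).unique (key _ (h.hasFDerivWithinAt_outerNormal hc hK hx hxK))
  have hvk : v ∈ (fderiv ℝ φ x).ker := by
    change fderiv ℝ φ x v = 0
    rw [h.fderiv_apply hx, hv, mul_zero]
  exact congrArg (fun T => T ⟨v, hvk⟩) huniq

/-- Differentiate the identity ⟨N, N⟩ = 1. -/
theorem inner_fderiv_unitGradient (h : IsLocalDefiningFn K U φ) (hx : x ∈ U)
    (v : EuclideanSpace ℝ (Fin n)) :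
    ⟪unitGradient φ x, fderiv ℝ (unitGradient φ) x v⟫ = 0 := by
  have h1 := (h.hasStrictFDerivAt_unitGradient hx).hasFDerivAt
  have h2 := h1.inner ℝ h1
  have h3 : HasFDerivAt (fun y => ⟪unitGradient φ y, unitGradient φ y⟫)
      (0 : EuclideanSpace ℝ (Fin n) →L[ℝ] ℝ) x := by
    refine (hasFDerivAt_const (1 : ℝ) x).congr_of_eventuallyEq ?_
    filter_upwards [h.isOpen.mem_nhds hx] with y hy
    rw [real_inner_self_eq_norm_sq, h.norm_unitGradient hy, one_pow]
  have h4 := congrArg (fun T => T v) (h2.unique h3)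
  simp only [ContinuousLinearMap.comp_apply, ContinuousLinearMap.prod_apply,
    fderivInnerCLM_apply, zero_apply] at h4
  rw [real_inner_comm (unitGradient φ x)] at h4
  linarith

/-- Differentiate Dφ(y) w = ‖∇φ(y)‖ ⟨N(y), w⟩ at x in the direction v; the derivative of ‖∇φ‖ comes
with the factor ⟨N(x), w⟩ = 0. -/
theorem fderiv_fderiv_apply (h : IsLocalDefiningFn K U φ) (hx : x ∈ U)
    (v : EuclideanSpace ℝ (Fin n)) {w : EuclideanSpace ℝ (Fin n)}
    (hw : ⟪unitGradient φ x, w⟫ = 0) :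
    fderiv ℝ (fderiv ℝ φ) x v w =
      ‖gradient φ x‖ * ⟪fderiv ℝ (unitGradient φ) x v, w⟫ := by
  have h1 : HasFDerivAt (fun y => fderiv ℝ φ y w)
      ((ContinuousLinearMap.apply ℝ ℝ w) ∘L (fderiv ℝ (fderiv ℝ φ) x)) x :=
    (ContinuousLinearMap.apply ℝ ℝ w).hasFDerivAt.comp x
      (h.hasStrictFDerivAt_fderiv hx).hasFDerivAt
  have hn : DifferentiableAt ℝ (fun y => ‖gradient φ y‖) x :=
    ((h.contDiffOn_gradient.norm ℝ fun _ hy => h.gradient_ne hy).contDiffAt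
      (h.isOpen.mem_nhds hx)).differentiableAt (by norm_num)
  have h2 := hn.hasFDerivAt.mul ((h.hasStrictFDerivAt_unitGradient hx).hasFDerivAt.inner ℝ
    (hasFDerivAt_const w x))
  have h3 : HasFDerivAt (fun y => fderiv ℝ φ y w) _ x := h2.congr_of_eventuallyEq (by
    filter_upwards [h.isOpen.mem_nhds hx] with y hy
    exact h.fderiv_apply hy w)
  have h4 := congrArg (fun T => T v) (h1.unique h3)
  simpa [hw] using h4

theorem weingarten_apply (h : IsLocalDefiningFn K U φ) (hc : IsClosed K)
    (hK : Convex ℝ K) (hx : x ∈ U) (hxK : x ∈ frontier K) (v : (ℝ ∙ outerNormal K x)ᗮ) :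
    (weingarten K x v : EuclideanSpace ℝ (Fin n)) = fderiv ℝ (unitGradient φ) x v := by
  have hN := h.outerNormal_eq hc hK hx hxK
  have hv : ⟪unitGradient φ x, (v : EuclideanSpace ℝ (Fin n))⟫ = 0 := by
    rw [← hN]
    exact Submodule.mem_orthogonal_singleton_iff_inner_right.1 v.2
  have h1 : fderiv ℝ (unitGradient φ) x v ∈ (ℝ ∙ outerNormal K x)ᗮ := by
    rw [Submodule.mem_orthogonal_singleton_iff_inner_right]
    exact (congrArg (fun u => ⟪u, _⟫) hN).trans (h.inner_fderiv_unitGradient hx v)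
  change (((ℝ ∙ outerNormal K x)ᗮ.orthogonalProjectionOnto
    (fderivWithin ℝ (outerNormal K) (frontier K) x v) : (ℝ ∙ outerNormal K x)ᗮ) :
      EuclideanSpace ℝ (Fin n)) = _
  rw [h.fderivWithin_outerNormal_apply hc hK hx hxK hv]
  exact Submodule.starProjection_eq_self_iff.2 h1

/-- This is the bridge between curvature and Taylor expansion: symmetry and definiteness pass from
the Hessian of φ to the Weingarten map, and quantitative lower bounds pass back. -/
theorem inner_weingarten (h : IsLocalDefiningFn K U φ) (hc : IsClosed K)
    (hK : Convex ℝ K) (hx : x ∈ U) (hxK : x ∈ frontier K) (v w : (ℝ ∙ outerNormal K x)ᗮ) :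
    fderiv ℝ (fderiv ℝ φ) x v w = ‖gradient φ x‖ * ⟪weingarten K x v, w⟫ := by
  have hw : ⟪unitGradient φ x, (w : EuclideanSpace ℝ (Fin n))⟫ = 0 := by
    rw [← h.outerNormal_eq hc hK hx hxK]
    exact Submodule.mem_orthogonal_singleton_iff_inner_right.1 w.2
  rw [h.fderiv_fderiv_apply hx v hw, ← h.weingarten_apply hc hK hx hxK]
  rfl

theorem isSymmetric_weingarten (h : IsLocalDefiningFn K U φ) (hc : IsClosed K)
    (hK : Convex ℝ K) (hx : x ∈ U) (hxK : x ∈ frontier K) : (weingarten K x).IsSymmetric := by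
  intro v w
  have hs : IsSymmSndFDerivAt ℝ φ x :=
    (h.contDiffOn.contDiffAt (h.isOpen.mem_nhds hx)).isSymmSndFDerivAt (by simp)
  have h1 := h.inner_weingarten hc hK hx hxK v w
  have h2 := h.inner_weingarten hc hK hx hxK w v
  rw [hs.eq] at h1
  rw [h2] at h1
  rw [real_inner_comm (weingarten K x w)]
  exact (mul_left_cancel₀ (norm_ne_zero_iff.2 (h.gradient_ne hx)) h1).symm

/-- Second order expansion of `φ`, uniform near a point. -/
theorem exists_ball_taylor (h : IsLocalDefiningFn K U φ) (hx : x ∈ U) {ε : ℝ} (hε : 0 < ε) :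
    ∃ r > 0, Metric.ball x r ⊆ U ∧ ∀ y ∈ Metric.ball x r, ∀ z ∈ Metric.ball x r,
      |φ z - φ y - ‖gradient φ y‖ * ⟪unitGradient φ y, z - y⟫ -
        1 / 2 * fderiv ℝ (fderiv ℝ φ) x (z - y) (z - y)| ≤ ε * ‖z - y‖ ^ 2 := by
  obtain ⟨r₁, hr₁, h1⟩ := exists_ball_taylor_two
    (by filter_upwards [h.isOpen.mem_nhds hx] with y hy using h.differentiableAt hy)
    (h.hasStrictFDerivAt_fderiv hx) hε
  obtain ⟨r₂, hr₂, h2⟩ := Metric.isOpen_iff.1 h.isOpen x hx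
  refine ⟨min r₁ r₂, lt_min hr₁ hr₂,
    (Metric.ball_subset_ball (min_le_right _ _)).trans h2, fun y hy z hz => ?_⟩
  rw [← h.fderiv_apply (h2 (Metric.ball_subset_ball (min_le_right _ _) hy))]
  exact h1 y (Metric.ball_subset_ball (min_le_left _ _) hy) z
    (Metric.ball_subset_ball (min_le_left _ _) hz)

end IsLocalDefiningFn

end Curvature

/-! ### Positive quadratic forms. -/

section QuadraticForms

variable {E : Type*} [NormedAddCommGroup E] [InnerProductSpace ℝ E]

/-- A form that is positive definite on `uᗮ` becomes positive definite on the whole space after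
adding a multiple of `⟪u, ·⟫ ^ 2`. -/
theorem exists_quadratic_lower_bound (B : E →L[ℝ] E →L[ℝ] ℝ) {u : E} (hu : ‖u‖ = 1) {b : ℝ}
    (hb : 0 < b) (hB : ∀ v, ⟪u, v⟫ = 0 → b * ‖v‖ ^ 2 ≤ B v v) :
    ∃ M > 0, ∀ w, b / 2 * ‖w‖ ^ 2 ≤ B w w + M * ⟪u, w⟫ ^ 2 := by
  -- The three summands pay for the mixed terms (through Young's inequality, at the price of half of
  -- b on uᗮ), for B u u, and for the normal part of the claimed lower bound.
  refine ⟨2 * ‖B‖ ^ 2 / b + ‖B‖ + b / 2, by positivity, fun w => ?_⟩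
  set a := ⟪u, w⟫ with ha
  set v := w - a • u with hv
  have huv : ⟪u, v⟫ = 0 := by
    rw [hv, inner_sub_right, inner_smul_right, real_inner_self_eq_norm_sq, hu]
    simp [ha]
  have hw : w = v + a • u := by simp [hv]
  have hnorm : ‖w‖ ^ 2 = ‖v‖ ^ 2 + a ^ 2 := by
    rw [hw, norm_add_sq_real, inner_smul_right, real_inner_comm, huv, norm_smul, hu]
    simp
  have hexp : B w w = B v v + a * (B v u + B u v) + a ^ 2 * B u u := by
    rw [hw]
    simp only [map_add, map_smul, add_apply, smul_apply, smul_eq_mul]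
    ring
  have h1 : |B v u| ≤ ‖B‖ * ‖v‖ := by simpa [hu] using B.le_opNorm₂ v u
  have h2 : |B u v| ≤ ‖B‖ * ‖v‖ := by simpa [hu] using B.le_opNorm₂ u v
  have h3 : |B u u| ≤ ‖B‖ := by simpa [hu] using B.le_opNorm₂ u u
  have h4 : -(2 * |a| * ‖B‖ * ‖v‖) ≤ a * (B v u + B u v) := by
    have : |a * (B v u + B u v)| ≤ |a| * (‖B‖ * ‖v‖ + ‖B‖ * ‖v‖) := by
      rw [abs_mul]
      gcongr
      exact (abs_add_le _ _).trans (add_le_add h1 h2)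
    have := neg_le_of_abs_le this
    linarith
  have h5 : -(a ^ 2 * ‖B‖) ≤ a ^ 2 * B u u := by
    have := neg_le_of_abs_le h3
    nlinarith [sq_nonneg a]
  have h6 : 2 * |a| * ‖B‖ * ‖v‖ ≤ b / 2 * ‖v‖ ^ 2 + 2 * ‖B‖ ^ 2 / b * a ^ 2 := by
    have h7 : 0 ≤ (b * ‖v‖ - 2 * ‖B‖ * |a|) ^ 2 / (2 * b) := by positivity
    have h8 : (b * ‖v‖ - 2 * ‖B‖ * |a|) ^ 2 / (2 * b) =
        b / 2 * ‖v‖ ^ 2 + 2 * ‖B‖ ^ 2 / b * |a| ^ 2 - 2 * |a| * ‖B‖ * ‖v‖ := by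
      field_simp
      ring
    rw [sq_abs] at h8
    linarith
  have h9 := hB v huv
  rw [hexp, hnorm]
  nlinarith

variable [FiniteDimensional ℝ E]

theorem exists_pos_mul_sq_norm_le {q : E → ℝ} (hq : Continuous q)
    (hhom : ∀ (t : ℝ) v, q (t • v) = t ^ 2 * q v) (hpos : ∀ v, v ≠ 0 → 0 < q v) :
    ∃ c > 0, ∀ v, c * ‖v‖ ^ 2 ≤ q v := by
  have h0 : q 0 = 0 := by simpa using hhom 0 0
  -- The sphere is empty when E is trivial, as happens for uᗮ in dimension one.
  rcases (Metric.sphere (0 : E) 1).eq_empty_or_nonempty with he | hne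
  · refine ⟨1, one_pos, fun v => ?_⟩
    have : v = 0 := by
      by_contra hv
      have : ‖v‖⁻¹ • v ∈ Metric.sphere (0 : E) 1 := by
        simp [norm_smul, inv_mul_cancel₀ (norm_ne_zero_iff.2 hv)]
      simp [he] at this
    simp [this, h0]
  · obtain ⟨w, hw, hmin⟩ := (isCompact_sphere (0 : E) 1).exists_isMinOn hne hq.continuousOn
    refine ⟨q w, hpos w (by rintro rfl; simp at hw), fun v => ?_⟩
    rcases eq_or_ne v 0 with rfl | hv
    · simp [h0]
    have hn := norm_ne_zero_iff.2 hv
    have h1 : ‖v‖⁻¹ • v ∈ Metric.sphere (0 : E) 1 := by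
      simp [norm_smul, inv_mul_cancel₀ hn]
    have h2 : q w ≤ q (‖v‖⁻¹ • v) := hmin h1
    rw [hhom] at h2
    calc q w * ‖v‖ ^ 2 ≤ ‖v‖⁻¹ ^ 2 * q v * ‖v‖ ^ 2 := by gcongr
      _ = q v := by field_simp

/-- An isotropic vector of a semidefinite form lies in its kernel: if ⟨Tv, v⟩ = 0, the form at v + t
Tv is 2t‖Tv‖² + O(t²), which must be nonnegative for negative t as well. -/
theorem inner_pos_of_det_ne_zero {T : E →ₗ[ℝ] E} (hT : T.IsSymmetric)
    (hnonneg : ∀ v, 0 ≤ ⟪T v, v⟫) (hdet : LinearMap.det T ≠ 0) {v : E} (hv : v ≠ 0) :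
    0 < ⟪T v, v⟫ := by
  refine lt_of_le_of_ne (hnonneg v) fun h0 => hv ?_
  have hinj : Function.Injective T := (LinearMap.equivOfDetNeZero T hdet).injective
  refine hinj ?_
  rw [map_zero]
  set a := ⟪T v, T v⟫ with ha
  set c := ⟪T (T v), T v⟫ with hc
  have hc0 : 0 ≤ c := hnonneg _
  have ha0 : 0 ≤ a := real_inner_self_nonneg
  have key : ∀ t : ℝ, 0 ≤ 2 * t * a + t ^ 2 * c := by
    intro t
    have h1 := hnonneg (v + t • T v)
    rw [map_add, map_smul, inner_add_left, inner_add_right, inner_add_right, inner_smul_left,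
      inner_smul_left, inner_smul_right, inner_smul_right, hT (T v) v, ← h0] at h1
    simp only [conj_trivial] at h1
    linarith
  -- Near the minimizer -a / c, with the denominator shifted so that c = 0 is allowed.
  have h2 := key (-a / (c + 1))
  have h3 : 2 * (-a / (c + 1)) * a + (-a / (c + 1)) ^ 2 * c = -(a ^ 2 * ((c + 2) / (c + 1) ^ 2)) := by
    field_simp
    ring
  rw [h3] at h2
  have h4 : 0 < (c + 2) / (c + 1) ^ 2 := by positivity
  have h5 : a ^ 2 = 0 := by nlinarith [sq_nonneg a]
  exact inner_self_eq_zero.1 (pow_eq_zero_iff two_ne_zero |>.1 h5)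

end QuadraticForms

/-! ### Continuity of the curvature, and positivity of the second fundamental form. -/

section Convexity

variable {n : ℕ} {K U : Set (EuclideanSpace ℝ (Fin n))} {φ : EuclideanSpace ℝ (Fin n) → ℝ}
  {x : EuclideanSpace ℝ (Fin n)}

/-- The extension of the Weingarten map by the identity on the normal line. -/
def shapeOperator (φ : EuclideanSpace ℝ (Fin n) → ℝ) (x : EuclideanSpace ℝ (Fin n)) :
    EuclideanSpace ℝ (Fin n) →L[ℝ] EuclideanSpace ℝ (Fin n) :=
  (fderiv ℝ (unitGradient φ) x) ∘L
    (ContinuousLinearMap.id ℝ _ - (innerSL ℝ (unitGradient φ x)).smulRight (unitGradient φ x)) +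
    (innerSL ℝ (unitGradient φ x)).smulRight (unitGradient φ x)

theorem shapeOperator_apply (φ : EuclideanSpace ℝ (Fin n) → ℝ) (x v : EuclideanSpace ℝ (Fin n)) :
    shapeOperator φ x v =
      fderiv ℝ (unitGradient φ) x (v - ⟪unitGradient φ x, v⟫ • unitGradient φ x) +
        ⟪unitGradient φ x, v⟫ • unitGradient φ x := by
  simp [shapeOperator]

namespace IsLocalDefiningFn

/-- The Weingarten maps act on tangent spaces that vary with x. Their extensions act on one fixed
space and depend continuously on x, so continuity of κ reduces to continuity of the determinant. -/
theorem gaussCurvature_eq_det (h : IsLocalDefiningFn K U φ) (hc : IsClosed K)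
    (hK : Convex ℝ K) (hx : x ∈ U) (hxK : x ∈ frontier K) :
    gaussCurvature K x = (shapeOperator φ x).det := by
  have hN := h.outerNormal_eq hc hK hx hxK
  have hu := h.norm_unitGradient hx
  refine (det_eq_det_compression (outerNormal K x) (hN ▸ hu) _ _ (fun z => ?_) ?_).symm
  · have hz : ⟪unitGradient φ x, (z : EuclideanSpace ℝ (Fin n))⟫ = 0 := by
      rw [← hN]
      exact Submodule.mem_orthogonal_singleton_iff_inner_right.1 z.2
    rw [h.weingarten_apply hc hK hx hxK, ContinuousLinearMap.coe_coe, shapeOperator_apply, hz]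
    simp
  · rw [hN, ContinuousLinearMap.coe_coe, shapeOperator_apply, real_inner_self_eq_norm_sq, hu]
    simp

theorem continuousOn_shapeOperator (h : IsLocalDefiningFn K U φ) :
    ContinuousOn (shapeOperator φ) U := by
  have h1 : ContinuousOn (fderiv ℝ (unitGradient φ)) U :=
    h.contDiffOn_unitGradient.continuousOn_fderiv_of_isOpen h.isOpen le_rfl
  have h2 : ContinuousOn (unitGradient φ) U := h.contDiffOn_unitGradient.continuousOn
  have h3 : ContinuousOn (fun y => innerSL ℝ (unitGradient φ y)) U :=
    (innerSL ℝ).continuous.comp_continuousOn h2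
  have h4 : ContinuousOn
      (fun y => (innerSL ℝ (unitGradient φ y)).smulRight (unitGradient φ y)) U :=
    ((ContinuousLinearMap.smulRightL ℝ (EuclideanSpace ℝ (Fin n))
      (EuclideanSpace ℝ (Fin n))).continuous.comp_continuousOn h3).clm_apply h2
  exact (h1.clm_comp (continuousOn_const.sub h4)).add h4

end IsLocalDefiningFn

theorem continuousOn_gaussCurvature (hC : HasC2Boundary K) (hc : IsClosed K) (hK : Convex ℝ K) :
    ContinuousOn (gaussCurvature K) (frontier K) := by
  intro x hx
  obtain ⟨U, φ, hxU, h⟩ := hC.exists_isLocalDefiningFn hx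
  have h1 : ContinuousWithinAt (fun y => (shapeOperator φ y).det) (frontier K) x :=
    (ContinuousLinearMap.continuous_det.continuousAt.comp
      (h.continuousOn_shapeOperator.continuousAt (h.isOpen.mem_nhds hxU))).continuousWithinAt
  refine h1.congr_of_eventuallyEq ?_ (h.gaussCurvature_eq_det hc hK hxU hx)
  filter_upwards [mem_nhdsWithin_of_mem_nhds (h.isOpen.mem_nhds hxU), self_mem_nhdsWithin]
    with y hyU hy
  exact h.gaussCurvature_eq_det hc hK hyU hy

theorem continuousOn_outerNormal (hC : HasC2Boundary K) (hc : IsClosed K) (hK : Convex ℝ K) :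
    ContinuousOn (outerNormal K) (frontier K) := by
  intro x hx
  obtain ⟨U, φ, hxU, h⟩ := hC.exists_isLocalDefiningFn hx
  exact (h.hasFDerivWithinAt_outerNormal hc hK hxU hx).continuousWithinAt

theorem norm_outerNormal (hC : HasC2Boundary K) (hc : IsClosed K) (hK : Convex ℝ K)
    (hx : x ∈ frontier K) : ‖outerNormal K x‖ = 1 := by
  obtain ⟨U, φ, hxU, h⟩ := hC.exists_isLocalDefiningFn hx
  rw [h.outerNormal_eq hc hK hxU hx, h.norm_unitGradient hxU]

theorem inner_outerNormal_le (hC : HasC2Boundary K) (hc : IsClosed K) (hK : Convex ℝ K)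
    (hx : x ∈ frontier K) {y : EuclideanSpace ℝ (Fin n)} (hy : y ∈ K) :
    ⟪y, outerNormal K x⟫ ≤ ⟪x, outerNormal K x⟫ := by
  obtain ⟨U, φ, hxU, h⟩ := hC.exists_isLocalDefiningFn hx
  rw [h.outerNormal_eq hc hK hxU hx]
  exact h.inner_unitGradient_le hc hK hxU hx hy

namespace IsLocalDefiningFn

/-- If the Hessian were negative on a tangent vector v, the curve x + t v + δ t² u with small δ > 0
would enter K although it rises above the supporting hyperplane at x. -/
theorem fderiv_fderiv_nonneg (h : IsLocalDefiningFn K U φ) (hc : IsClosed K)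
    (hK : Convex ℝ K) (hx : x ∈ U) (hxK : x ∈ frontier K) {v : EuclideanSpace ℝ (Fin n)}
    (hv : ⟪unitGradient φ x, v⟫ = 0) : 0 ≤ fderiv ℝ (fderiv ℝ φ) x v v := by
  by_contra! hneg
  set B := fderiv ℝ (fderiv ℝ φ) x with hB
  set b := B v v with hb
  set u := unitGradient φ x with hu
  set g := ‖gradient φ x‖ with hg
  have hg0 : 0 < g := norm_pos_iff.2 (h.gradient_ne hx)
  -- With these ε and δ each error term is at most -b/8 at t = 0, against the main term b/2 < 0.
  set ε := -b / (8 * (‖v‖ ^ 2 + 1)) with hε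
  have hε0 : 0 < ε := div_pos (by linarith) (by positivity)
  set δ := -b / (8 * g) with hδ
  have hδ0 : 0 < δ := div_pos (by linarith) (by positivity)
  obtain ⟨r, hr, hrU, hT⟩ := h.exists_ball_taylor hx hε0
  let w : ℝ → EuclideanSpace ℝ (Fin n) := fun t => v + (δ * t) • u
  have hwc : Continuous w := by fun_prop
  have hq : Continuous fun t => g * δ + 1 / 2 * B (w t) (w t) + ε * ‖w t‖ ^ 2 := by fun_prop
  have hq0 : g * δ + 1 / 2 * B (w 0) (w 0) + ε * ‖w 0‖ ^ 2 < 0 := by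
    have h1 : g * δ = -b / 8 := by rw [hδ]; field_simp
    have h2 : ε * ‖v‖ ^ 2 ≤ -b / 8 := by
      rw [hε, div_mul_eq_mul_div, div_le_div_iff₀ (by positivity) (by norm_num)]
      nlinarith
    have h3 : w 0 = v := by simp [w]
    rw [h3, h1, ← hb]
    linarith
  have hz : Continuous fun t : ℝ => x + t • w t := by fun_prop
  have e1 : ∀ᶠ t in 𝓝[>] (0 : ℝ), g * δ + 1 / 2 * B (w t) (w t) + ε * ‖w t‖ ^ 2 < 0 :=
    nhdsWithin_le_nhds (hq.continuousAt.eventually_lt continuousAt_const hq0)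
  have e2 : ∀ᶠ t in 𝓝[>] (0 : ℝ), x + t • w t ∈ Metric.ball x r :=
    nhdsWithin_le_nhds (hz.continuousAt.preimage_mem_nhds
      (by simpa using Metric.ball_mem_nhds x hr))
  obtain ⟨t, ht1, ht2, ht0⟩ := (e1.and (e2.and eventually_mem_nhdsWithin)).exists
  replace ht0 : 0 < t := ht0
  have h4 := (abs_le.1 (hT x (Metric.mem_ball_self hr) _ ht2)).2
  have huu : ⟪u, u⟫ = 1 := by rw [real_inner_self_eq_norm_sq, h.norm_unitGradient hx, one_pow]
  have h5 : ⟪u, t • w t⟫ = δ * t ^ 2 := by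
    simp only [w, inner_smul_right, inner_add_right, hv, huu]
    ring
  have h6 : φ (x + t • w t) ≤ 0 := by
    rw [add_sub_cancel_left, h.apply_eq_zero hc hx hxK, h5, map_smul, map_smul, smul_apply,
      norm_smul, mul_pow] at h4
    simp only [smul_eq_mul, Real.norm_eq_abs, sq_abs] at h4
    have : φ (x + t • w t) ≤
        t ^ 2 * (g * δ + 1 / 2 * B (w t) (w t) + ε * ‖w t‖ ^ 2) := by
      linarith
    nlinarith [sq_nonneg t]
  have h7 := h.inner_unitGradient_le hc hK hx hxK ((h.mem_iff (hrU ht2)).2 h6)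
  rw [inner_add_left, real_inner_comm u (t • w t), h5] at h7
  have : 0 < δ * t ^ 2 := by positivity
  linarith

/-- Convexity gives semidefiniteness, and the nonzero curvature determinant improves it to
definiteness. -/
theorem inner_weingarten_pos (h : IsLocalDefiningFn K U φ) (hc : IsClosed K)
    (hK : Convex ℝ K) (hx : x ∈ U) (hxK : x ∈ frontier K) (hκ : 0 < gaussCurvature K x)
    {v : (ℝ ∙ outerNormal K x)ᗮ} (hv : v ≠ 0) : 0 < ⟪weingarten K x v, v⟫ := by
  refine inner_pos_of_det_ne_zero (h.isSymmetric_weingarten hc hK hx hxK) (fun w => ?_) hκ.ne' hv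
  have hw : ⟪unitGradient φ x, (w : EuclideanSpace ℝ (Fin n))⟫ = 0 := by
    rw [← h.outerNormal_eq hc hK hx hxK]
    exact Submodule.mem_orthogonal_singleton_iff_inner_right.1 w.2
  have h1 := h.fderiv_fderiv_nonneg hc hK hx hxK hw
  rw [h.inner_weingarten hc hK hx hxK] at h1
  exact nonneg_of_mul_nonneg_right h1 (norm_pos_iff.2 (h.gradient_ne hx))

theorem exists_pos_le_fderiv_fderiv (h : IsLocalDefiningFn K U φ) (hc : IsClosed K)
    (hK : Convex ℝ K) (hx : x ∈ U) (hxK : x ∈ frontier K) (hκ : 0 < gaussCurvature K x) :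
    ∃ b > 0, ∀ v, ⟪unitGradient φ x, v⟫ = 0 →
      b * ‖v‖ ^ 2 ≤ fderiv ℝ (fderiv ℝ φ) x v v := by
  obtain ⟨b, hb, h1⟩ := exists_pos_mul_sq_norm_le
    (q := fun v : (ℝ ∙ outerNormal K x)ᗮ => ⟪weingarten K x v, v⟫)
    ((LinearMap.continuous_of_finiteDimensional (weingarten K x)).inner continuous_id)
    (fun t v => by rw [map_smul, inner_smul_left, inner_smul_right]; simp; ring)
    (fun v hv => h.inner_weingarten_pos hc hK hx hxK hκ hv)
  have hg : 0 < ‖gradient φ x‖ := norm_pos_iff.2 (h.gradient_ne hx)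
  refine ⟨‖gradient φ x‖ * b, by positivity, fun v hv => ?_⟩
  have hv' : v ∈ (ℝ ∙ outerNormal K x)ᗮ := by
    rw [Submodule.mem_orthogonal_singleton_iff_inner_right, h.outerNormal_eq hc hK hx hxK, hv]
  have h2 := h.inner_weingarten hc hK hx hxK ⟨v, hv'⟩ ⟨v, hv'⟩
  simp only at h2
  rw [h2, mul_assoc]
  exact mul_le_mul_of_nonneg_left (h1 ⟨v, hv'⟩) hg.le

end IsLocalDefiningFn

end Convexity

/-! ### Uniform outer and inner paraboloids at the boundary. -/

section UniformBounds

variable {n : ℕ} {K U : Set (EuclideanSpace ℝ (Fin n))} {φ : EuclideanSpace ℝ (Fin n) → ℝ}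
  {x : EuclideanSpace ℝ (Fin n)}

namespace IsLocalDefiningFn

theorem continuousAt_norm_gradient (h : IsLocalDefiningFn K U φ) (hx : x ∈ U) :
    ContinuousAt (fun y => ‖gradient φ y‖) x :=
  (h.contDiffOn_gradient.continuousOn.continuousAt (h.isOpen.mem_nhds hx)).norm

/-- Let w = z - y and let s be the depth ⟨y - z, N(y)⟩. Since φ(y) = 0 ≥ φ(z), Taylor's formula at y
bounds ½ B(w, w) by ‖∇φ(y)‖ s plus a small multiple of ‖w‖². The form B dominates ‖w‖² only after
adding a multiple of ⟨N(x), w⟩², but that is 2s² up to another small multiple of ‖w‖². -/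
theorem exists_strongly_convex (h : IsLocalDefiningFn K U φ) (hc : IsClosed K)
    (hK : Convex ℝ K) (hx : x ∈ U) (hxK : x ∈ frontier K) (hκ : 0 < gaussCurvature K x) :
    ∃ c > 0, ∃ r > 0, ∀ y ∈ frontier K ∩ Metric.ball x r, ∀ z ∈ K ∩ Metric.ball x r,
      c * ‖z - y‖ ^ 2 ≤ ⟪y - z, outerNormal K y⟫ := by
  obtain ⟨b, hb, h1⟩ := h.exists_pos_le_fderiv_fderiv hc hK hx hxK hκ
  obtain ⟨m, hm, h2⟩ := exists_quadratic_lower_bound _ (h.norm_unitGradient hx) hb h1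
  set B := fderiv ℝ (fderiv ℝ φ) x with hB
  obtain ⟨r₁, hr₁, hrU, hT⟩ := h.exists_ball_taylor hx (show (0 : ℝ) < b / 16 by positivity)
  set G := ‖gradient φ x‖ + 1 with hG
  have e1 : ∀ᶠ y in 𝓝 x, ‖gradient φ y‖ < G :=
    (h.continuousAt_norm_gradient hx).eventually_lt continuousAt_const (by simp [hG])
  have hNc : ContinuousAt (unitGradient φ) x :=
    h.contDiffOn_unitGradient.continuousOn.continuousAt (h.isOpen.mem_nhds hx)
  have e2 : ∀ᶠ y in 𝓝 x, m * ‖unitGradient φ x - unitGradient φ y‖ ^ 2 < b / 16 := by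
    have : ContinuousAt (fun y => m * ‖unitGradient φ x - unitGradient φ y‖ ^ 2) x := by fun_prop
    exact this.eventually_lt continuousAt_const (by simpa using hb)
  obtain ⟨r₂, hr₂, hr₂'⟩ := Metric.eventually_nhds_iff_ball.1 (e1.and e2)
  -- The bound 1 forces ‖w‖ ≤ 2, hence s ≤ 2 and s² ≤ 2s, so that the quadratic normal term is
  -- absorbed by a linear one.
  set r := min (min r₁ r₂) 1 with hr
  have hr0 : 0 < r := lt_min (lt_min hr₁ hr₂) one_pos
  have hrr₁ : r ≤ r₁ := (min_le_left _ _).trans (min_le_left _ _)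
  have hrr₂ : r ≤ r₂ := (min_le_left _ _).trans (min_le_right _ _)
  refine ⟨b / 8 / (G + 2 * m), by positivity, r, hr0, fun y hy z hz => ?_⟩
  have hyU : y ∈ U := hrU (Metric.ball_subset_ball hrr₁ hy.2)
  have hzU : z ∈ U := hrU (Metric.ball_subset_ball hrr₁ hz.2)
  have hN := h.outerNormal_eq hc hK hyU hy.1
  obtain ⟨hg, hu⟩ := hr₂' y (Metric.ball_subset_ball hrr₂ hy.2)
  have hsup := h.inner_unitGradient_le hc hK hyU hy.1 hz.1
  have hTz := (abs_le.1 (hT y (Metric.ball_subset_ball hrr₁ hy.2) z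
    (Metric.ball_subset_ball hrr₁ hz.2))).1
  rw [h.apply_eq_zero hc hyU hy.1] at hTz
  have hφz := (h.mem_iff hzU).1 hz.1
  rw [hN]
  set w := z - y with hw
  set s := ⟪y - z, unitGradient φ y⟫ with hs
  have hsw : ⟪unitGradient φ y, w⟫ = -s := by
    rw [hs, hw, real_inner_comm, ← inner_neg_left, neg_sub]
  have hs0 : 0 ≤ s := by
    rw [hs, inner_sub_left]
    linarith
  have hwn : ‖w‖ ≤ 2 := by
    have h3 : dist z y ≤ dist z x + dist x y := dist_triangle _ _ _
    have h4 : dist z x < r := hz.2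
    have h5 : dist x y < r := by rw [dist_comm]; exact hy.2
    have h6 : r ≤ 1 := min_le_right _ _
    rw [hw, ← dist_eq_norm]
    linarith
  have hsn : s ≤ ‖w‖ := by
    have := abs_real_inner_le_norm (unitGradient φ y) w
    rw [hsw, abs_neg, abs_of_nonneg hs0, h.norm_unitGradient hyU, one_mul] at this
    exact this
  have hdiff : ⟪unitGradient φ x, w⟫ ^ 2 ≤
      2 * s ^ 2 + 2 * (‖unitGradient φ x - unitGradient φ y‖ ^ 2 * ‖w‖ ^ 2) := by
    have h3 : ⟪unitGradient φ x, w⟫ = -s + ⟪unitGradient φ x - unitGradient φ y, w⟫ := by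
      rw [inner_sub_left, hsw]
      ring
    have h4 := abs_real_inner_le_norm (unitGradient φ x - unitGradient φ y) w
    have h5 : ⟪unitGradient φ x - unitGradient φ y, w⟫ ^ 2 ≤
        ‖unitGradient φ x - unitGradient φ y‖ ^ 2 * ‖w‖ ^ 2 := by
      rw [← mul_pow, ← sq_abs]
      exact pow_le_pow_left₀ (abs_nonneg _) h4 2
    rw [h3]
    nlinarith [sq_nonneg (s + ⟪unitGradient φ x - unitGradient φ y, w⟫)]
  have h7 := h2 w
  rw [hsw] at hTz
  have h8 : m * ⟪unitGradient φ x, w⟫ ^ 2 ≤ 4 * m * s + b / 8 * ‖w‖ ^ 2 := by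
    have h9 : m * s ^ 2 ≤ 2 * m * s := by
      have : s ^ 2 ≤ 2 * s := by nlinarith
      nlinarith
    have h10 : m * ‖unitGradient φ x - unitGradient φ y‖ ^ 2 * ‖w‖ ^ 2 ≤ b / 16 * ‖w‖ ^ 2 := by
      gcongr
    have h11 := mul_le_mul_of_nonneg_left hdiff hm.le
    linarith
  have h12 : ‖gradient φ y‖ * s ≤ G * s := by gcongr
  rw [div_mul_eq_mul_div, div_le_iff₀ (by positivity)]
  nlinarith

/-- The opposite estimate: φ(z) ≤ -‖∇φ(y)‖ s + (‖B‖/2 + 1) ‖z - y‖² by Taylor's formula, with s the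
depth of z below y. Near x the gradient has at least half its norm at x, so the constant c makes
this nonpositive. -/
theorem exists_inner_paraboloid (h : IsLocalDefiningFn K U φ) (hc : IsClosed K)
    (hK : Convex ℝ K) (hx : x ∈ U) :
    ∃ c > 0, ∃ r > 0, ∀ y ∈ frontier K ∩ Metric.ball x r, ∀ z, ‖z - y‖ < r →
      c * ‖z - y‖ ^ 2 ≤ ⟪y - z, outerNormal K y⟫ → z ∈ K := by
  set B := fderiv ℝ (fderiv ℝ φ) x with hB
  obtain ⟨r₁, hr₁, hrU, hT⟩ := h.exists_ball_taylor hx one_pos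
  have hg : 0 < ‖gradient φ x‖ := norm_pos_iff.2 (h.gradient_ne hx)
  obtain ⟨r₂, hr₂, hr₂'⟩ := Metric.eventually_nhds_iff_ball.1
    ((continuousAt_const (y := ‖gradient φ x‖ / 2)).eventually_lt (h.continuousAt_norm_gradient hx)
      (by linarith))
  set r := min (r₁ / 2) r₂ with hr
  refine ⟨(‖B‖ / 2 + 1) / (‖gradient φ x‖ / 2), by positivity, r,
    lt_min (by positivity) hr₂, fun y hy z hz hs => ?_⟩
  have hrr : r ≤ r₁ / 2 := min_le_left _ _
  have hy1 : dist y x < r := hy.2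
  have hyb : y ∈ Metric.ball x r₁ := by
    rw [Metric.mem_ball]
    linarith
  have hzb : z ∈ Metric.ball x r₁ := by
    have h3 : dist z x ≤ dist z y + dist y x := dist_triangle _ _ _
    rw [dist_eq_norm z y] at h3
    rw [Metric.mem_ball]
    linarith
  have hyU := hrU hyb
  have hTz := (abs_le.1 (hT y hyb z hzb)).2
  rw [h.apply_eq_zero hc hyU hy.1] at hTz
  rw [h.outerNormal_eq hc hK hyU hy.1] at hs
  have hgy := hr₂' y (Metric.ball_subset_ball (min_le_right _ _) hy.2)
  rw [h.mem_iff (hrU hzb)]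
  have hsw : ⟪unitGradient φ y, z - y⟫ = -⟪y - z, unitGradient φ y⟫ := by
    rw [real_inner_comm, ← inner_neg_left, neg_sub]
  rw [hsw] at hTz
  set s := ⟪y - z, unitGradient φ y⟫
  have hBw : B (z - y) (z - y) ≤ ‖B‖ * ‖z - y‖ ^ 2 := by
    have := B.le_opNorm₂ (z - y) (z - y)
    rw [mul_assoc, ← sq] at this
    exact (le_abs_self _).trans this
  rw [div_mul_eq_mul_div, div_le_iff₀ (by positivity)] at hs
  have hs0 : 0 ≤ s := by
    have : 0 ≤ (‖B‖ / 2 + 1) * ‖z - y‖ ^ 2 := by positivity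
    by_contra! hcon
    nlinarith
  nlinarith

end IsLocalDefiningFn

/-- `K` is uniformly strongly convex at its boundary points. -/
theorem IsC2Plus.exists_strongly_convex (hC : IsC2Plus K) (hcomp : IsCompact K)
    (hK : Convex ℝ K) :
    ∃ c > 0, ∀ y ∈ frontier K, ∀ z ∈ K, c * ‖z - y‖ ^ 2 ≤ ⟪y - z, outerNormal K y⟫ := by
  have hc := hcomp.isClosed
  obtain ⟨D, hD⟩ := Metric.isBounded_iff.1 hcomp.isBounded
  have hloc : ∀ x ∈ frontier K, ∃ t ∈ 𝓝[frontier K] x, ∃ c > 0, ∀ y ∈ frontier K ∩ t, ∀ z ∈ K,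
      c * ‖z - y‖ ^ 2 ≤ ⟪y - z, outerNormal K y⟫ := by
    intro x hx
    obtain ⟨U, φ, hxU, h⟩ := hC.c2.exists_isLocalDefiningFn hx
    obtain ⟨c, hc0, r, hr, h1⟩ := h.exists_strongly_convex hc hK hxU hx (hC.curvature_pos x hx)
    have hD0 : 0 ≤ D := dist_nonneg.trans (hD (hc.frontier_subset hx) (hc.frontier_subset hx))
    -- A distant z is moved towards y into the ball where the local estimate holds. The depth scales
    -- by t and the squared distance by t², so the constant only loses the factor t.
    set t := min 1 (r / (2 * (D + 1))) with ht
    have ht0 : 0 < t := lt_min one_pos (by positivity)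
    refine ⟨_, mem_nhdsWithin_of_mem_nhds (Metric.ball_mem_nhds x (half_pos hr)), c * t,
      by positivity, fun y hy z hz => ?_⟩
    have hyK := hc.frontier_subset hy.1
    have hz' : y + t • (z - y) ∈ K := hK.add_smul_sub_mem hyK hz ⟨ht0.le, min_le_left _ _⟩
    have hdist : ‖t • (z - y)‖ < r / 2 := by
      rw [norm_smul, Real.norm_of_nonneg ht0.le, ← dist_eq_norm]
      calc t * dist z y ≤ (r / (2 * (D + 1))) * D := by
            gcongr
            · exact min_le_right _ _
            · exact hD hz hyK
        _ < r / 2 := by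
          rw [div_mul_eq_mul_div, div_lt_div_iff₀ (by positivity) (by positivity)]
          nlinarith
    have hyx : dist y x < r / 2 := hy.2
    have hb : y + t • (z - y) ∈ Metric.ball x r := by
      rw [Metric.mem_ball]
      have h3 := dist_triangle (y + t • (z - y)) y x
      rw [dist_eq_norm (y + t • (z - y)) y, add_sub_cancel_left] at h3
      linarith
    have h2 := h1 y ⟨hy.1, by rw [Metric.mem_ball]; linarith⟩ _ ⟨hz', hb⟩
    rw [add_sub_cancel_left, norm_smul, Real.norm_of_nonneg ht0.le,
      show y - (y + t • (z - y)) = t • (y - z) by module, inner_smul_left] at h2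
    simp only [conj_trivial] at h2
    have h4 : t * (c * t * ‖z - y‖ ^ 2) ≤ t * ⟪y - z, outerNormal K y⟫ := by
      calc _ = c * (t * ‖z - y‖) ^ 2 := by ring
        _ ≤ _ := h2
    exact le_of_mul_le_mul_left h4 ht0
  have hcf : IsCompact (frontier K) := hcomp.of_isClosed_subset isClosed_frontier hc.frontier_subset
  have := hcf.induction_on (p := fun t => ∃ c > 0, ∀ y ∈ frontier K ∩ t, ∀ z ∈ K,
      c * ‖z - y‖ ^ 2 ≤ ⟪y - z, outerNormal K y⟫)
    ⟨1, one_pos, by simp⟩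
    (fun s t hst ⟨c, hc0, h⟩ => ⟨c, hc0, fun y hy => h y ⟨hy.1, hst hy.2⟩⟩)
    (fun s t ⟨c, hc0, h⟩ ⟨c', hc0', h'⟩ => ⟨min c c', lt_min hc0 hc0', fun y hy z hz => by
      rcases hy.2 with hs | hs
      · exact (mul_le_mul_of_nonneg_right (min_le_left _ _) (sq_nonneg _)).trans
          (h y ⟨hy.1, hs⟩ z hz)
      · exact (mul_le_mul_of_nonneg_right (min_le_right _ _) (sq_nonneg _)).trans
          (h' y ⟨hy.1, hs⟩ z hz)⟩)
    hloc
  simpa using this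

/-- `K` contains a piece of a paraboloid of uniform shape at each of its boundary points. -/
theorem HasC2Boundary.exists_inner_paraboloid (hC : HasC2Boundary K) (hcomp : IsCompact K)
    (hK : Convex ℝ K) :
    ∃ c > 0, ∃ r > 0, ∀ y ∈ frontier K, ∀ z, ‖z - y‖ < r →
      c * ‖z - y‖ ^ 2 ≤ ⟪y - z, outerNormal K y⟫ → z ∈ K := by
  have hc := hcomp.isClosed
  have hcf : IsCompact (frontier K) := hcomp.of_isClosed_subset isClosed_frontier hc.frontier_subset
  have := hcf.induction_on (p := fun t => ∃ c > 0, ∃ r > 0, ∀ y ∈ frontier K ∩ t, ∀ z,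
      ‖z - y‖ < r → c * ‖z - y‖ ^ 2 ≤ ⟪y - z, outerNormal K y⟫ → z ∈ K)
    ⟨1, one_pos, 1, one_pos, by simp⟩
    (fun s t hst ⟨c, hc0, r, hr, h⟩ => ⟨c, hc0, r, hr, fun y hy => h y ⟨hy.1, hst hy.2⟩⟩)
    (fun s t ⟨c, hc0, r, hr, h⟩ ⟨c', hc0', r', hr', h'⟩ => ⟨max c c', lt_max_of_lt_left hc0,
      min r r', lt_min hr hr', fun y hy z hz hs => by
        rcases hy.2 with ht | ht
        · exact h y ⟨hy.1, ht⟩ z (hz.trans_le (min_le_left _ _))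
            ((mul_le_mul_of_nonneg_right (le_max_left _ _) (sq_nonneg _)).trans hs)
        · exact h' y ⟨hy.1, ht⟩ z (hz.trans_le (min_le_right _ _))
            ((mul_le_mul_of_nonneg_right (le_max_right _ _) (sq_nonneg _)).trans hs)⟩)
    (fun x hx => by
      obtain ⟨U, φ, hxU, h⟩ := hC.exists_isLocalDefiningFn hx
      obtain ⟨c, hc0, r, hr, h1⟩ := h.exists_inner_paraboloid hc hK hxU
      exact ⟨_, mem_nhdsWithin_of_mem_nhds (Metric.ball_mem_nhds x hr), c, hc0, r, hr, h1⟩)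
  simpa using this

end UniformBounds

/-! ### The inverse Gauss map and continuity of the data on the sphere. -/

section Contact

variable {n : ℕ} {K : Set (EuclideanSpace ℝ (Fin n))} {u v x : EuclideanSpace ℝ (Fin n)}

/-- Symmetric convex bodies of class `C^2_+`. -/
structure IsSymmC2PlusBody (K : Set (EuclideanSpace ℝ (Fin n))) : Prop where
  isCompact : IsCompact K
  convex : Convex ℝ K
  interior_nonempty : (interior K).Nonempty
  neg_mem : ∀ x ∈ K, -x ∈ K
  isC2Plus : IsC2Plus K

/-- The boundary point with outer unit normal `u`. -/
def contact (K : Set (EuclideanSpace ℝ (Fin n))) (u : EuclideanSpace ℝ (Fin n)) :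
    EuclideanSpace ℝ (Fin n) :=
  Function.invFunOn (outerNormal K) (frontier K) u

namespace IsSymmC2PlusBody

theorem isClosed (h : IsSymmC2PlusBody K) : IsClosed K := h.isCompact.isClosed

theorem zero_mem_interior (h : IsSymmC2PlusBody K) : (0 : EuclideanSpace ℝ (Fin n)) ∈ interior K := by
  obtain ⟨x, hx⟩ := h.interior_nonempty
  have h1 := h.convex.combo_interior_closure_mem_interior hx
    (subset_closure (h.neg_mem x (interior_subset hx))) (a := 1 / 2) (b := 1 / 2)
    (by norm_num) (by norm_num) (by norm_num)
  simpa using h1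

theorem exists_outerNormal_eq (h : IsSymmC2PlusBody K) (hu : ‖u‖ = 1) :
    ∃ x ∈ frontier K, outerNormal K x = u := by
  obtain ⟨x, hxK, hmax⟩ := h.isCompact.exists_isMaxOn ⟨0, interior_subset h.zero_mem_interior⟩
    (f := fun y => ⟪y, u⟫) (by fun_prop)
  have hxf : x ∈ frontier K := by
    refine ⟨subset_closure hxK, fun hint => ?_⟩
    have hline : Tendsto (fun t : ℝ => x + t • u) (𝓝[>] 0) (𝓝 x) := by
      have : Continuous fun t : ℝ => x + t • u := by fun_prop
      simpa using (this.tendsto 0).mono_left (nhdsWithin_le_nhds (s := Ioi 0))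
    obtain ⟨t, ht, ht0⟩ := ((hline.eventually (mem_interior_iff_mem_nhds.1 hint)).and
      eventually_mem_nhdsWithin).exists
    have h1 : ⟪x + t • u, u⟫ ≤ ⟪x, u⟫ := hmax ht
    rw [inner_add_left, inner_smul_left, real_inner_self_eq_norm_sq, hu] at h1
    have h2 : 0 < t := ht0
    simp at h1
    linarith
  obtain ⟨U, φ, hxU, hd⟩ := h.isC2Plus.c2.exists_isLocalDefiningFn hxf
  refine ⟨x, hxf, ?_⟩
  rw [hd.outerNormal_eq h.isClosed h.convex hxU hxf]
  exact (hd.eq_unitGradient h.isClosed hxU hxf hu fun y hy => hmax hy).symm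

theorem contact_mem (h : IsSymmC2PlusBody K) (hu : ‖u‖ = 1) : contact K u ∈ frontier K :=
  Function.invFunOn_mem (h.exists_outerNormal_eq hu)

theorem outerNormal_contact (h : IsSymmC2PlusBody K) (hu : ‖u‖ = 1) :
    outerNormal K (contact K u) = u :=
  Function.invFunOn_eq (h.exists_outerNormal_eq hu)

/-- Add the strong convexity inequalities at x and at y: with a common normal the right-hand sides
cancel. -/
theorem injOn_outerNormal (h : IsSymmC2PlusBody K) : InjOn (outerNormal K) (frontier K) := by
  obtain ⟨c, hc, hs⟩ := h.isC2Plus.exists_strongly_convex h.isCompact h.convex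
  intro x hx y hy hxy
  have h1 := hs x hx y (h.isClosed.frontier_subset hy)
  have h2 := hs y hy x (h.isClosed.frontier_subset hx)
  rw [← hxy] at h2
  rw [inner_sub_left] at h1 h2
  rw [norm_sub_rev] at h2
  have h3 : ‖y - x‖ ^ 2 = 0 := by
    have := sq_nonneg ‖y - x‖
    nlinarith
  exact (sub_eq_zero.1 (norm_eq_zero.1 (pow_eq_zero_iff two_ne_zero |>.1 h3))).symm

theorem contact_outerNormal (h : IsSymmC2PlusBody K) (hx : x ∈ frontier K) :
    contact K (outerNormal K x) = x :=
  have hu := norm_outerNormal h.isC2Plus.c2 h.isClosed h.convex hx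
  h.injOn_outerNormal (h.contact_mem hu) hx (h.outerNormal_contact hu)

theorem inner_le_inner_contact (h : IsSymmC2PlusBody K) (hu : ‖u‖ = 1) (hx : x ∈ K) :
    ⟪x, u⟫ ≤ ⟪contact K u, u⟫ := by
  have := inner_outerNormal_le h.isC2Plus.c2 h.isClosed h.convex (h.contact_mem hu) hx
  rwa [h.outerNormal_contact hu] at this

theorem supportFn_eq (h : IsSymmC2PlusBody K) (hu : ‖u‖ = 1) :
    supportFn K u = ⟪contact K u, u⟫ :=
  IsGreatest.csSup_eq ⟨⟨_, h.isClosed.frontier_subset (h.contact_mem hu), rfl⟩, by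
    rintro _ ⟨y, hy, rfl⟩
    exact h.inner_le_inner_contact hu hy⟩

theorem bddAbove_image_inner (h : IsSymmC2PlusBody K) (u : EuclideanSpace ℝ (Fin n)) :
    BddAbove ((fun x => ⟪x, u⟫) '' K) :=
  (h.isCompact.image (by fun_prop)).bddAbove

theorem inner_le_supportFn (h : IsSymmC2PlusBody K) (hx : x ∈ K) : ⟪x, u⟫ ≤ supportFn K u :=
  le_csSup (h.bddAbove_image_inner u) ⟨x, hx, rfl⟩

theorem exists_pos_le_supportFn (h : IsSymmC2PlusBody K) :
    ∃ r > 0, ∀ u, ‖u‖ = 1 → r ≤ supportFn K u := by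
  obtain ⟨r, hr, hb⟩ := Metric.isOpen_iff.1 isOpen_interior _ h.zero_mem_interior
  refine ⟨r / 2, by positivity, fun u hu => ?_⟩
  have h1 : (r / 2) • u ∈ K := interior_subset (hb (by
    simp [norm_smul, hu, abs_of_pos hr, hr]))
  have h2 := h.inner_le_supportFn h1 (u := u)
  rw [inner_smul_left, real_inner_self_eq_norm_sq, hu] at h2
  simpa using h2

theorem supportFn_pos (h : IsSymmC2PlusBody K) (hu : ‖u‖ = 1) : 0 < supportFn K u := by
  obtain ⟨r, hr, h1⟩ := h.exists_pos_le_supportFn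
  exact hr.trans_le (h1 u hu)

theorem exists_supportFn_le (h : IsSymmC2PlusBody K) :
    ∃ R > 0, ∀ u, ‖u‖ = 1 → supportFn K u ≤ R := by
  obtain ⟨R, hR, hb⟩ := h.isCompact.isBounded.exists_pos_norm_le
  refine ⟨R, hR, fun u hu => ?_⟩
  rw [h.supportFn_eq hu]
  refine (real_inner_le_norm _ _).trans ?_
  rw [hu, mul_one]
  exact hb _ (h.isClosed.frontier_subset (h.contact_mem hu))

/-- Adding the strong convexity inequalities at both contact points gives 2c‖d‖² ≤ ⟨d, u - v⟩ for
their difference d, which is a Lipschitz bound with constant 1/(2c). -/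
theorem continuousOn_contact (h : IsSymmC2PlusBody K) :
    ContinuousOn (contact K) (Metric.sphere 0 1) := by
  obtain ⟨c, hc, hs⟩ := h.isC2Plus.exists_strongly_convex h.isCompact h.convex
  have hl : LipschitzOnWith (Real.toNNReal (1 / (2 * c))) (contact K) (Metric.sphere 0 1) := by
    refine LipschitzOnWith.of_dist_le_mul fun u hu v hv => ?_
    replace hu : ‖u‖ = 1 := by simpa using hu
    replace hv : ‖v‖ = 1 := by simpa using hv
    have h1 := hs _ (h.contact_mem hu) _ (h.isClosed.frontier_subset (h.contact_mem hv))
    have h2 := hs _ (h.contact_mem hv) _ (h.isClosed.frontier_subset (h.contact_mem hu))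
    rw [h.outerNormal_contact hu] at h1
    rw [h.outerNormal_contact hv] at h2
    rw [Real.coe_toNNReal _ (by positivity), dist_eq_norm, dist_eq_norm]
    set d := contact K u - contact K v with hd
    have h3 : 2 * c * ‖d‖ ^ 2 ≤ ⟪d, u - v⟫ := by
      rw [norm_sub_rev, ← hd] at h1
      rw [← neg_sub (contact K u), ← hd, inner_neg_left] at h2
      rw [inner_sub_right]
      linarith
    have h4 : 2 * c * ‖d‖ ^ 2 ≤ ‖d‖ * ‖u - v‖ := h3.trans (real_inner_le_norm _ _)
    rw [div_mul_eq_mul_div, le_div_iff₀ (by positivity), one_mul]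
    by_contra! hcon
    have h5 : 0 < ‖d‖ := by
      by_contra! h6
      have h7 : ‖d‖ = 0 := le_antisymm h6 (norm_nonneg _)
      rw [h7, zero_mul] at hcon
      exact absurd hcon (norm_nonneg _).not_gt
    nlinarith
  exact hl.continuousOn

theorem continuousOn_supportFn (h : IsSymmC2PlusBody K) :
    ContinuousOn (supportFn K) (Metric.sphere 0 1) :=
  (h.continuousOn_contact.inner continuousOn_id).congr fun u hu => by
    simpa using h.supportFn_eq (by simpa using hu)

theorem curvatureFn_eq (K : Set (EuclideanSpace ℝ (Fin n))) (u : EuclideanSpace ℝ (Fin n)) :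
    curvatureFn K u = (gaussCurvature K (contact K u))⁻¹ := rfl

theorem curvatureFn_pos (h : IsSymmC2PlusBody K) (hu : ‖u‖ = 1) : 0 < curvatureFn K u :=
  inv_pos.2 (h.isC2Plus.curvature_pos _ (h.contact_mem hu))

theorem continuousOn_curvatureFn (h : IsSymmC2PlusBody K) :
    ContinuousOn (curvatureFn K) (Metric.sphere 0 1) := by
  refine ContinuousOn.inv₀ ?_ fun u hu =>
    (h.isC2Plus.curvature_pos _ (h.contact_mem (by simpa using hu))).ne'
  exact (continuousOn_gaussCurvature h.isC2Plus.c2 h.isClosed h.convex).comp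
    h.continuousOn_contact fun u hu => h.contact_mem (by simpa using hu)

theorem continuousOn_sphereIntegrand (h : IsSymmC2PlusBody K) :
    ContinuousOn (sphereIntegrand K) (Metric.sphere 0 1) := by
  have h1 := h.continuousOn_supportFn
  have h2 := h.continuousOn_curvatureFn
  have h3 : ∀ u ∈ Metric.sphere (0 : EuclideanSpace ℝ (Fin n)) 1, 0 < supportFn K u :=
    fun u hu => h.supportFn_pos (by simpa using hu)
  have h4 : ∀ u ∈ Metric.sphere (0 : EuclideanSpace ℝ (Fin n)) 1, 0 < curvatureFn K u :=
    fun u hu => h.curvatureFn_pos (by simpa using hu)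
  refine ((h1.pow n).inv₀ fun u hu => (pow_pos (h3 u hu) n).ne').mul (ContinuousOn.log ?_ ?_)
  · exact (continuousOn_const.mul (h1.pow _)).mul h2
  · intro u hu
    have := h3 u hu
    have := h4 u hu
    positivity

end IsSymmC2PlusBody

end Contact

/-! ### Anisotropic scaling and elementary exponential estimates. -/

section Scaling

theorem integral_comp_scale_prod {F : Type*} [NormedAddCommGroup F] [InnerProductSpace ℝ F]
    [FiniteDimensional ℝ F] [MeasurableSpace F] [BorelSpace F] (f : F × ℝ → ℝ) {a b : ℝ}
    (ha : 0 < a) (hb : 0 < b) :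
    ∫ w : F × ℝ, f (a • w.1, b * w.2) = (a ^ Module.finrank ℝ F * b)⁻¹ * ∫ w, f w := by
  set T : (F × ℝ) →ₗ[ℝ] (F × ℝ) :=
    LinearMap.prodMap (a • LinearMap.id) (b • LinearMap.id) with hT
  have hdet : LinearMap.det T = a ^ Module.finrank ℝ F * b := by
    rw [hT, LinearMap.det_prodMap, LinearMap.det_smul, LinearMap.det_smul]
    simp
  have hpos : 0 < a ^ Module.finrank ℝ F * b := by positivity
  have hne : LinearMap.det T ≠ 0 := by rw [hdet]; exact hpos.ne'
  have : (volume : Measure (F × ℝ)).IsAddHaarMeasure :=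
    Measure.prod.instIsAddHaarMeasure volume volume
  have hmap := Measure.map_linearMap_addHaar_eq_smul_addHaar (volume : Measure (F × ℝ)) hne
  have hemb : MeasurableEmbedding T :=
    (LinearMap.equivOfDetNeZero T hne).toContinuousLinearEquiv.toHomeomorph.measurableEmbedding
  have h1 : ∫ w, f (T w) = ∫ w, f w ∂(Measure.map T volume) := (hemb.integral_map f).symm
  rw [hmap, integral_smul_measure, hdet, ENNReal.toReal_ofReal (abs_nonneg _),
    abs_of_pos (inv_pos.2 hpos)] at h1
  simpa [hT] using h1

theorem max_one_sub_div_rpow_le_exp {p : ℝ} (hp : 0 < p) (t : ℝ) :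
    (max (1 - t / p) 0) ^ p ≤ Real.exp (-t) := by
  have h1 : max (1 - t / p) 0 ≤ Real.exp (-(t / p)) :=
    max_le (Real.one_sub_le_exp_neg _) (Real.exp_pos _).le
  calc (max (1 - t / p) 0) ^ p ≤ (Real.exp (-(t / p))) ^ p :=
        Real.rpow_le_rpow (le_max_right _ _) h1 hp.le
    _ = Real.exp (-t) := by
      rw [← Real.exp_mul]
      congr 1
      field_simp

theorem tendsto_max_one_sub_div_rpow (t : ℝ) :
    Tendsto (fun p : ℝ => (max (1 - t / p) 0) ^ p) atTop (𝓝 (Real.exp (-t))) := by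
  refine (Real.tendsto_one_add_div_rpow_exp (-t)).congr' ?_
  filter_upwards [eventually_gt_atTop 0, eventually_gt_atTop t] with p hp hpt
  have h1 : 0 ≤ 1 - t / p := by
    rw [sub_nonneg, div_le_one hp]
    exact hpt.le
  rw [max_eq_left h1, neg_div, ← sub_eq_add_neg]

theorem exp_neg_two_mul_le_one_sub {t : ℝ} (h0 : 0 ≤ t) (h1 : t ≤ 1 / 2) :
    Real.exp (-(2 * t)) ≤ 1 - t := by
  have h2 := Real.add_one_le_exp (2 * t)
  rw [Real.exp_neg, inv_le_comm₀ (Real.exp_pos _) (by linarith)]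
  refine le_trans ?_ h2
  rw [inv_le_iff_one_le_mul₀ (by linarith)]
  nlinarith

end Scaling

/-! ### The rescaled moment integrand and its dominating function. -/

section Laplace

variable {n : ℕ} {K : Set (EuclideanSpace ℝ (Fin n))} {u : EuclideanSpace ℝ (Fin n)}

/-- The moments of `⟨x, u⟩ / h_K(u)`, rescaled to have a positive finite limit. -/
def scaledMoment (K : Set (EuclideanSpace ℝ (Fin n))) (u : EuclideanSpace ℝ (Fin n)) (p : ℝ) : ℝ :=
  p ^ ((n + 1 : ℝ) / 2) * ∫ x in K, (|⟪x, u⟫| / supportFn K u) ^ p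

/-- The integrand of `scaledMoment` near the contact point, in parabolic coordinates. -/
def rescaledIntegrand (K : Set (EuclideanSpace ℝ (Fin n))) (u : EuclideanSpace ℝ (Fin n))
    (hu : ‖u‖ = 1) (p : ℝ) : (ℝ ∙ u)ᗮ × ℝ → ℝ :=
  indicator {w | contact K u + splitEquiv u hu ((√p)⁻¹ • w.1, p⁻¹ * w.2) ∈ K}
    fun w => (max (1 - (w.2 / supportFn K u) / p) 0) ^ p

theorem rescaledIntegrand_of_mem (hu : ‖u‖ = 1) {p : ℝ} {w : (ℝ ∙ u)ᗮ × ℝ}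
    (hw : contact K u + splitEquiv u hu ((√p)⁻¹ • w.1, p⁻¹ * w.2) ∈ K) :
    rescaledIntegrand K u hu p w = (max (1 - (w.2 / supportFn K u) / p) 0) ^ p :=
  if_pos hw

theorem rescaledIntegrand_of_notMem (hu : ‖u‖ = 1) {p : ℝ} {w : (ℝ ∙ u)ᗮ × ℝ}
    (hw : contact K u + splitEquiv u hu ((√p)⁻¹ • w.1, p⁻¹ * w.2) ∉ K) :
    rescaledIntegrand K u hu p w = 0 :=
  if_neg hw

theorem rescaledIntegrand_nonneg (hu : ‖u‖ = 1) (p : ℝ) (w : (ℝ ∙ u)ᗮ × ℝ) :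
    0 ≤ rescaledIntegrand K u hu p w :=
  indicator_nonneg (fun _ _ => Real.rpow_nonneg (le_max_right _ _) _) w

namespace IsSymmC2PlusBody

/-- The reflection x ↦ -x exchanges the two half-spaces, so only the contact point in the direction
u has to be studied. -/
theorem setIntegral_abs_inner_rpow (h : IsSymmC2PlusBody K) {p : ℝ} (hp : 0 < p) (s : ℝ) :
    ∫ x in K, (|⟪x, u⟫| / s) ^ p = 2 * ∫ x in K, (max ⟪x, u⟫ 0 / s) ^ p := by
  have hsplit : ∀ t : ℝ, (|t| / s) ^ p = (max t 0 / s) ^ p + (max (-t) 0 / s) ^ p := by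
    intro t
    rcases le_total 0 t with ht | ht
    · rw [abs_of_nonneg ht, max_eq_left ht, max_eq_right (by linarith), zero_div,
        Real.zero_rpow hp.ne', add_zero]
    · rw [abs_of_nonpos ht, max_eq_right ht, max_eq_left (by linarith), zero_div,
        Real.zero_rpow hp.ne', zero_add]
  have hc : ∀ θ : EuclideanSpace ℝ (Fin n),
      Continuous fun x : EuclideanSpace ℝ (Fin n) => (max ⟪x, θ⟫ 0 / s) ^ p := by
    intro θ
    exact (by fun_prop : Continuous fun x : EuclideanSpace ℝ (Fin n) =>
      max ⟪x, θ⟫ 0 / s).rpow_const fun _ => Or.inr hp.le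
  have hi : ∀ θ : EuclideanSpace ℝ (Fin n), IntegrableOn (fun x => (max ⟪x, θ⟫ 0 / s) ^ p) K :=
    fun θ => (hc θ).continuousOn.integrableOn_compact h.isCompact
  have hneg : ∫ x in K, (max (-⟪x, u⟫) 0 / s) ^ p = ∫ x in K, (max ⟪x, u⟫ 0 / s) ^ p := by
    rw [← integral_indicator h.isClosed.measurableSet, ← integral_indicator
      h.isClosed.measurableSet, ← integral_neg_eq_self]
    congr 1
    ext x
    by_cases hx : x ∈ K
    · rw [indicator_of_mem (h.neg_mem x hx), indicator_of_mem hx]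
      simp
    · rw [indicator_of_notMem (fun hx' => hx (by simpa using h.neg_mem _ hx')),
        indicator_of_notMem hx]
  have hi' : IntegrableOn (fun x => (max (-⟪x, u⟫) 0 / s) ^ p) K := by
    simpa [inner_neg_right] using hi (-u)
  simp_rw [hsplit]
  rw [integral_add (hi u) hi', hneg, two_mul]

/-- At x₀ + z/√p - (s/p) u the quotient ⟨x, u⟩ / h is 1 - s/(hp), and the Jacobian p^{-(n-1)/2} ·
p^{-1} cancels the prefactor p^{(n+1)/2}. -/
theorem scaledMoment_eq (h : IsSymmC2PlusBody K) (hu : ‖u‖ = 1) {p : ℝ} (hp : 0 < p) :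
    scaledMoment K u p = 2 * ∫ w, rescaledIntegrand K u hu p w := by
  have hs := h.supportFn_pos hu
  set x₀ := contact K u with hx₀
  have hfr : Module.finrank ℝ (ℝ ∙ u)ᗮ + 1 = n := by
    simpa using finrank_orthogonal_unit u hu
  set f : (ℝ ∙ u)ᗮ × ℝ → ℝ := fun w =>
    indicator K (fun x => (max ⟪x, u⟫ 0 / supportFn K u) ^ p) (x₀ + splitEquiv u hu w) with hf
  have h1 : ∫ w, f w = ∫ x in K, (max ⟪x, u⟫ 0 / supportFn K u) ^ p := by
    rw [hf, (measurePreserving_splitEquiv u hu).integral_comp (measurableEmbedding_splitEquiv u hu)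
      (fun y => indicator K (fun x => (max ⟪x, u⟫ 0 / supportFn K u) ^ p) (x₀ + y)),
      integral_add_left_eq_self (fun y => indicator K (fun x =>
        (max ⟪x, u⟫ 0 / supportFn K u) ^ p) y), integral_indicator h.isClosed.measurableSet]
  have h2 : rescaledIntegrand K u hu p = fun w => f ((√p)⁻¹ • w.1, p⁻¹ * w.2) := by
    funext w
    simp only [rescaledIntegrand, hf, indicator, mem_ofPred_eq, ← hx₀]
    congr 2
    rw [inner_add_left, inner_splitEquiv, ← h.supportFn_eq hu, ← max_div_div_right hs.le, zero_div]
    congr 1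
    field_simp
    ring
  have hp' : 0 < √p := Real.sqrt_pos.2 hp
  rw [h2, integral_comp_scale_prod f (inv_pos.2 hp') (inv_pos.2 hp), h1, scaledMoment,
    h.setIntegral_abs_inner_rpow hp]
  have h3 : p ^ ((n + 1 : ℝ) / 2) = ((√p)⁻¹ ^ Module.finrank ℝ (ℝ ∙ u)ᗮ * p⁻¹)⁻¹ := by
    have hn : (n : ℝ) = Module.finrank ℝ (ℝ ∙ u)ᗮ + 1 := by exact_mod_cast hfr.symm
    rw [mul_inv, inv_inv, inv_pow, inv_inv, Real.sqrt_eq_rpow, ← Real.rpow_natCast,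
      ← Real.rpow_mul hp.le, hn]
    nth_rw 3 [← Real.rpow_one p]
    rw [← Real.rpow_add hp]
    congr 1
    ring
  rw [h3]
  ring

theorem measurable_rescaledIntegrand (h : IsSymmC2PlusBody K) (hu : ‖u‖ = 1) (p : ℝ) :
    Measurable (rescaledIntegrand K u hu p) := by
  have hc : Continuous fun w : (ℝ ∙ u)ᗮ × ℝ =>
      contact K u + splitEquiv u hu ((√p)⁻¹ • w.1, p⁻¹ * w.2) :=
    continuous_const.add ((continuous_splitEquiv u hu).comp (by fun_prop))
  exact Measurable.indicator (by fun_prop) (hc.measurable h.isClosed.measurableSet)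

/-- Strong convexity at the contact point reads c (‖z‖²/p + s²/p²) ≤ s/p in these coordinates;
multiplication by p leaves a region that does not depend on p, hence a dominating function. -/
theorem rescaledIntegrand_le (h : IsSymmC2PlusBody K) (hu : ‖u‖ = 1) {c : ℝ} (hc : 0 < c)
    (hs : ∀ y ∈ frontier K, ∀ z ∈ K, c * ‖z - y‖ ^ 2 ≤ ⟪y - z, outerNormal K y⟫) {p : ℝ}
    (hp : 0 < p) (w : (ℝ ∙ u)ᗮ × ℝ) :
    rescaledIntegrand K u hu p w ≤ indicator {w : (ℝ ∙ u)ᗮ × ℝ | c * ‖w.1‖ ^ 2 ≤ w.2}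
      (fun w => Real.exp (-(w.2 / supportFn K u))) w := by
  by_cases hw : contact K u + splitEquiv u hu ((√p)⁻¹ • w.1, p⁻¹ * w.2) ∈ K
  · have h1 := hs _ (h.contact_mem hu) _ hw
    have hp' : 0 < √p := Real.sqrt_pos.2 hp
    rw [h.outerNormal_contact hu, add_sub_cancel_left, sub_add_cancel_left, inner_neg_left,
      inner_splitEquiv, neg_neg, norm_sq_splitEquiv] at h1
    simp only [norm_smul, norm_inv, Real.norm_of_nonneg hp'.le, mul_pow, inv_pow,
      Real.sq_sqrt hp.le] at h1
    have h2 : c * ‖w.1‖ ^ 2 ≤ w.2 := by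
      have h3 : c * (p⁻¹ * ‖w.1‖ ^ 2) ≤ p⁻¹ * w.2 := by
        refine le_trans ?_ h1
        have : 0 ≤ (p ^ 2)⁻¹ * w.2 ^ 2 := by positivity
        gcongr
        linarith
      have h4 := mul_le_mul_of_nonneg_left h3 hp.le
      calc c * ‖w.1‖ ^ 2 = p * (c * (p⁻¹ * ‖w.1‖ ^ 2)) := by field_simp
        _ ≤ p * (p⁻¹ * w.2) := h4
        _ = w.2 := by field_simp
    rw [rescaledIntegrand_of_mem hu hw,
      indicator_of_mem (s := {w : (ℝ ∙ u)ᗮ × ℝ | c * ‖w.1‖ ^ 2 ≤ w.2}) h2]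
    exact max_one_sub_div_rpow_le_exp hp _
  · rw [rescaledIntegrand_of_notMem hu hw]
    exact indicator_nonneg (fun _ _ => (Real.exp_pos _).le) w

end IsSymmC2PlusBody

end Laplace

/-! ### The pointwise limit of the scaled moments. -/

section LaplaceLimit

variable {n : ℕ} {K : Set (EuclideanSpace ℝ (Fin n))} {u : EuclideanSpace ℝ (Fin n)}

namespace IsSymmC2PlusBody

theorem exists_weingarten_compression (h : IsSymmC2PlusBody K) (hu : ‖u‖ = 1) :
    ∃ T : (ℝ ∙ u)ᗮ →ₗ[ℝ] (ℝ ∙ u)ᗮ, T.IsSymmetric ∧ (∀ v, v ≠ 0 → 0 < ⟪T v, v⟫) ∧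
      LinearMap.det T = gaussCurvature K (contact K u) ∧
      ∃ U φ, contact K u ∈ U ∧ IsLocalDefiningFn K U φ ∧ unitGradient φ (contact K u) = u ∧
        ∀ v w : (ℝ ∙ u)ᗮ, fderiv ℝ (fderiv ℝ φ) (contact K u) v w =
          ‖gradient φ (contact K u)‖ * ⟪T v, w⟫ := by
  have hx := h.contact_mem hu
  obtain ⟨U, φ, hxU, hd⟩ := h.isC2Plus.c2.exists_isLocalDefiningFn hx
  have hN := h.outerNormal_contact hu
  have h1 := hd.isSymmetric_weingarten h.isClosed h.convex hxU hx
  have h2 := fun v hv => hd.inner_weingarten_pos h.isClosed h.convex hxU hx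
    (h.isC2Plus.curvature_pos _ hx) (v := v) hv
  have h3 := hd.inner_weingarten h.isClosed h.convex hxU hx
  have h4 : unitGradient φ (contact K u) = u :=
    (hd.outerNormal_eq h.isClosed h.convex hxU hx).symm.trans hN
  have h5 : LinearMap.det (weingarten K (contact K u)) = gaussCurvature K (contact K u) := rfl
  -- The Weingarten map acts on the complement of `outerNormal K (contact K u)`, which equals u only
  -- propositionally. Once map and normal are generalized, the equality can be substituted.
  generalize weingarten K (contact K u) = T at h1 h2 h3 h5
  generalize outerNormal K (contact K u) = w at T h1 h2 h3 h5 hN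
  subst hN
  exact ⟨T, h1, h2, h5, U, φ, hxU, hd, h4, h3⟩

end IsSymmC2PlusBody

/-- Membership in `K` of points that approach a boundary point along a parabola. -/
theorem IsLocalDefiningFn.eventually_parabola {U : Set (EuclideanSpace ℝ (Fin n))}
    {φ : EuclideanSpace ℝ (Fin n) → ℝ} {x : EuclideanSpace ℝ (Fin n)}
    (h : IsLocalDefiningFn K U φ) (hc : IsClosed K) (hx : x ∈ U) (hxK : x ∈ frontier K)
    (hu : ‖u‖ = 1) (hxu : unitGradient φ x = u) (z : (ℝ ∙ u)ᗮ) (s : ℝ) :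
    (1 / 2 * fderiv ℝ (fderiv ℝ φ) x z z < ‖gradient φ x‖ * s →
      ∀ᶠ p : ℝ in atTop, x + splitEquiv u hu ((√p)⁻¹ • z, p⁻¹ * s) ∈ K) ∧
    (‖gradient φ x‖ * s < 1 / 2 * fderiv ℝ (fderiv ℝ φ) x z z →
      ∀ᶠ p : ℝ in atTop, x + splitEquiv u hu ((√p)⁻¹ • z, p⁻¹ * s) ∉ K) := by
  set B := fderiv ℝ (fderiv ℝ φ) x with hB
  set g := ‖gradient φ x‖ with hg
  -- The displacement from x multiplied by √p; it tends to z.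
  let y : ℝ → EuclideanSpace ℝ (Fin n) := fun p => (z : EuclideanSpace ℝ (Fin n)) - ((√p)⁻¹ * s) • u
  have hsq : Tendsto (fun p : ℝ => (√p)⁻¹) atTop (𝓝 0) :=
    tendsto_inv_atTop_zero.comp Real.tendsto_sqrt_atTop
  have hy : Tendsto y atTop (𝓝 z) := by
    have h1 : Tendsto (fun p : ℝ => ((√p)⁻¹ * s) • u) atTop (𝓝 ((0 * s) • u)) :=
      (hsq.mul_const s).smul_const u
    have := tendsto_const_nhds (x := (z : EuclideanSpace ℝ (Fin n))) (f := atTop (α := ℝ))|>.sub h1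
    simpa using this
  have hyw : ∀ p : ℝ, 0 < p → splitEquiv u hu ((√p)⁻¹ • z, p⁻¹ * s) = (√p)⁻¹ • y p := by
    intro p hp
    have : p⁻¹ = (√p)⁻¹ * (√p)⁻¹ := by rw [← mul_inv, Real.mul_self_sqrt hp.le]
    rw [splitEquiv_apply, this]
    simp only [y, Submodule.coe_smul, smul_sub, smul_smul, mul_assoc]
  have hw0 : Tendsto (fun p : ℝ => x + splitEquiv u hu ((√p)⁻¹ • z, p⁻¹ * s)) atTop (𝓝 x) := by
    have h1 : Tendsto (fun p : ℝ => x + (√p)⁻¹ • y p) atTop (𝓝 (x + (0 : ℝ) • (z : EuclideanSpace ℝ (Fin n)))) :=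
      tendsto_const_nhds.add (hsq.smul hy)
    simp only [zero_smul, add_zero] at h1
    refine h1.congr' ?_
    filter_upwards [eventually_gt_atTop 0] with p hp
    rw [hyw p hp]
  -- Multiplied by p, the value of φ at the moving point tends to ½ B(z, z) - g s, whose sign
  -- decides membership in K.
  have hTaylor : ∀ ε > 0, ∀ᶠ p : ℝ in atTop,
      x + splitEquiv u hu ((√p)⁻¹ • z, p⁻¹ * s) ∈ U ∧
      |p * φ (x + splitEquiv u hu ((√p)⁻¹ • z, p⁻¹ * s)) - (1 / 2 * B (y p) (y p) - g * s)| ≤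
        ε * ‖y p‖ ^ 2 := by
    intro ε hε
    obtain ⟨r, hr, hrU, hT⟩ := h.exists_ball_taylor hx hε
    filter_upwards [eventually_gt_atTop 0, hw0.eventually (Metric.ball_mem_nhds x hr)] with p hp hb
    refine ⟨hrU hb, ?_⟩
    have h1 := hT x (Metric.mem_ball_self hr) _ hb
    rw [add_sub_cancel_left, h.apply_eq_zero hc hx hxK, hxu, real_inner_comm, inner_splitEquiv,
      sub_zero, hyw p hp, map_smul, map_smul, smul_apply, norm_smul] at h1
    rw [hyw p hp]
    have hpp : (√p)⁻¹ * (√p)⁻¹ = p⁻¹ := by rw [← mul_inv, Real.mul_self_sqrt hp.le]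
    have h2 : p * φ (x + (√p)⁻¹ • y p) - (1 / 2 * B (y p) (y p) - g * s) =
        p * (φ (x + (√p)⁻¹ • y p) - ‖gradient φ x‖ * -(p⁻¹ * s) -
          1 / 2 * (√p)⁻¹ • (√p)⁻¹ • (fderiv ℝ (fderiv ℝ φ) x (y p)) (y p)) := by
      rw [smul_smul, hpp, smul_eq_mul, ← hB, ← hg]
      field_simp
      ring
    rw [h2, abs_mul, abs_of_pos hp]
    calc _ ≤ p * (ε * (‖(√p)⁻¹‖ * ‖y p‖) ^ 2) := mul_le_mul_of_nonneg_left h1 hp.le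
      _ = ε * ‖y p‖ ^ 2 := by
        rw [mul_pow, Real.norm_eq_abs, sq_abs, sq, hpp]
        field_simp
  have hB2 : Tendsto (fun p => B (y p) (y p)) atTop (𝓝 (B z z)) := by
    have : Continuous fun v => B v v := by fun_prop
    exact (this.tendsto _).comp hy
  have hn2 : Tendsto (fun p => ‖y p‖ ^ 2) atTop (𝓝 (‖(z : EuclideanSpace ℝ (Fin n))‖ ^ 2)) :=
    hy.norm.pow 2
  constructor
  · intro hlt
    set d := g * s - 1 / 2 * B z z with hd
    have hd0 : 0 < d := by linarith
    set ε := d / (2 * (‖(z : EuclideanSpace ℝ (Fin n))‖ ^ 2 + 1)) with hε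
    have hε0 : 0 < ε := by positivity
    have hlim : Tendsto (fun p => 1 / 2 * B (y p) (y p) - g * s + ε * ‖y p‖ ^ 2) atTop
        (𝓝 (1 / 2 * B z z - g * s + ε * ‖(z : EuclideanSpace ℝ (Fin n))‖ ^ 2)) :=
      ((hB2.const_mul _).sub_const _).add (hn2.const_mul _)
    have hneg : 1 / 2 * B z z - g * s + ε * ‖(z : EuclideanSpace ℝ (Fin n))‖ ^ 2 < 0 := by
      have : ε * ‖(z : EuclideanSpace ℝ (Fin n))‖ ^ 2 ≤ d / 2 := by
        rw [hε, div_mul_eq_mul_div, div_le_div_iff₀ (by positivity) (by norm_num)]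
        nlinarith
      linarith
    filter_upwards [hTaylor ε hε0, hlim.eventually (gt_mem_nhds hneg), eventually_gt_atTop 0]
      with p ⟨hpU, hp1⟩ hp2 hp0
    rw [h.mem_iff hpU]
    have h3 := (abs_le.1 hp1).2
    by_contra! hcon
    have := mul_pos hp0 hcon
    linarith
  · intro hlt
    set d := 1 / 2 * B z z - g * s with hd
    have hd0 : 0 < d := by linarith
    set ε := d / (2 * (‖(z : EuclideanSpace ℝ (Fin n))‖ ^ 2 + 1)) with hε
    have hε0 : 0 < ε := by positivity
    have hlim : Tendsto (fun p => 1 / 2 * B (y p) (y p) - g * s - ε * ‖y p‖ ^ 2) atTop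
        (𝓝 (1 / 2 * B z z - g * s - ε * ‖(z : EuclideanSpace ℝ (Fin n))‖ ^ 2)) :=
      ((hB2.const_mul _).sub_const _).sub (hn2.const_mul _)
    have hpos : 0 < 1 / 2 * B z z - g * s - ε * ‖(z : EuclideanSpace ℝ (Fin n))‖ ^ 2 := by
      have : ε * ‖(z : EuclideanSpace ℝ (Fin n))‖ ^ 2 ≤ d / 2 := by
        rw [hε, div_mul_eq_mul_div, div_le_div_iff₀ (by positivity) (by norm_num)]
        nlinarith
      linarith
    filter_upwards [hTaylor ε hε0, hlim.eventually (lt_mem_nhds hpos), eventually_gt_atTop 0]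
      with p ⟨hpU, hp1⟩ hp2 hp0
    rw [h.mem_iff hpU, not_le]
    have h3 := (abs_le.1 hp1).1
    by_contra! hcon
    have := mul_nonpos_of_nonneg_of_nonpos hp0.le hcon
    linarith

/-- Vertical sections of a graph are single points. On the limiting paraboloid itself the second
order expansion does not decide membership, so it has to be null. -/
theorem ae_ne_graph {F : Type*} [NormedAddCommGroup F] [InnerProductSpace ℝ F]
    [FiniteDimensional ℝ F] [MeasurableSpace F] [BorelSpace F] {q : F → ℝ} (hq : Continuous q) :
    ∀ᵐ w : F × ℝ, q w.1 ≠ w.2 := by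
  have hm : MeasurableSet {w : F × ℝ | q w.1 = w.2} :=
    (isClosed_eq (by fun_prop) (by fun_prop)).measurableSet
  have h0 : (volume : Measure (F × ℝ)) {w : F × ℝ | q w.1 = w.2} = 0 := by
    rw [Measure.volume_eq_prod, Measure.measure_prod_null hm]
    refine Eventually.of_forall fun z => ?_
    have : Prod.mk z ⁻¹' {w : F × ℝ | q w.1 = w.2} = {q z} := by
      ext s
      simp [eq_comm]
    change volume (Prod.mk z ⁻¹' {w : F × ℝ | q w.1 = w.2}) = 0
    rw [this]
    simp
  rw [ae_iff]
  simpa using h0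

namespace IsSymmC2PlusBody

/-- Dominated convergence in parabolic coordinates: the limit is the integral of e^{-s/h} over s ≥
½⟨Tz, z⟩, which is h times a Gaussian integral with det T = κ. -/
theorem tendsto_scaledMoment (h : IsSymmC2PlusBody K) (hu : ‖u‖ = 1) :
    Tendsto (scaledMoment K u) atTop (𝓝 (√(2 ^ (n + 1) * Real.pi ^ (n - 1) *
      supportFn K u ^ (n + 1) * curvatureFn K u))) := by
  obtain ⟨c, hc, hs⟩ := h.isC2Plus.exists_strongly_convex h.isCompact h.convex
  obtain ⟨T, hTs, hTp, hTd, U, φ, hxU, hd, hxu, hB⟩ := h.exists_weingarten_compression hu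
  have hh := h.supportFn_pos hu
  have hg : 0 < ‖gradient φ (contact K u)‖ := norm_pos_iff.2 (hd.gradient_ne hxU)
  have hTc : Continuous T := LinearMap.continuous_of_finiteDimensional T
  set q : (ℝ ∙ u)ᗮ → ℝ := fun z => 1 / 2 * ⟪T z, z⟫ with hq
  have hqc : Continuous q := by fun_prop
  obtain ⟨b, hb, hqb⟩ := exists_pos_mul_sq_norm_le hqc
    (fun t v => by simp only [hq, map_smul, inner_smul_left, inner_smul_right]; simp; ring)
    (fun v hv => by have := hTp v hv; simp only [hq]; positivity)
  obtain ⟨-, hval⟩ := integral_epigraph_exp hqc hb hh hqb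
  have hdom := (integral_epigraph_exp (F := (ℝ ∙ u)ᗮ) (q := fun z => c * ‖z‖ ^ 2)
    (by fun_prop) hc hh fun _ => le_rfl).1
  have hlim : Tendsto (fun p => ∫ w, rescaledIntegrand K u hu p w) atTop
      (𝓝 (∫ w : (ℝ ∙ u)ᗮ × ℝ, indicator {w : (ℝ ∙ u)ᗮ × ℝ | q w.1 ≤ w.2}
        (fun w => Real.exp (-(w.2 / supportFn K u))) w)) := by
    refine tendsto_integral_filter_of_dominated_convergence _
      (Eventually.of_forall fun p => (h.measurable_rescaledIntegrand hu p).aestronglyMeasurable)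
      ?_ hdom ?_
    · filter_upwards [eventually_gt_atTop 0] with p hp
      refine Eventually.of_forall fun w => ?_
      rw [Real.norm_of_nonneg (rescaledIntegrand_nonneg hu p w)]
      exact h.rescaledIntegrand_le hu hc hs hp w
    · filter_upwards [ae_ne_graph hqc] with w hw
      obtain ⟨hin, hout⟩ := hd.eventually_parabola h.isClosed hxU (h.contact_mem hu) hu hxu w.1 w.2
      rw [hB] at hin hout
      rcases lt_or_gt_of_ne hw with hlt | hlt
      · rw [indicator_of_mem (s := {w : (ℝ ∙ u)ᗮ × ℝ | q w.1 ≤ w.2}) hlt.le]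
        refine (tendsto_max_one_sub_div_rpow (w.2 / supportFn K u)).congr' ?_
        have : 1 / 2 * (‖gradient φ (contact K u)‖ * ⟪T w.1, w.1⟫) <
            ‖gradient φ (contact K u)‖ * w.2 := by
          have := mul_lt_mul_of_pos_left hlt hg
          simp only [hq] at this
          linarith
        filter_upwards [hin this] with p hp
        rw [rescaledIntegrand_of_mem hu hp]
      · rw [indicator_of_notMem (s := {w : (ℝ ∙ u)ᗮ × ℝ | q w.1 ≤ w.2}) (not_le.2 hlt)]
        refine tendsto_const_nhds.congr' ?_
        have : ‖gradient φ (contact K u)‖ * w.2 <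
            1 / 2 * (‖gradient φ (contact K u)‖ * ⟪T w.1, w.1⟫) := by
          have := mul_lt_mul_of_pos_left hlt hg
          simp only [hq] at this
          linarith
        filter_upwards [hout this] with p hp
        rw [rescaledIntegrand_of_notMem hu hp]
  have hgauss := integral_exp_neg_quadratic hTs hTp
    (show 0 < 1 / (2 * supportFn K u) by positivity)
  have hvalue : 2 * (∫ w : (ℝ ∙ u)ᗮ × ℝ, indicator {w : (ℝ ∙ u)ᗮ × ℝ | q w.1 ≤ w.2}
        (fun w => Real.exp (-(w.2 / supportFn K u))) w) = √(2 ^ (n + 1) * Real.pi ^ (n - 1) *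
      supportFn K u ^ (n + 1) * curvatureFn K u) := by
    have hκ := h.isC2Plus.curvature_pos _ (h.contact_mem hu)
    have hfr : Module.finrank ℝ (ℝ ∙ u)ᗮ + 1 = n := by
      simpa using finrank_orthogonal_unit u hu
    have hint : ∫ z, Real.exp (-((supportFn K u)⁻¹ * q z)) =
        ∫ z : (ℝ ∙ u)ᗮ, Real.exp (-(1 / (2 * supportFn K u) * ⟪T z, z⟫)) := by
      congr 1
      ext z
      simp only [hq]
      congr 2
      field_simp
    rw [hval, hint, hgauss, hTd, curvatureFn_eq]
    obtain ⟨d, hd⟩ : ∃ d, Module.finrank ℝ (ℝ ∙ u)ᗮ = d := ⟨_, rfl⟩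
    rw [hd] at hfr ⊢
    subst hfr
    rw [Nat.add_sub_cancel]
    rw [← mul_assoc]
    have h2 : (0 : ℝ) ≤ 2 * supportFn K u := by positivity
    -- The factor 2h goes under the root as (2h)², where it multiplies (2πh)^{n-1}/κ.
    nth_rw 1 [← Real.sqrt_sq h2]
    rw [← Real.sqrt_mul (by positivity)]
    congr 1
    rw [div_div_eq_mul_div, div_one, mul_pow, mul_pow]
    field_simp
    ring
  rw [← hvalue]
  refine (hlim.const_mul 2).congr' ?_
  filter_upwards [eventually_gt_atTop 0] with p hp
  rw [h.scaledMoment_eq hu hp]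

end IsSymmC2PlusBody

end LaplaceLimit

/-! ### Two-sided bounds on the scaled moments, uniform in the direction. -/

section MomentBounds

variable {n : ℕ} {K : Set (EuclideanSpace ℝ (Fin n))} {u : EuclideanSpace ℝ (Fin n)}

theorem volume_closedBall_eq_of_finrank {F : Type*} [NormedAddCommGroup F] [InnerProductSpace ℝ F]
    [FiniteDimensional ℝ F] [MeasurableSpace F] [BorelSpace F] {d : ℕ}
    (hd : Module.finrank ℝ F = d) (ρ : ℝ) :
    volume (Metric.closedBall (0 : F) ρ) =
      volume (Metric.closedBall (0 : EuclideanSpace ℝ (Fin d)) ρ) := by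
  subst hd
  have h1 := (stdOrthonormalBasis ℝ F).repr.measurePreserving.measure_preimage_equiv
    (f := (stdOrthonormalBasis ℝ F).repr.toHomeomorph.toMeasurableEquiv)
    (Metric.closedBall (0 : EuclideanSpace ℝ (Fin (Module.finrank ℝ F))) ρ)
  rw [← h1]
  congr 1
  ext z
  simp

namespace IsSymmC2PlusBody

/-- The dominating function has an explicit integral that depends on u only through h_K(u),
increasingly, and h_K is bounded on the sphere. -/
theorem exists_scaledMoment_le (h : IsSymmC2PlusBody K) :
    ∃ M > 0, ∀ p > 0, ∀ u, ‖u‖ = 1 → scaledMoment K u p ≤ M := by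
  obtain ⟨c, hc, hs⟩ := h.isC2Plus.exists_strongly_convex h.isCompact h.convex
  obtain ⟨R, hR, hRu⟩ := h.exists_supportFn_le
  refine ⟨2 * (R * (Real.pi / (R⁻¹ * c)) ^ (((n : ℝ) - 1) / 2)), by positivity,
    fun p hp u hu => ?_⟩
  have hh := h.supportFn_pos hu
  obtain ⟨hdom, hval⟩ := integral_epigraph_exp (F := (ℝ ∙ u)ᗮ) (q := fun z => c * ‖z‖ ^ 2)
    (by fun_prop) hc hh fun _ => le_rfl
  have hfr : Module.finrank ℝ (ℝ ∙ u)ᗮ + 1 = n := by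
    simpa using finrank_orthogonal_unit u hu
  have hn : (Module.finrank ℝ (ℝ ∙ u)ᗮ : ℝ) = n - 1 := by
    have := congrArg (Nat.cast : ℕ → ℝ) hfr
    push_cast at this
    linarith
  have hn0 : (0 : ℝ) ≤ (n - 1) / 2 := by rw [← hn]; positivity
  rw [h.scaledMoment_eq hu hp]
  have h1 : ∫ w, rescaledIntegrand K u hu p w ≤ _ :=
    integral_mono_of_nonneg (Eventually.of_forall fun w => rescaledIntegrand_nonneg hu p w) hdom
      (Eventually.of_forall fun w => h.rescaledIntegrand_le hu hc hs hp w)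
  have hb : 0 < (supportFn K u)⁻¹ * c := by positivity
  have hgauss := GaussianFourier.integral_rexp_neg_mul_sq_norm (V := (ℝ ∙ u)ᗮ) hb
  have h2 : ∫ z : (ℝ ∙ u)ᗮ, Real.exp (-((supportFn K u)⁻¹ * (c * ‖z‖ ^ 2))) =
      (Real.pi / ((supportFn K u)⁻¹ * c)) ^ (((n : ℝ) - 1) / 2) := by
    rw [← hn, ← hgauss]
    congr 1
    ext z
    congr 1
    ring
  rw [hval, h2] at h1
  refine mul_le_mul_of_nonneg_left (h1.trans ?_) two_pos.le
  have h3 := hRu u hu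
  gcongr

/-- For large p the inner paraboloid contains the fixed box ‖z‖ ≤ ρ, 1 ≤ s ≤ 2 in rescaled
coordinates, for every u at once, and there the integrand is at least e^{-4/h₀}. -/
theorem exists_le_scaledMoment (h : IsSymmC2PlusBody K) :
    ∃ m > 0, ∃ p₀ > 0, ∀ p ≥ p₀, ∀ u, ‖u‖ = 1 → m ≤ scaledMoment K u p := by
  obtain ⟨c, hc, hs⟩ := h.isC2Plus.exists_strongly_convex h.isCompact h.convex
  obtain ⟨C, hC, r, hr, hin⟩ := h.isC2Plus.c2.exists_inner_paraboloid h.isCompact h.convex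
  obtain ⟨h₀, hh₀, hhu⟩ := h.exists_pos_le_supportFn
  set ρ := √(1 / (2 * C)) with hρ
  have hρ0 : 0 < ρ := Real.sqrt_pos.2 (by positivity)
  have hρ2 : ρ ^ 2 = 1 / (2 * C) := Real.sq_sqrt (by positivity)
  set V := volume.real (Metric.closedBall (0 : EuclideanSpace ℝ (Fin (n - 1))) ρ) with hV
  have hV0 : 0 < V := by
    refine ENNReal.toReal_pos ?_ measure_closedBall_lt_top.ne
    exact (Metric.measure_closedBall_pos _ _ hρ0).ne'
  refine ⟨2 * (V * Real.exp (-(4 / h₀))), by positivity,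
    -- The bound 8C gives s²/p ≤ 1/(2C), which together with ‖z‖² ≤ 1/(2C) yields the paraboloid
    -- inequality for s ≥ 1. The next entry keeps the point within distance r, and 4/h₀ gives s/(hp)
    -- ≤ 1/2.
    max (max 1 (8 * C)) (max ((ρ ^ 2 + 4) / r ^ 2 + 1) (4 / h₀)), by positivity,
    fun p hp u hu => ?_⟩
  obtain ⟨hp', hp''⟩ := max_le_iff.1 hp
  obtain ⟨hp1, hp2⟩ := max_le_iff.1 hp'
  obtain ⟨hp3, hp4⟩ := max_le_iff.1 hp''
  have hp0 : 0 < p := by linarith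
  have hfr : Module.finrank ℝ (ℝ ∙ u)ᗮ + 1 = n := by
    simpa using finrank_orthogonal_unit u hu
  have hh := h.supportFn_pos hu
  rw [h.scaledMoment_eq hu hp0]
  refine mul_le_mul_of_nonneg_left ?_ two_pos.le
  set S : Set ((ℝ ∙ u)ᗮ × ℝ) := Metric.closedBall 0 ρ ×ˢ Icc 1 2 with hS
  have hSm : MeasurableSet S := measurableSet_closedBall.prod measurableSet_Icc
  have hSv : volume S = volume (Metric.closedBall (0 : EuclideanSpace ℝ (Fin (n - 1))) ρ) := by
    rw [hS, Measure.volume_eq_prod, Measure.prod_prod,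
      volume_closedBall_eq_of_finrank (d := n - 1) (by omega)]
    norm_num
  have hint : ∫ w, indicator S (fun _ => Real.exp (-(4 / h₀))) w =
      V * Real.exp (-(4 / h₀)) := by
    rw [integral_indicator hSm, setIntegral_const, smul_eq_mul, measureReal_def, hSv]
    rfl
  have hdom := (integral_epigraph_exp (F := (ℝ ∙ u)ᗮ) (q := fun z => c * ‖z‖ ^ 2)
    (by fun_prop) hc hh fun _ => le_rfl).1
  have hri : Integrable (rescaledIntegrand K u hu p) :=
    hdom.mono' (h.measurable_rescaledIntegrand hu p).aestronglyMeasurable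
      (Eventually.of_forall fun w => by
        rw [Real.norm_of_nonneg (rescaledIntegrand_nonneg hu p w)]
        exact h.rescaledIntegrand_le hu hc hs hp0 w)
  rw [← hint]
  refine integral_mono_of_nonneg
    (Eventually.of_forall fun w => indicator_nonneg (fun _ _ => (Real.exp_pos _).le) w) hri
    (Eventually.of_forall fun w => ?_)
  by_cases hw : w ∈ S
  · change indicator S (fun _ => Real.exp (-(4 / h₀))) w ≤ rescaledIntegrand K u hu p w
    rw [indicator_of_mem hw]
    have hw1 : ‖w.1‖ ≤ ρ := by simpa using hw.1
    have hw2 : 1 ≤ w.2 := hw.2.1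
    have hw3 : w.2 ≤ 2 := hw.2.2
    have hw1' : ‖w.1‖ ^ 2 ≤ 1 / (2 * C) := by
      rw [← hρ2]
      exact pow_le_pow_left₀ (norm_nonneg _) hw1 2
    have hnorm : ‖splitEquiv u hu ((√p)⁻¹ • w.1, p⁻¹ * w.2)‖ ^ 2 =
        p⁻¹ * (‖w.1‖ ^ 2 + p⁻¹ * w.2 ^ 2) := by
      rw [norm_sq_splitEquiv]
      simp only [norm_smul, norm_inv, Real.norm_of_nonneg (Real.sqrt_nonneg p), mul_pow, inv_pow,
        Real.sq_sqrt hp0.le]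
      ring
    have hsq : w.2 ^ 2 ≤ 4 := by nlinarith
    have hmem : contact K u + splitEquiv u hu ((√p)⁻¹ • w.1, p⁻¹ * w.2) ∈ K := by
      refine hin _ (h.contact_mem hu) _ ?_ ?_
      · rw [add_sub_cancel_left]
        refine lt_of_pow_lt_pow_left₀ 2 hr.le ?_
        rw [hnorm, inv_mul_lt_iff₀ hp0]
        have h1 : p⁻¹ * w.2 ^ 2 ≤ 4 := by
          have : p⁻¹ ≤ 1 := inv_le_one_of_one_le₀ hp1
          nlinarith [sq_nonneg w.2]
        have h2 : (ρ ^ 2 + 4) / r ^ 2 < p := by linarith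
        rw [div_lt_iff₀ (by positivity)] at h2
        linarith
      · rw [add_sub_cancel_left, sub_add_cancel_left, h.outerNormal_contact hu, inner_neg_left,
          inner_splitEquiv, neg_neg, hnorm]
        have h1 : p⁻¹ * w.2 ^ 2 ≤ 1 / (2 * C) := by
          rw [inv_mul_le_iff₀ hp0]
          have : 4 ≤ p * (1 / (2 * C)) := by
            rw [mul_one_div, le_div_iff₀ (by positivity)]
            linarith
          linarith
        have h2 : C * (‖w.1‖ ^ 2 + p⁻¹ * w.2 ^ 2) ≤ w.2 := by
          have : C * (1 / (2 * C) + 1 / (2 * C)) = 1 := by field_simp; norm_num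
          nlinarith
        have h3 := mul_le_mul_of_nonneg_left h2 (inv_pos.2 hp0).le
        linarith
    rw [rescaledIntegrand_of_mem hu hmem]
    have ht : w.2 / supportFn K u ≤ 2 / h₀ := by
      have := hhu u hu
      gcongr
    have ht0 : 0 ≤ w.2 / supportFn K u := by positivity
    have htp : w.2 / supportFn K u / p ≤ 1 / 2 := by
      rw [div_le_iff₀ hp0]
      have : 4 / h₀ = 2 * (2 / h₀) := by ring
      linarith
    have h5 := exp_neg_two_mul_le_one_sub (div_nonneg ht0 hp0.le) htp
    calc Real.exp (-(4 / h₀)) ≤ Real.exp (-(2 * (w.2 / supportFn K u))) := by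
          rw [Real.exp_le_exp]
          have : 4 / h₀ = 2 * (2 / h₀) := by ring
          linarith
      _ = Real.exp (-(2 * (w.2 / supportFn K u / p))) ^ p := by
        rw [← Real.exp_mul]
        congr 1
        field_simp
      _ ≤ (max (1 - w.2 / supportFn K u / p) 0) ^ p :=
        Real.rpow_le_rpow (Real.exp_pos _).le (h5.trans (le_max_left _ _)) hp0.le
  · change indicator S (fun _ => Real.exp (-(4 / h₀))) w ≤ rescaledIntegrand K u hu p w
    rw [indicator_of_notMem hw]
    exact rescaledIntegrand_nonneg hu p w

end IsSymmC2PlusBody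

end MomentBounds

/-! ### Volumes of polar bodies as integrals over the sphere. -/

section PolarVolume

variable {n : ℕ} {K : Set (EuclideanSpace ℝ (Fin n))} {u : EuclideanSpace ℝ (Fin n)}

theorem volumeIoiPow_apply_Iic (k : ℕ) (x : Ioi (0 : ℝ)) :
    Measure.volumeIoiPow k (Iic x) = ENNReal.ofReal (x.1 ^ (k + 1) / (k + 1)) := by
  rw [← Measure.volumeIoiPow_apply_Iio, ← Iio_union_right]
  refine le_antisymm ((measure_union_le _ _).trans ?_) (measure_mono subset_union_left)
  have h0 : Measure.volumeIoiPow k {x} = 0 := by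
    refine withDensity_absolutelyContinuous _ _ ?_
    rw [(MeasurableEmbedding.subtype_coe measurableSet_Ioi).comap_apply]
    simp
  rw [h0, add_zero]

/-- The volume of a star body in terms of its gauge. -/
theorem volume_sublevel_eq_integral (hn : 1 ≤ n) {g : EuclideanSpace ℝ (Fin n) → ℝ}
    (hm : MeasurableSet {y | g y ≤ 1}) (hhom : ∀ t > 0, ∀ y, g (t • y) = t * g y)
    (hc : ContinuousOn g (Metric.sphere 0 1)) (hpos : ∀ u, ‖u‖ = 1 → 0 < g u) :
    volume {y | g y ≤ 1} ≠ ⊤ ∧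
    volume.real {y | g y ≤ 1} =
      1 / n * ∫ u : Metric.sphere (0 : EuclideanSpace ℝ (Fin n)) 1, (g u ^ n)⁻¹ ∂(sphereMeasure n) := by
  have : NeZero n := ⟨by omega⟩
  have hint : Integrable (fun u : Metric.sphere (0 : EuclideanSpace ℝ (Fin n)) 1 =>
      (g u ^ n)⁻¹ / n) (sphereMeasure n) := by
    have hcont : Continuous fun u : Metric.sphere (0 : EuclideanSpace ℝ (Fin n)) 1 =>
        (g u ^ n)⁻¹ / n := by
      have h1 : Continuous fun u : Metric.sphere (0 : EuclideanSpace ℝ (Fin n)) 1 => g u :=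
        continuousOn_iff_continuous_domRestrict.1 hc
      exact ((h1.pow n).inv₀ fun u => (pow_pos (hpos u (by simp)) n).ne').div_const _
    have : IsFiniteMeasure (sphereMeasure n) := by unfold sphereMeasure; infer_instance
    exact hcont.integrable_of_hasCompactSupport (HasCompactSupport.of_compactSpace _)
  have hkey : volume {y | g y ≤ 1} = ∫⁻ u : Metric.sphere (0 : EuclideanSpace ℝ (Fin n)) 1,
      ENNReal.ofReal ((g u ^ n)⁻¹ / n) ∂(sphereMeasure n) := by
    have hmp := (volume : Measure (EuclideanSpace ℝ (Fin n))).measurePreserving_homeomorphUnitSphereProd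
    set S : Set (({0}ᶜ : Set (EuclideanSpace ℝ (Fin n)))) := Subtype.val ⁻¹' {y | g y ≤ 1} with hS
    have h1 : volume {y | g y ≤ 1} = (volume : Measure (EuclideanSpace ℝ (Fin n))).comap
        (Subtype.val : (({0}ᶜ : Set (EuclideanSpace ℝ (Fin n)))) → _) S := by
      rw [comap_subtype_coe_apply (measurableSet_singleton _).compl, hS,
        Subtype.image_preimage_coe, inter_comm, ← sdiff_eq,
        measure_sdiff_null (measure_singleton _)]
    set P : Set (Metric.sphere (0 : EuclideanSpace ℝ (Fin n)) 1 × Ioi (0 : ℝ)) :=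
      (homeomorphUnitSphereProd (EuclideanSpace ℝ (Fin n))).symm ⁻¹' S with hP
    have hSm : MeasurableSet S := measurable_subtype_coe hm
    have hPm : MeasurableSet P := (Homeomorph.measurable _) hSm
    have h2 : S = homeomorphUnitSphereProd (EuclideanSpace ℝ (Fin n)) ⁻¹' P := by
      ext y
      simp [hP]
    rw [h1, h2, hmp.measure_preimage hPm.nullMeasurableSet, Measure.prod_apply hPm]
    refine lintegral_congr fun u => ?_
    have hgu := hpos u (by simp)
    -- By homogeneity the ray in the direction u leaves the body at radius 1 / g(u).
    have h3 : Prod.mk u ⁻¹' P = Iic ⟨(g u)⁻¹, inv_pos.2 hgu⟩ := by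
      ext t
      have ht : (0 : ℝ) < t := t.2
      simp only [hP, hS, mem_preimage, mem_ofPred_eq, homeomorphUnitSphereProd_symm_apply_coe,
        mem_Iic]
      rw [hhom _ ht, ← Subtype.coe_le_coe, ← le_div_iff₀ hgu, one_div]
    rw [h3, volumeIoiPow_apply_Iic]
    congr 1
    have hfr : Module.finrank ℝ (EuclideanSpace ℝ (Fin n)) - 1 + 1 = n := by
      simp
      omega
    have hfr' : ((Module.finrank ℝ (EuclideanSpace ℝ (Fin n)) - 1 : ℕ) : ℝ) + 1 = n := by
      exact_mod_cast hfr
    rw [hfr, hfr', inv_pow]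
  have hnn : 0 ≤ᵐ[sphereMeasure n] fun u : Metric.sphere (0 : EuclideanSpace ℝ (Fin n)) 1 =>
      (g u ^ n)⁻¹ / n := Eventually.of_forall fun u => by
    have := hpos u (by simp)
    change 0 ≤ (g u ^ n)⁻¹ / n
    positivity
  rw [measureReal_def, hkey, ← ofReal_integral_eq_lintegral_ofReal hint hnn]
  refine ⟨ENNReal.ofReal_ne_top, ?_⟩
  rw [ENNReal.toReal_ofReal (integral_nonneg_of_ae hnn), integral_div]
  ring

theorem polarBody_eq_sublevel {C : Set (EuclideanSpace ℝ (Fin n))} (hne : C.Nonempty)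
    (hb : ∀ u, BddAbove ((fun x => ⟪x, u⟫) '' C)) :
    polarBody C = {y | supportFn C y ≤ 1} := by
  ext y
  simp only [polarBody, supportFn, mem_ofPred_eq]
  rw [csSup_le_iff (hb y) (hne.image _)]
  simp

theorem isClosed_polarBody (C : Set (EuclideanSpace ℝ (Fin n))) : IsClosed (polarBody C) := by
  have : polarBody C = ⋂ x ∈ C, {y | ⟪x, y⟫ ≤ 1} := by
    ext y
    simp [polarBody]
  rw [this]
  exact isClosed_biInter fun x _ => isClosed_le (by fun_prop) continuous_const

theorem polarBody_Zp {p : ℝ} (hp : 1 ≤ p) (hK : IsCompact K) :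
    polarBody (Zp p K) = {y | moment p K y ≤ 1} := by
  have h0 : ∀ θ, 0 ≤ moment p K θ := fun θ => by unfold moment; positivity
  rw [polarBody_eq_sublevel ⟨0, fun θ => by simpa using h0 θ⟩ fun θ => ⟨moment p K θ, by
    rintro _ ⟨x, hx, rfl⟩
    exact hx θ⟩]
  ext y
  simp only [mem_ofPred_eq]
  rw [supportFn_Zp hp K hK]
  rfl

theorem continuous_moment {p : ℝ} (hp : 1 ≤ p) (hK : IsCompact K) : Continuous (moment p K) := by
  have hp0 : 0 < p := by linarith
  have h1 : Continuous fun θ => ∫ x in K, |⟪x, θ⟫| ^ p := by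
    refine continuous_parametric_integral_of_continuous ?_ hK
    exact (by fun_prop : Continuous fun q : EuclideanSpace ℝ (Fin n) × EuclideanSpace ℝ (Fin n) =>
      |⟪q.2, q.1⟫|).rpow_const fun _ => Or.inr hp0.le
  exact h1.rpow_const fun _ => Or.inr (by positivity)

namespace IsSymmC2PlusBody

theorem integral_abs_inner_rpow_pos (h : IsSymmC2PlusBody K) {p : ℝ} (hp : 0 < p) (hu : ‖u‖ = 1) :
    0 < ∫ x in K, |⟪x, u⟫| ^ p := by
  have hc : Continuous fun x : EuclideanSpace ℝ (Fin n) => |⟪x, u⟫| ^ p :=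
    (by fun_prop : Continuous fun x : EuclideanSpace ℝ (Fin n) => |⟪x, u⟫|).rpow_const
      fun _ => Or.inr hp.le
  rw [setIntegral_pos_iff_support_of_nonneg_ae (Eventually.of_forall fun x => by positivity)
    (hc.continuousOn.integrableOn_compact h.isCompact)]
  have hO : IsOpen (interior K ∩ {x | ⟪x, u⟫ ≠ 0}) :=
    isOpen_interior.inter (isOpen_ne_fun (by fun_prop) continuous_const)
  have hne : (interior K ∩ {x | ⟪x, u⟫ ≠ 0}).Nonempty := by
    obtain ⟨r, hr, hb⟩ := Metric.isOpen_iff.1 isOpen_interior _ h.zero_mem_interior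
    refine ⟨(r / 2) • u, hb (by simp [norm_smul, hu, abs_of_pos hr, hr]), ?_⟩
    simp only [mem_ofPred_eq, inner_smul_left, real_inner_self_eq_norm_sq, hu]
    simpa using hr.ne'
  refine (hO.measure_pos volume hne).trans_le (measure_mono fun x hx => ⟨?_, interior_subset hx.1⟩)
  exact (Real.rpow_pos_of_pos (abs_pos.2 hx.2) p).ne'

theorem moment_pos (h : IsSymmC2PlusBody K) {p : ℝ} (hp : 0 < p) (hu : ‖u‖ = 1) :
    0 < moment p K u :=
  Real.rpow_pos_of_pos (h.integral_abs_inner_rpow_pos hp hu) _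

theorem supportFn_smul {t : ℝ} (ht : 0 < t) (y : EuclideanSpace ℝ (Fin n)) :
    supportFn K (t • y) = t * supportFn K y := by
  unfold supportFn
  rw [← smul_eq_mul, ← Real.sSup_smul_of_nonneg ht.le, ← image_smul, image_image]
  congr 1
  refine image_congr fun x _ => ?_
  rw [inner_smul_right, smul_eq_mul]

theorem volume_polarBody (h : IsSymmC2PlusBody K) (hn : 1 ≤ n) :
    volume (polarBody K) ≠ ⊤ ∧ volume.real (polarBody K) = 1 / n *
      ∫ u : Metric.sphere (0 : EuclideanSpace ℝ (Fin n)) 1,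
        (supportFn K u ^ n)⁻¹ ∂(sphereMeasure n) := by
  have h1 := polarBody_eq_sublevel ⟨0, interior_subset h.zero_mem_interior⟩ h.bddAbove_image_inner
  have h2 := (isClosed_polarBody K).measurableSet
  rw [h1] at h2 ⊢
  exact volume_sublevel_eq_integral hn h2 (fun t ht y => supportFn_smul ht y)
    h.continuousOn_supportFn fun u hu => h.supportFn_pos hu

theorem volume_polarBody_Zp (h : IsSymmC2PlusBody K) (hn : 1 ≤ n) {p : ℝ} (hp : 1 ≤ p) :
    volume (polarBody (Zp p K)) ≠ ⊤ ∧ volume.real (polarBody (Zp p K)) = 1 / n *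
      ∫ u : Metric.sphere (0 : EuclideanSpace ℝ (Fin n)) 1,
        (moment p K u ^ n)⁻¹ ∂(sphereMeasure n) := by
  have h1 := polarBody_Zp hp h.isCompact
  have h2 := (isClosed_polarBody (Zp p K)).measurableSet
  rw [h1] at h2 ⊢
  exact volume_sublevel_eq_integral hn h2
    (fun t ht y => by rw [moment_smul hp, abs_of_pos ht])
    (continuous_moment hp h.isCompact).continuousOn fun u hu => h.moment_pos (by linarith) hu

theorem scaledMoment_pos (h : IsSymmC2PlusBody K) {p : ℝ} (hp : 0 < p) (hu : ‖u‖ = 1) :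
    0 < scaledMoment K u p := by
  have hh := h.supportFn_pos hu
  have h1 := h.integral_abs_inner_rpow_pos hp hu
  rw [scaledMoment]
  simp_rw [Real.div_rpow (abs_nonneg _) hh.le]
  rw [integral_div]
  positivity

/-- Since h_{Z_p} = h_K · (p^{-(n+1)/2} R_p)^{1/p}, all dependence on p sits in one exponent, which
is ready for expansion of the exponential. -/
theorem inv_moment_pow (h : IsSymmC2PlusBody K) {p : ℝ} (hp : 0 < p) (hu : ‖u‖ = 1) :
    (moment p K u ^ n)⁻¹ = (supportFn K u ^ n)⁻¹ *
      Real.exp (n / p * ((n + 1) / 2 * Real.log p - Real.log (scaledMoment K u p))) := by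
  have hh := h.supportFn_pos hu
  have hI := h.integral_abs_inner_rpow_pos hp hu
  set I := ∫ x in K, |⟪x, u⟫| ^ p with hIdef
  have h1 : scaledMoment K u p = p ^ ((n + 1 : ℝ) / 2) * (I / supportFn K u ^ p) := by
    rw [scaledMoment]
    simp_rw [Real.div_rpow (abs_nonneg _) hh.le]
    rw [integral_div]
  have h2 : Real.log (scaledMoment K u p) =
      (n + 1) / 2 * Real.log p + (Real.log I - p * Real.log (supportFn K u)) := by
    rw [h1, Real.log_mul (by positivity) (by positivity), Real.log_div hI.ne' (by positivity),
      Real.log_rpow hp, Real.log_rpow hh]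
  have h3 : moment p K u = Real.exp (1 / p * Real.log I) := by
    rw [moment, ← hIdef, Real.rpow_def_of_pos hI, mul_comm]
  have h4 : supportFn K u = Real.exp (Real.log (supportFn K u)) := (Real.exp_log hh).symm
  rw [h2, h3, ← Real.exp_nat_mul, ← Real.exp_neg]
  nth_rw 1 [h4]
  rw [← Real.exp_nat_mul, ← Real.exp_neg, ← Real.exp_add]
  congr 1
  field_simp
  ring

end IsSymmC2PlusBody

end PolarVolume

/-! ### Asymptotics of the polar volumes. -/

section Limits

variable {n : ℕ} {K : Set (EuclideanSpace ℝ (Fin n))}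

theorem tendsto_log_sq_div : Tendsto (fun p : ℝ => Real.log p ^ 2 / p) atTop (𝓝 0) := by
  simpa using Real.tendsto_pow_log_div_mul_add_atTop 1 0 2 one_ne_zero

theorem tendsto_log_div : Tendsto (fun p : ℝ => Real.log p / p) atTop (𝓝 0) := by
  simpa using Real.tendsto_pow_log_div_mul_add_atTop 1 0 1 one_ne_zero

theorem isFiniteMeasure_sphereMeasure (n : ℕ) : IsFiniteMeasure (sphereMeasure n) := by
  unfold sphereMeasure
  infer_instance

theorem integrable_sphere_of_continuousOn {f : EuclideanSpace ℝ (Fin n) → ℝ}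
    (hf : ContinuousOn f (Metric.sphere 0 1)) :
    Integrable (fun u : Metric.sphere (0 : EuclideanSpace ℝ (Fin n)) 1 => f u)
      (sphereMeasure n) := by
  have := isFiniteMeasure_sphereMeasure n
  have h1 : Continuous fun u : Metric.sphere (0 : EuclideanSpace ℝ (Fin n)) 1 => f u :=
    continuousOn_iff_continuous_domRestrict.1 hf
  exact h1.integrable_of_hasCompactSupport (HasCompactSupport.of_compactSpace _)

namespace IsSymmC2PlusBody

theorem continuousOn_inv_supportFn_pow (h : IsSymmC2PlusBody K) :
    ContinuousOn (fun u => (supportFn K u ^ n)⁻¹) (Metric.sphere 0 1) :=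
  (h.continuousOn_supportFn.pow n).inv₀ fun u hu =>
    (pow_pos (h.supportFn_pos (by simpa using hu)) n).ne'

theorem continuousOn_inv_moment_pow (h : IsSymmC2PlusBody K) {p : ℝ} (hp : 1 ≤ p) :
    ContinuousOn (fun u => (moment p K u ^ n)⁻¹) (Metric.sphere 0 1) :=
  ((continuous_moment hp h.isCompact).continuousOn.pow n).inv₀ fun u hu =>
    (pow_pos (h.moment_pos (by linarith) (by simpa using hu)) n).ne'

/-- The deviation of `h_{Z_p}^{-n}` from the expansion of `h_K^{-n}`, up to first order. -/
def momentDeviation (K : Set (EuclideanSpace ℝ (Fin n))) (p : ℝ) (u : EuclideanSpace ℝ (Fin n)) :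
    ℝ :=
  p * ((moment p K u ^ n)⁻¹ - (supportFn K u ^ n)⁻¹) -
    n * (n + 1) / 2 * Real.log p * (supportFn K u ^ n)⁻¹

/-- The linear term p ε contains exactly the logarithm of p that the deviation subtracts; what
survives is -n log R_p and the quadratic remainder of the exponential. -/
theorem momentDeviation_eq (h : IsSymmC2PlusBody K) {p : ℝ} (hp : 0 < p)
    {u : EuclideanSpace ℝ (Fin n)} (hu : ‖u‖ = 1) {ε : ℝ}
    (hε : ε = n / p * ((n + 1) / 2 * Real.log p - Real.log (scaledMoment K u p))) :
    momentDeviation K p u = (supportFn K u ^ n)⁻¹ *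
      (p * (Real.exp ε - 1 - ε) - n * Real.log (scaledMoment K u p)) := by
  have h1 : p * ε = n * ((n + 1) / 2 * Real.log p - Real.log (scaledMoment K u p)) := by
    rw [hε]
    field_simp
  rw [momentDeviation, h.inv_moment_pow hp hu, ← hε]
  linear_combination (supportFn K u ^ n)⁻¹ * h1

/-- The two-sided bounds on R_p give |log R_p| ≤ A, hence |ε| ≤ e(p) = O(log p / p), and |exp ε - 1
- ε| ≤ ε² once e(p) ≤ 1. None of this depends on the direction. -/
theorem exists_remainder_bound (h : IsSymmC2PlusBody K) :
    ∃ A > 0, ∃ e : ℝ → ℝ, Tendsto (fun p => p * e p ^ 2) atTop (𝓝 0) ∧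
      ∀ᶠ p in atTop, ∀ u, ‖u‖ = 1 → |Real.log (scaledMoment K u p)| ≤ A ∧
        ∃ ε, ε = n / p * ((n + 1) / 2 * Real.log p - Real.log (scaledMoment K u p)) ∧
          |p * (Real.exp ε - 1 - ε)| ≤ p * e p ^ 2 := by
  obtain ⟨M, hM, hMu⟩ := h.exists_scaledMoment_le
  obtain ⟨m, hm, p₀, hp₀, hmu⟩ := h.exists_le_scaledMoment
  set A := max |Real.log m| |Real.log M| + 1 with hA
  have hA0 : 0 < A := by positivity
  set e : ℝ → ℝ := fun p => n / p * ((n + 1) / 2 * Real.log p + A) with he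
  have hinv : Tendsto (fun p : ℝ => p⁻¹) atTop (𝓝 0) := tendsto_inv_atTop_zero
  have he0 : Tendsto e atTop (𝓝 0) := by
    have h1 : Tendsto (fun p : ℝ => (n : ℝ) * ((n + 1) / 2) * (Real.log p / p) + n * A * p⁻¹) atTop
        (𝓝 ((n : ℝ) * ((n + 1) / 2) * 0 + n * A * 0)) :=
      (tendsto_log_div.const_mul _).add (hinv.const_mul _)
    simp only [mul_zero, add_zero] at h1
    refine h1.congr fun p => ?_
    simp only [he]
    ring
  have he2 : Tendsto (fun p => p * e p ^ 2) atTop (𝓝 0) := by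
    have h1 : Tendsto (fun p : ℝ => (n : ℝ) ^ 2 * (((n + 1) / 2) ^ 2 * (Real.log p ^ 2 / p) +
        2 * ((n + 1) / 2) * A * (Real.log p / p) + A ^ 2 * p⁻¹)) atTop
        (𝓝 ((n : ℝ) ^ 2 * (((n + 1) / 2) ^ 2 * 0 + 2 * ((n + 1) / 2) * A * 0 + A ^ 2 * 0))) :=
      ((((tendsto_log_sq_div.const_mul _).add (tendsto_log_div.const_mul _)).add
        (hinv.const_mul _))).const_mul _
    simp only [mul_zero, add_zero] at h1
    refine h1.congr' ?_
    filter_upwards [eventually_gt_atTop 0] with p hp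
    simp only [he]
    field_simp
    ring
  refine ⟨A, hA0, e, he2, ?_⟩
  filter_upwards [eventually_ge_atTop p₀, eventually_ge_atTop 1,
    he0.eventually (gt_mem_nhds one_pos)] with p hpp₀ hp1 hpe u hu
  have hp : 0 < p := by linarith
  have hlogp := Real.log_nonneg hp1
  have hR := h.scaledMoment_pos hp hu
  have hlog : |Real.log (scaledMoment K u p)| ≤ A := by
    have h1 := Real.log_le_log hm (hmu p hpp₀ u hu)
    have h2 := Real.log_le_log hR (hMu p hp u hu)
    have h3 := neg_abs_le (Real.log m)
    have h4 := le_abs_self (Real.log M)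
    have h5 := le_max_left |Real.log m| |Real.log M|
    have h6 := le_max_right |Real.log m| |Real.log M|
    rw [abs_le]
    constructor <;> linarith
  refine ⟨hlog, _, rfl, ?_⟩
  set ε := n / p * ((n + 1) / 2 * Real.log p - Real.log (scaledMoment K u p)) with hε
  have hεe : |ε| ≤ e p := by
    rw [hε, abs_mul, abs_of_nonneg (by positivity)]
    simp only [he]
    gcongr
    refine (abs_sub _ _).trans (add_le_add (le_of_eq (abs_of_nonneg (by positivity))) hlog)
  have h7 := Real.abs_exp_sub_one_sub_id_le (hεe.trans hpe.le)
  rw [abs_mul, abs_of_pos hp]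
  gcongr
  refine h7.trans ?_
  rw [← sq_abs]
  exact pow_le_pow_left₀ (abs_nonneg _) hεe 2

theorem tendsto_momentDeviation (h : IsSymmC2PlusBody K) {u : EuclideanSpace ℝ (Fin n)}
    (hu : ‖u‖ = 1) :
    Tendsto (fun p => momentDeviation K p u) atTop (𝓝 (-(n / 2) * sphereIntegrand K u)) := by
  obtain ⟨A, hA, e, he, hb⟩ := h.exists_remainder_bound
  have hh := h.supportFn_pos hu
  have hf := h.curvatureFn_pos hu
  set C := 2 ^ (n + 1) * Real.pi ^ (n - 1) * supportFn K u ^ (n + 1) * curvatureFn K u with hC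
  have hC0 : 0 < C := by positivity
  have h1 : Tendsto (fun p => Real.log (scaledMoment K u p)) atTop (𝓝 (Real.log C / 2)) := by
    rw [← Real.log_sqrt hC0.le]
    exact (Real.continuousAt_log (Real.sqrt_pos.2 hC0).ne').tendsto.comp
      (h.tendsto_scaledMoment hu)
  have h2 : Tendsto (fun p => momentDeviation K p u + (supportFn K u ^ n)⁻¹ *
      (n * Real.log (scaledMoment K u p))) atTop (𝓝 0) := by
    have h3 : Tendsto (fun p => (supportFn K u ^ n)⁻¹ * (p * e p ^ 2)) atTop (𝓝 0) := by
      simpa using he.const_mul (supportFn K u ^ n)⁻¹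
    refine squeeze_zero_norm' ?_ h3
    filter_upwards [hb, eventually_gt_atTop 0] with p hp hp0
    obtain ⟨-, ε, hε, hle⟩ := hp u hu
    rw [h.momentDeviation_eq hp0 hu hε, ← mul_add, sub_add_cancel, norm_mul,
      Real.norm_of_nonneg (by positivity)]
    gcongr
    exact hle
  have h4 := h2.sub ((h1.const_mul (n : ℝ)).const_mul (supportFn K u ^ n)⁻¹)
  have h5 : -((n : ℝ) / 2) * sphereIntegrand K u =
      0 - (supportFn K u ^ n)⁻¹ * (n * (Real.log C / 2)) := by
    rw [sphereIntegrand, ← hC]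
    ring
  rw [h5]
  refine h4.congr fun p => ?_
  ring

theorem tendsto_integral_momentDeviation (h : IsSymmC2PlusBody K) :
    Tendsto (fun p => ∫ u : Metric.sphere (0 : EuclideanSpace ℝ (Fin n)) 1,
      momentDeviation K p u ∂(sphereMeasure n)) atTop
      (𝓝 (-(n / 2) * ∫ u : Metric.sphere (0 : EuclideanSpace ℝ (Fin n)) 1,
        sphereIntegrand K u ∂(sphereMeasure n))) := by
  have hfin := isFiniteMeasure_sphereMeasure n
  obtain ⟨A, hA, e, he, hb⟩ := h.exists_remainder_bound
  obtain ⟨r, hr, hru⟩ := h.exists_pos_le_supportFn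
  rw [← integral_const_mul]
  -- Here r bounds h_K below on the sphere, 1 bounds the quadratic remainder for large p, and nA
  -- bounds n log R_p.
  refine tendsto_integral_filter_of_dominated_convergence (fun _ => (r ^ n)⁻¹ * (1 + n * A))
    ?_ ?_ (integrable_const _) ?_
  · filter_upwards [eventually_ge_atTop 1] with p hp
    refine (integrable_sphere_of_continuousOn (f := momentDeviation K p) ?_).aestronglyMeasurable
    exact (continuousOn_const.mul ((h.continuousOn_inv_moment_pow hp).sub
      h.continuousOn_inv_supportFn_pow)).sub
      (continuousOn_const.mul h.continuousOn_inv_supportFn_pow)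
  · filter_upwards [hb, eventually_gt_atTop 0, he.eventually (gt_mem_nhds one_pos)]
      with p hp hp0 hpe
    refine Eventually.of_forall fun u => ?_
    have hu : ‖(u : EuclideanSpace ℝ (Fin n))‖ = 1 := by simp
    obtain ⟨hlog, ε, hε, hle⟩ := hp u hu
    have hh := h.supportFn_pos hu
    rw [h.momentDeviation_eq hp0 hu hε, norm_mul, Real.norm_of_nonneg (by positivity)]
    have h1 : (supportFn K u ^ n)⁻¹ ≤ (r ^ n)⁻¹ := by
      have := hru u hu
      gcongr
    refine mul_le_mul h1 ?_ (norm_nonneg _) (by positivity)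
    refine (abs_sub _ _).trans (add_le_add (hle.trans hpe.le) ?_)
    rw [abs_mul, Nat.abs_cast]
    gcongr
  · exact Eventually.of_forall fun u => h.tendsto_momentDeviation (by simp)

theorem integral_momentDeviation (h : IsSymmC2PlusBody K) (hn : 1 ≤ n) {p : ℝ} (hp : 1 ≤ p) :
    ∫ u : Metric.sphere (0 : EuclideanSpace ℝ (Fin n)) 1,
      momentDeviation K p u ∂(sphereMeasure n) =
    n * (p * (volume.real (polarBody (Zp p K)) - volume.real (polarBody K) -
      (n : ℝ) * (n + 1) / (2 * p) * Real.log p * volume.real (polarBody K))) := by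
  have h1 := integrable_sphere_of_continuousOn (h.continuousOn_inv_moment_pow hp)
  have h2 := integrable_sphere_of_continuousOn h.continuousOn_inv_supportFn_pow
  have hp0 : p ≠ 0 := by linarith
  have hn0 : (n : ℝ) ≠ 0 := by positivity
  rw [(h.volume_polarBody hn).2, (h.volume_polarBody_Zp hn hp).2]
  unfold momentDeviation
  have h3 : Integrable (fun u : Metric.sphere (0 : EuclideanSpace ℝ (Fin n)) 1 =>
      p * ((moment p K u ^ n)⁻¹ - (supportFn K u ^ n)⁻¹)) (sphereMeasure n) :=
    (h1.sub h2).const_mul p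
  rw [integral_sub h3 (h2.const_mul _), integral_const_mul,
    integral_const_mul, integral_sub h1 h2]
  field_simp

theorem tendsto_volume_deviation (h : IsSymmC2PlusBody K) (hn : 1 ≤ n) :
    Tendsto (fun p : ℝ => p * (volume.real (polarBody (Zp p K)) - volume.real (polarBody K) -
      (n : ℝ) * (n + 1) / (2 * p) * Real.log p * volume.real (polarBody K))) atTop
      (𝓝 (-(1 / 2) * ∫ u : Metric.sphere (0 : EuclideanSpace ℝ (Fin n)) 1,
        sphereIntegrand K u ∂(sphereMeasure n))) := by
  have hn0 : (n : ℝ) ≠ 0 := by positivity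
  have h1 := h.tendsto_integral_momentDeviation.const_mul (n : ℝ)⁻¹
  have h2 : (n : ℝ)⁻¹ * (-(n / 2) * ∫ u : Metric.sphere (0 : EuclideanSpace ℝ (Fin n)) 1,
        sphereIntegrand K u ∂(sphereMeasure n)) =
      -(1 / 2) * ∫ u : Metric.sphere (0 : EuclideanSpace ℝ (Fin n)) 1,
        sphereIntegrand K u ∂(sphereMeasure n) := by
    field_simp
  rw [h2] at h1
  refine h1.congr' ?_
  filter_upwards [eventually_ge_atTop 1] with p hp
  rw [h.integral_momentDeviation hn hp, inv_mul_cancel_left₀ hn0]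

/-- Divide the second order expansion by log p: its bounded part disappears and the coefficient of
log p / p remains. -/
theorem tendsto_volume_first_order (h : IsSymmC2PlusBody K) (hn : 1 ≤ n) :
    Tendsto (fun p : ℝ => p / Real.log p *
        (volume.real (polarBody (Zp p K)) - volume.real (polarBody K))) atTop
      (𝓝 ((n : ℝ) * (n + 1) / 2 * volume.real (polarBody K))) := by
  have h1 := (Real.tendsto_log_atTop.inv_tendsto_atTop.mul (h.tendsto_volume_deviation hn)).add_const
    ((n : ℝ) * (n + 1) / 2 * volume.real (polarBody K))
  rw [zero_mul, zero_add] at h1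
  refine h1.congr' ?_
  filter_upwards [eventually_gt_atTop 1] with p hp
  have hlog : Real.log p ≠ 0 := (Real.log_pos hp).ne'
  have hp0 : p ≠ 0 := by linarith
  simp only [Pi.inv_apply]
  field_simp
  ring

/-- The two corrections differ by n(n+1)/2 · (log² p / p) times the quantity whose limit was found
in the first order statement, so the difference vanishes. -/
theorem tendsto_volume_deviation_Zp (h : IsSymmC2PlusBody K) (hn : 1 ≤ n) :
    Tendsto (fun p : ℝ => p * (volume.real (polarBody (Zp p K)) - volume.real (polarBody K) -
      (n : ℝ) * (n + 1) / (2 * p) * Real.log p * volume.real (polarBody (Zp p K)))) atTop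
      (𝓝 (-(1 / 2) * ∫ u : Metric.sphere (0 : EuclideanSpace ℝ (Fin n)) 1,
        sphereIntegrand K u ∂(sphereMeasure n))) := by
  have h1 := (h.tendsto_volume_deviation hn).sub
    ((tendsto_log_sq_div.mul (h.tendsto_volume_first_order hn)).const_mul ((n : ℝ) * (n + 1) / 2))
  rw [zero_mul, mul_zero, sub_zero] at h1
  refine h1.congr' ?_
  filter_upwards [eventually_gt_atTop 1] with p hp
  have hlog : Real.log p ≠ 0 := (Real.log_pos hp).ne'
  have hp0 : p ≠ 0 := by linarith
  field_simp
  ring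

end IsSymmC2PlusBody

end Limits

/-! ### Thin radial shells over subsets of the sphere. -/

section Shell

variable {n : ℕ}

theorem volumeIoiPow_apply_Ico (k : ℕ) {a b : Ioi (0 : ℝ)} (hab : a ≤ b) :
    Measure.volumeIoiPow k (Ico a b) =
      ENNReal.ofReal ((b.1 ^ (k + 1) - a.1 ^ (k + 1)) / (k + 1)) := by
  have h1 : Ico a b = Iio b \ Iio a := by
    ext x
    simp
  have ha : (0 : ℝ) < a := a.2
  rw [h1, measure_sdiff (Iio_subset_Iio hab) measurableSet_Iio.nullMeasurableSet
    (by rw [Measure.volumeIoiPow_apply_Iio]; exact ENNReal.ofReal_ne_top),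
    Measure.volumeIoiPow_apply_Iio, Measure.volumeIoiPow_apply_Iio,
    ← ENNReal.ofReal_sub _ (by positivity), sub_div]

/-- The part of the cone over `B` between the radii `1 - δ` and `1`. -/
def radialShell (B : Set (Metric.sphere (0 : EuclideanSpace ℝ (Fin n)) 1)) (δ : ℝ) :
    Set (EuclideanSpace ℝ (Fin n)) :=
  {y | ∃ u ∈ B, ∃ t ∈ Ico (1 - δ) 1, y = t • (u : EuclideanSpace ℝ (Fin n))}

theorem volume_radialShell (hn : 1 ≤ n) {B : Set (Metric.sphere (0 : EuclideanSpace ℝ (Fin n)) 1)}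
    (hB : MeasurableSet B) {δ : ℝ} (h0 : 0 < δ) (h1 : δ < 1) :
    volume (radialShell B δ) = sphereMeasure n B * ENNReal.ofReal ((1 - (1 - δ) ^ n) / n) := by
  set a : Ioi (0 : ℝ) := ⟨1 - δ, by rw [mem_Ioi]; linarith⟩ with ha
  set b : Ioi (0 : ℝ) := ⟨1, mem_Ioi.2 one_pos⟩ with hb
  have hab : a ≤ b := by
    rw [← Subtype.coe_le_coe]
    change 1 - δ ≤ 1
    linarith
  have hmp := (volume : Measure (EuclideanSpace ℝ (Fin n))).measurePreserving_homeomorphUnitSphereProd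
  have hset : radialShell B δ = Subtype.val ''
      (homeomorphUnitSphereProd (EuclideanSpace ℝ (Fin n)) ⁻¹' (B ×ˢ Ico a b)) := by
    rw [← Homeomorph.image_symm, image_image]
    ext y
    simp only [radialShell, mem_ofPred_eq, mem_image, mem_prod, Prod.exists]
    constructor
    · rintro ⟨u, hu, t, ht, rfl⟩
      have ht0 : 0 < t := by have := ht.1; linarith
      exact ⟨u, ⟨t, ht0⟩, ⟨hu, ht.1, ht.2⟩, by simp⟩
    · rintro ⟨u, t, ⟨hu, ht1, ht2⟩, rfl⟩
      exact ⟨u, hu, t, ⟨ht1, ht2⟩, by simp⟩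
  have hfr : Module.finrank ℝ (EuclideanSpace ℝ (Fin n)) - 1 + 1 = n := by
    simp
    omega
  have hfr' : ((Module.finrank ℝ (EuclideanSpace ℝ (Fin n)) - 1 : ℕ) : ℝ) + 1 = n := by
    exact_mod_cast hfr
  rw [hset, ← comap_subtype_coe_apply (measurableSet_singleton _).compl,
    hmp.measure_preimage (hB.prod measurableSet_Ico).nullMeasurableSet, Measure.prod_prod,
    volumeIoiPow_apply_Ico _ hab, hfr, hfr']
  simp [ha, hb, sphereMeasure]

/-- The ratio is a difference quotient at 0 of a function with derivative 1. Hence the volume of a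
radial shell divided by δ recovers the spherical measure of its base. -/
theorem tendsto_shell_ratio (hn : 1 ≤ n) :
    Tendsto (fun δ : ℝ => (1 - (1 - δ) ^ n) / n / δ) (𝓝[>] 0) (𝓝 1) := by
  have h1 : HasDerivAt (fun δ : ℝ => (1 - (1 - δ) ^ n) / n) 1 0 := by
    have h2 := ((((hasDerivAt_id (0 : ℝ)).const_sub 1).pow n).const_sub 1).div_const (n : ℝ)
    have hn0 : (n : ℝ) ≠ 0 := by positivity
    refine h2.congr_deriv ?_
    simp [hn0]
  have h3 := (hasDerivWithinAt_iff_tendsto_slope' (notMem_Ioi.2 le_rfl)).1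
    (h1.hasDerivWithinAt (s := Ioi 0))
  refine h3.congr fun t => ?_
  rw [slope_def_field]
  simp

end Shell

/-! ### Thin cylinders over boundary pieces, and linearization of the Gauss map. -/

section Flattening

variable {n : ℕ} {K U : Set (EuclideanSpace ℝ (Fin n))} {φ : EuclideanSpace ℝ (Fin n) → ℝ}
  {u x₀ : EuclideanSpace ℝ (Fin n)}

/-- The cylinder over the projection of `A` to `uᗮ`, between the heights `1 - δ` and `1`. -/
def flatShell (u : EuclideanSpace ℝ (Fin n)) (A : Set (EuclideanSpace ℝ (Fin n))) (δ : ℝ) :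
    Set (EuclideanSpace ℝ (Fin n)) :=
  {y | ∃ x ∈ A, ∃ t ∈ Ico (1 - δ) 1, y = (x - ⟪u, x⟫ • u) + t • u}

theorem coe_orthogonalProjectionOnto_unit (hu : ‖u‖ = 1) (x : EuclideanSpace ℝ (Fin n)) :
    ((ℝ ∙ u)ᗮ.orthogonalProjectionOnto x : EuclideanSpace ℝ (Fin n)) = x - ⟪u, x⟫ • u := by
  have := Submodule.starProjection_add_starProjection_orthogonal (K := ℝ ∙ u) x
  rw [Submodule.starProjection_unit_singleton ℝ hu] at this
  exact eq_sub_of_add_eq' this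

theorem volume_flatShell (hu : ‖u‖ = 1) (A : Set (EuclideanSpace ℝ (Fin n))) (δ : ℝ) :
    volume (flatShell u A δ) =
      volume ((ℝ ∙ u)ᗮ.orthogonalProjectionOnto '' A) * ENNReal.ofReal δ := by
  -- The height coordinate enters `splitEquiv` with a minus sign, so the half-open interval of
  -- heights is reflected.
  have hset : splitEquiv u hu ⁻¹' flatShell u A δ =
      ((ℝ ∙ u)ᗮ.orthogonalProjectionOnto '' A) ×ˢ Ioc (-1) (δ - 1) := by
    ext q
    simp only [mem_preimage, flatShell, mem_ofPred_eq, mem_prod, mem_image]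
    have key : ∀ (x : EuclideanSpace ℝ (Fin n)) (t : ℝ), (x - ⟪u, x⟫ • u) + t • u =
        splitEquiv u hu ((ℝ ∙ u)ᗮ.orthogonalProjectionOnto x, -t) := by
      intro x t
      rw [splitEquiv_apply, coe_orthogonalProjectionOnto_unit hu]
      module
    constructor
    · rintro ⟨x, hx, t, ht, hq⟩
      rw [key] at hq
      rw [(splitEquiv u hu).injective hq]
      refine ⟨⟨x, hx, rfl⟩, ?_⟩
      have h1 := ht.1
      have h2 := ht.2
      constructor <;> simp only <;> linarith
    · rintro ⟨⟨x, hx, hq1⟩, hq2⟩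
      refine ⟨x, hx, -q.2, ?_, ?_⟩
      · have h1 := hq2.1
        have h2 := hq2.2
        constructor <;> linarith
      · rw [key, hq1, neg_neg]
  rw [← (measurePreserving_splitEquiv u hu).measure_preimage_emb
    (measurableEmbedding_splitEquiv u hu), hset, Measure.volume_eq_prod, Measure.prod_prod,
    Real.volume_Ioc]
  congr 2
  ring

/-- As φ vanishes at both boundary points, strict differentiability at x₀ says that Dφ(x₀)(x - y) =
‖∇φ(x₀)‖ ⟨u, x - y⟩ is small relative to x - y. -/
theorem IsLocalDefiningFn.exists_ball_tangential (h : IsLocalDefiningFn K U φ) (hc : IsClosed K)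
    (hx : x₀ ∈ U) (hxu : unitGradient φ x₀ = u) {η : ℝ} (hη : 0 < η) :
    ∃ r > 0, Metric.ball x₀ r ⊆ U ∧
      ∀ x ∈ frontier K ∩ Metric.ball x₀ r, ∀ y ∈ frontier K ∩ Metric.ball x₀ r,
        |⟪u, x - y⟫| ≤ η * ‖x - y‖ := by
  have hg : 0 < ‖gradient φ x₀‖ := norm_pos_iff.2 (h.gradient_ne hx)
  have hφ : HasStrictFDerivAt φ (fderiv ℝ φ x₀) x₀ :=
    (h.contDiffOn.contDiffAt (h.isOpen.mem_nhds hx)).hasStrictFDerivAt (by norm_num)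
  obtain ⟨r₁, hr₁, h1⟩ := Metric.eventually_nhds_iff_ball.1
    (hφ.isLittleO.bound (mul_pos hg hη))
  obtain ⟨r₂, hr₂, h2⟩ := Metric.isOpen_iff.1 h.isOpen x₀ hx
  have hsub : Metric.ball x₀ (min r₁ r₂) ⊆ U :=
    (Metric.ball_subset_ball (min_le_right _ _)).trans h2
  refine ⟨min r₁ r₂, lt_min hr₁ hr₂, hsub, fun x hx' y hy' => ?_⟩
  have hxy : (x, y) ∈ Metric.ball (x₀, x₀) r₁ := by
    rw [← ball_prod_same]
    exact ⟨Metric.ball_subset_ball (min_le_left _ _) hx'.2,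
      Metric.ball_subset_ball (min_le_left _ _) hy'.2⟩
  have h3 := h1 _ hxy
  simp only [h.apply_eq_zero hc (hsub hx'.2) hx'.1, h.apply_eq_zero hc (hsub hy'.2) hy'.1,
    sub_zero, zero_sub, norm_neg, Real.norm_eq_abs, h.fderiv_apply hx, hxu, abs_mul,
    abs_norm] at h3
  rw [mul_assoc] at h3
  exact le_of_mul_le_mul_left h3 hg

theorem norm_tangential_le (hu : ‖u‖ = 1) (v : EuclideanSpace ℝ (Fin n)) (t : ℝ) :
    ‖v - ⟪u, v⟫ • u‖ ≤ ‖(v - ⟪u, v⟫ • u) + t • u‖ ∧ |t| ≤ ‖(v - ⟪u, v⟫ • u) + t • u‖ := by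
  have horth : ⟪v - ⟪u, v⟫ • u, u⟫ = 0 := by
    rw [inner_sub_left, inner_smul_left, real_inner_self_eq_norm_sq, hu, real_inner_comm]
    simp
  have h1 : ‖(v - ⟪u, v⟫ • u) + t • u‖ ^ 2 = ‖v - ⟪u, v⟫ • u‖ ^ 2 + t ^ 2 := by
    rw [norm_add_sq_real, inner_smul_right, horth, norm_smul, hu]
    simp
  constructor
  · refine le_of_sq_le_sq ?_ (norm_nonneg _)
    rw [h1]
    nlinarith [sq_nonneg t]
  · refine le_of_sq_le_sq ?_ (norm_nonneg _)
    rw [h1, sq_abs]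
    nlinarith [sq_nonneg ‖v - ⟪u, v⟫ • u‖]

/-- Near a boundary point, the Gauss map is close to its linearization, in coordinates on the
tangent space. -/
theorem IsLocalDefiningFn.exists_ball_approximates (h : IsLocalDefiningFn K U φ) (hc : IsClosed K)
    (hK : Convex ℝ K) (hx : x₀ ∈ U) (hxu : unitGradient φ x₀ = u)
    {τ : ℝ} (hτ : 0 < τ) {η : ℝ} (hη : 0 < η) (hη1 : η ≤ 1 / 2) :
    ∃ r > 0, ∃ δ₀ ∈ Ioo (0 : ℝ) 1,
      (∀ x ∈ frontier K ∩ Metric.ball x₀ r, ∀ y ∈ frontier K ∩ Metric.ball x₀ r,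
        (1 - η) * ‖x - y‖ ≤ ‖(x - y) - ⟪u, x - y⟫ • u‖) ∧
      ∀ x ∈ frontier K ∩ Metric.ball x₀ r, ∀ y ∈ frontier K ∩ Metric.ball x₀ r,
        ∀ s ∈ Ico (1 - δ₀) 1, ∀ t ∈ Ico (1 - δ₀) 1,
        ‖s • outerNormal K x - t • outerNormal K y -
          shapeOperator φ x₀ (((x - ⟪u, x⟫ • u) + s • u) - ((y - ⟪u, y⟫ • u) + t • u))‖ ≤
          τ * ‖((x - ⟪u, x⟫ • u) + s • u) - ((y - ⟪u, y⟫ • u) + t • u)‖ := by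
  have hu : ‖u‖ = 1 := hxu ▸ h.norm_unitGradient hx
  set D := fderiv ℝ (unitGradient φ) x₀ with hD
  set M := ‖D‖ + 1 with hM
  have hM0 : 0 < M := by positivity
  set η' := min η (τ / (8 * M)) with hη'
  have hη'0 : 0 < η' := lt_min hη (by positivity)
  obtain ⟨r₁, hr₁, hrU, htan⟩ := h.exists_ball_tangential hc hx hxu hη'0
  obtain ⟨r₂, hr₂, hstr⟩ := Metric.eventually_nhds_iff_ball.1
    ((h.hasStrictFDerivAt_unitGradient hx).isLittleO.bound (show 0 < τ / 8 by positivity))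
  have hNc : ContinuousAt (unitGradient φ) x₀ :=
    h.contDiffOn_unitGradient.continuousOn.continuousAt (h.isOpen.mem_nhds hx)
  obtain ⟨r₃, hr₃, hcont⟩ := Metric.eventually_nhds_iff_ball.1
    (hNc.eventually (Metric.ball_mem_nhds _ (show 0 < τ / 4 by positivity)))
  set r := min r₁ (min r₂ r₃) with hr
  have hr1 : r ≤ r₁ := min_le_left _ _
  have hr2 : r ≤ r₂ := (min_le_right _ _).trans (min_le_left _ _)
  have hr3 : r ≤ r₃ := (min_le_right _ _).trans (min_le_right _ _)
  have hbil : ∀ x ∈ frontier K ∩ Metric.ball x₀ r, ∀ y ∈ frontier K ∩ Metric.ball x₀ r,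
      |⟪u, x - y⟫| ≤ η' * ‖x - y‖ ∧ (1 - η) * ‖x - y‖ ≤ ‖(x - y) - ⟪u, x - y⟫ • u‖ := by
    intro x hx' y hy'
    have h1 := htan x ⟨hx'.1, Metric.ball_subset_ball hr1 hx'.2⟩ y
      ⟨hy'.1, Metric.ball_subset_ball hr1 hy'.2⟩
    refine ⟨h1, ?_⟩
    have h2 : ‖x - y‖ ≤ ‖(x - y) - ⟪u, x - y⟫ • u‖ + ‖⟪u, x - y⟫ • u‖ := by
      simpa using norm_add_le ((x - y) - ⟪u, x - y⟫ • u) (⟪u, x - y⟫ • u)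
    rw [norm_smul, hu, mul_one, Real.norm_eq_abs] at h2
    have h3 : η' * ‖x - y‖ ≤ η * ‖x - y‖ :=
      mul_le_mul_of_nonneg_right (min_le_left _ _) (norm_nonneg _)
    linarith
  refine ⟨r, lt_min hr₁ (lt_min hr₂ hr₃), min (1 / 2) (τ / (4 * M)),
    ⟨lt_min (by norm_num) (by positivity), (min_le_left _ _).trans_lt (by norm_num)⟩,
    fun x hx' y hy' => (hbil x hx' y hy').2, fun x hx' y hy' s hs t ht => ?_⟩
  obtain ⟨hb1, hb2⟩ := hbil x hx' y hy'
  have hxU := hrU (Metric.ball_subset_ball hr1 hx'.2)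
  have hyU := hrU (Metric.ball_subset_ball hr1 hy'.2)
  rw [h.outerNormal_eq hc hK hxU hx'.1, h.outerNormal_eq hc hK hyU hy'.1]
  set v := x - y with hv
  have hw : ((x - ⟪u, x⟫ • u) + s • u) - ((y - ⟪u, y⟫ • u) + t • u) =
      (v - ⟪u, v⟫ • u) + (s - t) • u := by
    rw [hv, inner_sub_right]
    module
  rw [hw]
  set w := v - ⟪u, v⟫ • u with hwdef
  obtain ⟨hn1, hn2⟩ := norm_tangential_le hu v (s - t)
  rw [← hwdef] at hn1 hn2
  have huw : ⟪u, w + (s - t) • u⟫ = s - t := by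
    rw [hwdef, inner_add_right, inner_sub_right, inner_smul_right, inner_smul_right,
      real_inner_self_eq_norm_sq, hu]
    ring
  have hL : shapeOperator φ x₀ (w + (s - t) • u) = D w + (s - t) • u := by
    rw [shapeOperator_apply, hxu, huw, add_sub_cancel_right]
  have hvw : v = w + ⟪u, v⟫ • u := by rw [hwdef]; module
  -- There are four sources of error: the variation of the normal near x₀, the nonlinearity of the
  -- Gauss map, the normal component of x - y, and the distance of t from 1. Each contributes at
  -- most a quarter of τ.
  have hdec : s • unitGradient φ x - t • unitGradient φ y - shapeOperator φ x₀ (w + (s - t) • u) =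
      (s - t) • (unitGradient φ x - unitGradient φ x₀) +
        t • (unitGradient φ x - unitGradient φ y - D v) + t • (⟪u, v⟫ • D u) + (t - 1) • D w := by
    have : D v = D w + ⟪u, v⟫ • D u := by
      conv_lhs => rw [hvw]
      rw [map_add, map_smul]
    rw [hL, hxu, this]
    module
  have hpair : (x, y) ∈ Metric.ball (x₀, x₀) r₂ := by
    rw [← ball_prod_same]
    exact ⟨Metric.ball_subset_ball hr2 hx'.2, Metric.ball_subset_ball hr2 hy'.2⟩
  have e1 := hstr _ hpair
  simp only [← hD, ← hv] at e1
  have e2 : ‖unitGradient φ x - unitGradient φ x₀‖ ≤ τ / 4 := by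
    have := hcont x (Metric.ball_subset_ball hr3 hx'.2)
    rw [dist_eq_norm] at this
    exact this.le
  have ht0 : 0 ≤ t := by
    have := ht.1
    have := min_le_left (1 / 2 : ℝ) (τ / (4 * M))
    linarith
  have ht1 : ‖t‖ ≤ 1 := by
    rw [Real.norm_of_nonneg ht0]
    exact ht.2.le
  have ht2 : ‖t - 1‖ ≤ τ / (4 * M) := by
    have h1 := ht.1
    have h2 := ht.2
    have := min_le_right (1 / 2 : ℝ) (τ / (4 * M))
    rw [Real.norm_eq_abs, abs_le]
    constructor <;> linarith [show (0 : ℝ) < τ / (4 * M) by positivity]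
  set W := ‖w + (s - t) • u‖ with hW
  have hvW : ‖v‖ ≤ 2 * W := by nlinarith [norm_nonneg v]
  have hDu : ‖D u‖ ≤ M := by
    have := D.le_opNorm u
    rw [hu, mul_one] at this
    linarith
  have hDw : ‖D w‖ ≤ M * W := by
    refine (D.le_opNorm w).trans ?_
    have : ‖D‖ ≤ M := by linarith
    gcongr
  have b1 : ‖(s - t) • (unitGradient φ x - unitGradient φ x₀)‖ ≤ W * (τ / 4) := by
    rw [norm_smul, Real.norm_eq_abs]
    gcongr
  have b2 : ‖t • (unitGradient φ x - unitGradient φ y - D v)‖ ≤ 1 * (τ / 8 * (2 * W)) := by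
    rw [norm_smul]
    gcongr
    exact e1.trans (by gcongr)
  have b3 : ‖t • (⟪u, v⟫ • D u)‖ ≤ 1 * ((τ / (8 * M) * (2 * W)) * M) := by
    rw [norm_smul, norm_smul, Real.norm_eq_abs ⟪u, v⟫]
    gcongr
    refine hb1.trans ?_
    gcongr
    exact min_le_right _ _
  have b4 : ‖(t - 1) • D w‖ ≤ τ / (4 * M) * (M * W) := by
    rw [norm_smul]
    gcongr
  rw [hdec]
  have c3 : 1 * ((τ / (8 * M) * (2 * W)) * M) = τ / 4 * W := by field_simp; ring
  have c4 : τ / (4 * M) * (M * W) = τ / 4 * W := by field_simp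
  rw [c3] at b3
  rw [c4] at b4
  refine (norm_add_le _ _).trans ?_
  refine (add_le_add_left (norm_add_le _ _) _).trans ?_
  refine (add_le_add_left (add_le_add_left (norm_add_le _ _) _) _).trans ?_
  linarith

end Flattening

/-! ### Local distortion of measure by the Gauss map. -/

section GaussMap

open scoped NNReal ENNReal

theorem LipschitzOnWith.euclideanHausdorffMeasure_image_le {X Y : Type*} [MetricSpace X]
    [MeasurableSpace X] [BorelSpace X] [MetricSpace Y] [MeasurableSpace Y] [BorelSpace Y]
    {C : ℝ≥0} {f : X → Y} {s : Set X} (hf : LipschitzOnWith C f s) (d : ℕ) :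
    Measure.euclideanHausdorffMeasure d (f '' s) ≤
      (C : ℝ≥0∞) ^ d * Measure.euclideanHausdorffMeasure d s := by
  have h1 := hf.hausdorffMeasure_image_le (d := (d : ℝ)) (Nat.cast_nonneg d)
  rw [ENNReal.rpow_natCast] at h1
  simp only [Measure.euclideanHausdorffMeasure_def, Measure.smul_apply, Measure.nnreal_smul_coe_apply]
  calc _ ≤ _ := mul_le_mul_right h1 _
    _ = _ := by ring

variable {n : ℕ} {K : Set (EuclideanSpace ℝ (Fin n))} {u x₀ : EuclideanSpace ℝ (Fin n)}

/-- A nearly isometric projection to a hyperplane nearly preserves the Hausdorff measure. -/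
theorem euclideanHausdorffMeasure_projection (hu : ‖u‖ = 1) {A : Set (EuclideanSpace ℝ (Fin n))}
    {η : ℝ} (hη : η < 1) (hA : ∀ x ∈ A, ∀ y ∈ A,
      (1 - η) * ‖x - y‖ ≤ ‖(x - y) - ⟪u, x - y⟫ • u‖) :
    volume ((ℝ ∙ u)ᗮ.orthogonalProjectionOnto '' A) ≤
      Measure.euclideanHausdorffMeasure (n - 1) A ∧
    Measure.euclideanHausdorffMeasure (n - 1) A ≤
      (Real.toNNReal (1 - η)⁻¹ : ℝ≥0∞) ^ (n - 1) *
        volume ((ℝ ∙ u)ᗮ.orthogonalProjectionOnto '' A) := by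
  have hfr : Module.finrank ℝ (ℝ ∙ u)ᗮ = n - 1 := by
    have : Module.finrank ℝ (ℝ ∙ u)ᗮ + 1 = n := by simpa using finrank_orthogonal_unit u hu
    omega
  have hvol : (volume : Measure (ℝ ∙ u)ᗮ) = Measure.euclideanHausdorffMeasure (n - 1) := by
    rw [← hfr, InnerProductSpace.euclideanHausdorffMeasure_eq_volume]
  set P := (ℝ ∙ u)ᗮ.orthogonalProjectionOnto with hP
  have hpos : 0 < 1 - η := by linarith
  have hPn : ∀ x ∈ A, ∀ y ∈ A, (1 - η) * ‖x - y‖ ≤ ‖P x - P y‖ := by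
    intro x hx y hy
    rw [← map_sub]
    change _ ≤ ‖((P (x - y) : (ℝ ∙ u)ᗮ) : EuclideanSpace ℝ (Fin n))‖
    rw [hP, coe_orthogonalProjectionOnto_unit hu]
    exact hA x hx y hy
  rw [hvol]
  constructor
  · have hl : LipschitzOnWith 1 P A := by
      refine LipschitzOnWith.of_dist_le_mul fun x _ y _ => ?_
      rw [dist_eq_norm, dist_eq_norm, ← map_sub]
      exact ((ℝ ∙ u)ᗮ.orthogonalProjectionOnto.le_opNorm _).trans
        (mul_le_mul_of_nonneg_right (Submodule.orthogonalProjectionOnto_norm_le _) (norm_nonneg _))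
    simpa using LipschitzOnWith.euclideanHausdorffMeasure_image_le hl (n - 1)
  · have hinj : InjOn P A := by
      intro x hx y hy hxy
      have h1 := hPn x hx y hy
      rw [hxy, sub_self, norm_zero] at h1
      have h2 : ‖x - y‖ ≤ 0 := by
        by_contra! hcon
        exact absurd (mul_pos hpos hcon) h1.not_gt
      exact sub_eq_zero.1 (norm_le_zero_iff.1 h2)
    set g := Function.invFunOn P A with hg
    have hgP : ∀ x ∈ A, g (P x) = x := fun x hx => hinj.leftInvOn_invFunOn hx
    have hl : LipschitzOnWith (Real.toNNReal (1 - η)⁻¹) g (P '' A) := by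
      refine LipschitzOnWith.of_dist_le_mul ?_
      rintro _ ⟨x, hx, rfl⟩ _ ⟨y, hy, rfl⟩
      rw [hgP x hx, hgP y hy, dist_eq_norm, dist_eq_norm,
        Real.coe_toNNReal _ (inv_pos.2 hpos).le, ← div_eq_inv_mul, le_div_iff₀ hpos, mul_comm]
      exact hPn x hx y hy
    have himg : g '' (P '' A) = A := by
      rw [image_image]
      exact (image_congr fun x hx => hgP x hx).trans (image_id' A)
    have := LipschitzOnWith.euclideanHausdorffMeasure_image_le hl (n - 1)
    rwa [himg] at this

/-- The image of the spherical measure under the map sending a unit vector to the boundary point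
with this outer normal. -/
def sphereContactMeasure (K : Set (EuclideanSpace ℝ (Fin n))) : Measure (EuclideanSpace ℝ (Fin n)) :=
  (sphereMeasure n).map fun v : Metric.sphere (0 : EuclideanSpace ℝ (Fin n)) 1 => contact K v

namespace IsSymmC2PlusBody

theorem continuous_contact_sphere (h : IsSymmC2PlusBody K) :
    Continuous fun v : Metric.sphere (0 : EuclideanSpace ℝ (Fin n)) 1 => contact K v :=
  continuousOn_iff_continuous_domRestrict.1 h.continuousOn_contact

/-- The map (x - ⟨u, x⟩u) + t u ↦ t N(x) carries the flat shell over A onto the radial shell over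
its normals, and near x₀ it is approximated by the shape operator, of determinant κ(x₀). The volume
bounds for approximately linear maps, divided by δ as δ tends to 0, become bounds on the spherical
measure. -/
theorem exists_ball_projection_bounds (h : IsSymmC2PlusBody K) (hn : 1 ≤ n)
    (hx₀ : x₀ ∈ frontier K) (hxu : outerNormal K x₀ = u) {a b : ℝ≥0}
    (ha : (a : ℝ) < gaussCurvature K x₀) (hb : gaussCurvature K x₀ < b) {η : ℝ} (hη : 0 < η)
    (hη1 : η ≤ 1 / 2) :
    ∃ r > 0, (∀ x ∈ frontier K ∩ Metric.ball x₀ r, ∀ y ∈ frontier K ∩ Metric.ball x₀ r,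
        (1 - η) * ‖x - y‖ ≤ ‖(x - y) - ⟪u, x - y⟫ • u‖) ∧
      ∀ A, MeasurableSet A → A ⊆ frontier K ∩ Metric.ball x₀ r →
        a * volume ((ℝ ∙ u)ᗮ.orthogonalProjectionOnto '' A) ≤
          sphereContactMeasure K A ∧
        sphereContactMeasure K A ≤
          b * volume ((ℝ ∙ u)ᗮ.orthogonalProjectionOnto '' A) := by
  have hfin := isFiniteMeasure_sphereMeasure n
  obtain ⟨U, φ, hxU, hd⟩ := h.isC2Plus.c2.exists_isLocalDefiningFn hx₀
  have hxu' : unitGradient φ x₀ = u :=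
    (hd.outerNormal_eq h.isClosed h.convex hxU hx₀).symm.trans hxu
  have hu : ‖u‖ = 1 := hxu' ▸ hd.norm_unitGradient hxU
  have hdet := hd.gaussCurvature_eq_det h.isClosed h.convex hxU hx₀
  have hκ := h.isC2Plus.curvature_pos x₀ hx₀
  have hdet1 : (a : ℝ≥0∞) < ENNReal.ofReal |(shapeOperator φ x₀).det| := by
    rw [← hdet, abs_of_pos hκ, ← ENNReal.ofReal_coe_nnreal]
    exact (ENNReal.ofReal_lt_ofReal_iff hκ).2 ha
  have hdet2 : ENNReal.ofReal |(shapeOperator φ x₀).det| < (b : ℝ≥0∞) := by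
    rw [← hdet, abs_of_pos hκ, ← ENNReal.ofReal_coe_nnreal]
    exact (ENNReal.ofReal_lt_ofReal_iff (hκ.trans hb)).2 hb
  obtain ⟨τ, ⟨hlo, hhi⟩, hτ⟩ := (((mul_le_addHaar_image_of_lt_det volume _ hdet1).and
    (addHaar_image_le_mul_of_det_lt volume _ hdet2)).and eventually_mem_nhdsWithin).exists
  replace hτ : (0 : ℝ) < τ := hτ
  obtain ⟨r, hr, δ₀, hδ₀, hbil, happ⟩ :=
    hd.exists_ball_approximates h.isClosed h.convex hxU hxu' hτ hη hη1
  refine ⟨r, hr, hbil, fun A hAm hA => ?_⟩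
  set P := (ℝ ∙ u)ᗮ.orthogonalProjectionOnto with hP
  have hpos : 0 < 1 - η := by linarith
  have hinj : InjOn P A := by
    intro x hx y hy hxy
    have h1 := hbil x (hA hx) y (hA hy)
    rw [← coe_orthogonalProjectionOnto_unit hu, ← hP, map_sub, hxy, sub_self] at h1
    have h2 : ‖x - y‖ ≤ 0 := by
      by_contra! hcon
      refine absurd (mul_pos hpos hcon) ?_
      simpa using h1
    exact sub_eq_zero.1 (norm_le_zero_iff.1 h2)
  set g : EuclideanSpace ℝ (Fin n) → EuclideanSpace ℝ (Fin n) := fun y =>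
    ⟪u, y⟫ • outerNormal K (Function.invFunOn P A (P y)) with hg
  have hgval : ∀ x ∈ A, ∀ t : ℝ, g ((x - ⟪u, x⟫ • u) + t • u) = t • outerNormal K x := by
    intro x hx t
    have hPu : P u = 0 :=
      Submodule.orthogonalProjectionOnto_orthogonalComplement_singleton_eq_zero u
    have h1 : P ((x - ⟪u, x⟫ • u) + t • u) = P x := by
      rw [map_add, map_sub, map_smul, map_smul, hPu]
      simp
    have h2 : ⟪u, (x - ⟪u, x⟫ • u) + t • u⟫ = t := by
      rw [inner_add_right, inner_sub_right, inner_smul_right, inner_smul_right,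
        real_inner_self_eq_norm_sq, hu]
      ring
    simp only [hg]
    rw [h1, h2, hinj.leftInvOn_invFunOn hx]
  set B : Set (Metric.sphere (0 : EuclideanSpace ℝ (Fin n)) 1) :=
    (fun v : Metric.sphere (0 : EuclideanSpace ℝ (Fin n)) 1 => contact K v) ⁻¹' A with hB
  have hBm : MeasurableSet B := h.continuous_contact_sphere.measurable hAm
  have hνB : sphereContactMeasure K A = sphereMeasure n B :=
    Measure.map_apply h.continuous_contact_sphere.measurable hAm
  rw [hνB]
  have himg : ∀ δ, g '' flatShell u A δ = radialShell B δ := by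
    intro δ
    ext y
    constructor
    · rintro ⟨_, ⟨x, hx, t, ht, rfl⟩, rfl⟩
      have hxf := (hA hx).1
      refine ⟨⟨outerNormal K x, ?_⟩, ?_, t, ht, hgval x hx t⟩
      · simpa using norm_outerNormal h.isC2Plus.c2 h.isClosed h.convex hxf
      · change contact K (outerNormal K x) ∈ A
        rwa [h.contact_outerNormal hxf]
    · rintro ⟨v, hv, t, ht, rfl⟩
      refine ⟨_, ⟨contact K v, hv, t, ht, rfl⟩, ?_⟩
      rw [hgval _ hv, h.outerNormal_contact (by simp)]
  have happrox : ∀ δ ≤ δ₀, ApproximatesLinearOn g (shapeOperator φ x₀) (flatShell u A δ) τ := by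
    intro δ hδ
    rintro _ ⟨x, hx, s, hs, rfl⟩ _ ⟨y, hy, t, ht, rfl⟩
    rw [hgval x hx, hgval y hy]
    exact happ x (hA hx) y (hA hy) s ⟨by linarith [hs.1], hs.2⟩ t ⟨by linarith [ht.1], ht.2⟩
  set V := volume (P '' A) with hV
  have hlim : Tendsto (fun δ : ℝ => sphereMeasure n B *
      ENNReal.ofReal ((1 - (1 - δ) ^ n) / n / δ)) (𝓝[>] 0) (𝓝 (sphereMeasure n B)) := by
    have h1 := ENNReal.tendsto_ofReal (tendsto_shell_ratio hn)
    rw [ENNReal.ofReal_one] at h1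
    simpa using ENNReal.Tendsto.const_mul (a := sphereMeasure n B) h1 (Or.inl one_ne_zero)
  have hev : ∀ᶠ δ in 𝓝[>] (0 : ℝ), a * V ≤
      sphereMeasure n B * ENNReal.ofReal ((1 - (1 - δ) ^ n) / n / δ) ∧
      sphereMeasure n B * ENNReal.ofReal ((1 - (1 - δ) ^ n) / n / δ) ≤ b * V := by
    filter_upwards [Ioo_mem_nhdsGT hδ₀.1] with δ hδ
    have hδ1 : δ < 1 := hδ.2.trans hδ₀.2
    have h1 := hlo _ _ (happrox δ hδ.2.le)
    have h2 := hhi _ _ (happrox δ hδ.2.le)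
    have hsplit : ENNReal.ofReal ((1 - (1 - δ) ^ n) / n) =
        ENNReal.ofReal ((1 - (1 - δ) ^ n) / n / δ) * ENNReal.ofReal δ := by
      rw [← ENNReal.ofReal_mul' hδ.1.le, div_mul_cancel₀ _ hδ.1.ne']
    rw [himg, volume_radialShell hn hBm hδ.1 hδ1, volume_flatShell hu, hsplit, ← mul_assoc,
      ← mul_assoc] at h1 h2
    have hδpos : ENNReal.ofReal δ ≠ 0 := (ENNReal.ofReal_pos.2 hδ.1).ne'
    exact ⟨(ENNReal.mul_le_mul_iff_left hδpos ENNReal.ofReal_ne_top).1 h1,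
      (ENNReal.mul_le_mul_iff_left hδpos ENNReal.ofReal_ne_top).1 h2⟩
  exact ⟨ge_of_tendsto hlim (hev.mono fun _ h => h.1), le_of_tendsto hlim (hev.mono fun _ h => h.2)⟩

/-- Comparison of the pulled back spherical measure with the surface area measure. -/
theorem exists_ball_measure_bounds (h : IsSymmC2PlusBody K) (hn : 1 ≤ n)
    (hx₀ : x₀ ∈ frontier K) {a b : ℝ≥0}
    (ha : (a : ℝ) < gaussCurvature K x₀) (hb : gaussCurvature K x₀ < b) :
    ∃ r > 0, ∀ A, MeasurableSet A → A ⊆ frontier K ∩ Metric.ball x₀ r →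
        a * Measure.euclideanHausdorffMeasure (n - 1) A ≤
          sphereContactMeasure K A ∧
        sphereContactMeasure K A ≤
          b * Measure.euclideanHausdorffMeasure (n - 1) A := by
  -- The gap between a and κ(x₀) leaves room for the factor (1 - η)^{-(n-1)} lost in projecting to
  -- the tangent hyperplane.
  obtain ⟨a', haa', ha'⟩ := exists_between ha
  lift a' to ℝ≥0 using a.2.trans haa'.le
  have hlim : Tendsto (fun η : ℝ => (a : ℝ) * ((1 - η)⁻¹) ^ (n - 1)) (𝓝[>] 0) (𝓝 a) := by
    have h1 : ContinuousAt (fun η : ℝ => (a : ℝ) * ((1 - η)⁻¹) ^ (n - 1)) 0 := by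
      fun_prop (disch := norm_num)
    simpa using h1.tendsto.mono_left (nhdsWithin_le_nhds (s := Ioi 0))
  obtain ⟨η, hηa, hη⟩ := ((hlim.eventually (gt_mem_nhds haa')).and
    (Ioo_mem_nhdsGT (show (0 : ℝ) < 1 / 2 by norm_num))).exists
  obtain ⟨r, hr, hbil, hAr⟩ := h.exists_ball_projection_bounds hn hx₀ rfl ha' hb hη.1 hη.2.le
  have hu := norm_outerNormal h.isC2Plus.c2 h.isClosed h.convex hx₀
  refine ⟨r, hr, fun A hAm hA => ?_⟩
  obtain ⟨h1, h2⟩ := hAr A hAm hA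
  obtain ⟨h3, h4⟩ := euclideanHausdorffMeasure_projection hu (by linarith [hη.2])
    fun x hx y hy => hbil x (hA hx) y (hA hy)
  refine ⟨le_trans ?_ h1, h2.trans (mul_le_mul_right h3 _)⟩
  refine (mul_le_mul_right h4 _).trans ?_
  rw [← mul_assoc]
  refine mul_le_mul_left ?_ _
  have h5 : a * Real.toNNReal (1 - η)⁻¹ ^ (n - 1) ≤ a' := by
    rw [← NNReal.coe_le_coe]
    push_cast
    rw [Real.coe_toNNReal _ (inv_nonneg.2 (by linarith [hη.2]))]
    exact hηa.le
  exact_mod_cast h5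

end IsSymmC2PlusBody

end GaussMap

/-! ### Change of variables between the sphere and the boundary. -/

section ChangeOfVariables

open scoped NNReal ENNReal

/-- Domination of measures up to constants close to one is a local property. -/
theorem measure_le_of_locally_le {X : Type*} [PseudoMetricSpace X] [MeasurableSpace X]
    [OpensMeasurableSpace X] {μ ν : Measure X} {S : Set X} (hS : IsCompact S)
    (hSm : MeasurableSet S) (hμ : μ Sᶜ = 0)
    (h : ∀ c : ℝ≥0, 1 < c → ∀ x ∈ S, ∃ r > 0, ∀ A, MeasurableSet A → A ⊆ S ∩ Metric.ball x r →
      μ A ≤ c * ν A) : μ ≤ ν := by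
  refine Measure.le_iff.2 fun A hA => ?_
  have key : ∀ c : ℝ≥0, 1 < c → μ A ≤ c * ν A := by
    intro c hc
    -- The induction carries an open superset, so that in the union step A is split along a
    -- measurable set.
    obtain ⟨V, -, hSV, hV⟩ := hS.induction_on
      (p := fun s => ∃ V, IsOpen V ∧ s ⊆ V ∧ ∀ A, MeasurableSet A → A ⊆ S ∩ V → μ A ≤ c * ν A)
      ⟨∅, isOpen_empty, Subset.rfl, fun A _ hA => by
        have : A = ∅ := subset_empty_iff.1 (hA.trans inter_subset_right)
        simp [this]⟩
      (fun s t hst ⟨V, hV, htV, H⟩ => ⟨V, hV, hst.trans htV, H⟩)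
      (fun s t ⟨V, hV, hsV, HV⟩ ⟨W, hW, htW, HW⟩ => ⟨V ∪ W, hV.union hW,
        union_subset_union hsV htW, fun A hAm hA => by
          rw [← measure_inter_add_sdiff A hV.measurableSet,
            ← measure_inter_add_sdiff (μ := ν) A hV.measurableSet, mul_add]
          refine add_le_add
            (HV _ (hAm.inter hV.measurableSet) fun x hx => ⟨(hA hx.1).1, hx.2⟩)
            (HW _ (hAm.diff hV.measurableSet) fun x hx => ⟨(hA hx.1).1, ?_⟩)
          exact (hA hx.1).2.resolve_left hx.2⟩)
      (fun x hx => by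
        obtain ⟨r, hr, H⟩ := h c hc x hx
        exact ⟨Metric.ball x r, mem_nhdsWithin_of_mem_nhds (Metric.ball_mem_nhds x hr),
          Metric.ball x r, Metric.isOpen_ball, Subset.rfl, H⟩)
    calc μ A ≤ μ (A ∩ S) + μ (A \ S) := (measure_inter_add_sdiff A hSm).ge
      _ = μ (A ∩ S) := by
          rw [measure_mono_null (show A \ S ⊆ Sᶜ from fun x hx => hx.2) hμ, add_zero]
      _ ≤ c * ν (A ∩ S) := hV _ (hA.inter hSm) fun x hx => ⟨hx.2, hSV hx.2⟩
      _ ≤ c * ν A := mul_le_mul_right (measure_mono inter_subset_left) _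
  have hlim : Tendsto (fun c : ℝ≥0 => (c : ℝ≥0∞) * ν A) (𝓝[>] 1) (𝓝 (1 * ν A)) :=
    ENNReal.Tendsto.mul_const
      ((ENNReal.continuous_coe.tendsto 1).mono_left nhdsWithin_le_nhds) (Or.inl one_ne_zero)
  rw [one_mul] at hlim
  exact ge_of_tendsto hlim (eventually_mem_nhdsWithin.mono fun c hc => key c hc)

variable {n : ℕ} {K : Set (EuclideanSpace ℝ (Fin n))} {x₀ : EuclideanSpace ℝ (Fin n)}

/-- The surface area measure weighted by the Gauss curvature. -/
def curvatureMeasure (K : Set (EuclideanSpace ℝ (Fin n))) : Measure (EuclideanSpace ℝ (Fin n)) :=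
  (surfaceMeasure K).withDensity fun x => ENNReal.ofReal (gaussCurvature K x)

theorem curvatureMeasure_apply {A : Set (EuclideanSpace ℝ (Fin n))} (hA : MeasurableSet A)
    (hAK : A ⊆ frontier K) : curvatureMeasure K A =
      ∫⁻ x in A, ENNReal.ofReal (gaussCurvature K x) ∂Measure.euclideanHausdorffMeasure (n - 1) := by
  rw [curvatureMeasure, withDensity_apply _ hA, surfaceMeasure, Measure.restrict_restrict hA,
    inter_eq_left.2 hAK]

namespace IsSymmC2PlusBody

theorem continuousOn_gaussCurvature (h : IsSymmC2PlusBody K) :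
    ContinuousOn (gaussCurvature K) (frontier K) :=
  CentroidBody.continuousOn_gaussCurvature h.isC2Plus.c2 h.isClosed h.convex

/-- Write c = t². Near x₀ the curvature stays between κ(x₀)/t and κ(x₀)t, so both measures lie
between these multiples of the Hausdorff measure, and the ratio of the multiples is c. -/
theorem exists_ball_measure_comparison (h : IsSymmC2PlusBody K) (hn : 1 ≤ n)
    (hx₀ : x₀ ∈ frontier K) {c : ℝ≥0} (hc : 1 < c) :
    ∃ r > 0, ∀ A, MeasurableSet A → A ⊆ frontier K ∩ Metric.ball x₀ r →
      sphereContactMeasure K A ≤ c * curvatureMeasure K A ∧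
      curvatureMeasure K A ≤ c * sphereContactMeasure K A := by
  have hκ := h.isC2Plus.curvature_pos x₀ hx₀
  obtain ⟨t, ht, htc⟩ : ∃ t : ℝ≥0, 1 < t ∧ t * t = c :=
    ⟨NNReal.sqrt c, by simpa using NNReal.sqrt_lt_sqrt.2 hc, NNReal.mul_self_sqrt c⟩
  have ht' : (1 : ℝ) < t := by exact_mod_cast ht
  set k : ℝ≥0 := ⟨gaussCurvature K x₀, hκ.le⟩ with hk
  have hkv : (k : ℝ) = gaussCurvature K x₀ := rfl
  have ha : ((k / t : ℝ≥0) : ℝ) < gaussCurvature K x₀ := by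
    push_cast
    rw [hkv]
    exact div_lt_self hκ ht'
  have hb : gaussCurvature K x₀ < ((k * t : ℝ≥0) : ℝ) := by
    push_cast
    rw [hkv]
    exact lt_mul_of_one_lt_right hκ ht'
  have hab : k * t = c * (k / t) := by
    have : t ≠ 0 := (zero_lt_one.trans ht).ne'
    rw [← htc]
    field_simp
  obtain ⟨r₁, hr₁, H⟩ := h.exists_ball_measure_bounds hn hx₀ ha hb
  obtain ⟨r₂, hr₂, hr₂'⟩ := Metric.mem_nhdsWithin_iff.1
    (h.continuousOn_gaussCurvature x₀ hx₀ (Ioo_mem_nhds ha hb))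
  refine ⟨min r₁ r₂, lt_min hr₁ hr₂, fun A hAm hA => ?_⟩
  obtain ⟨h1, h2⟩ := H A hAm (hA.trans (inter_subset_inter_right _
    (Metric.ball_subset_ball (min_le_left _ _))))
  have hκA : ∀ x ∈ A, gaussCurvature K x ∈ Ioo (((k / t : ℝ≥0) : ℝ)) ((k * t : ℝ≥0) : ℝ) :=
    fun x hx => hr₂' ⟨Metric.ball_subset_ball (min_le_right _ _) (hA hx).2, (hA hx).1⟩
  have hcm := curvatureMeasure_apply hAm fun x hx => (hA hx).1
  have h3 : ((k / t : ℝ≥0) : ℝ≥0∞) * Measure.euclideanHausdorffMeasure (n - 1) A ≤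
      curvatureMeasure K A := by
    rw [hcm, ← setLIntegral_const]
    refine setLIntegral_mono' hAm fun x hx => ?_
    rw [← ENNReal.ofReal_coe_nnreal]
    exact ENNReal.ofReal_le_ofReal (hκA x hx).1.le
  have h4 : curvatureMeasure K A ≤
      ((k * t : ℝ≥0) : ℝ≥0∞) * Measure.euclideanHausdorffMeasure (n - 1) A := by
    rw [hcm, ← setLIntegral_const]
    refine setLIntegral_mono' hAm fun x hx => ?_
    rw [← ENNReal.ofReal_coe_nnreal]
    exact ENNReal.ofReal_le_ofReal (hκA x hx).2.le
  rw [hab, ENNReal.coe_mul, mul_assoc] at h2 h4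
  exact ⟨h2.trans (mul_le_mul_right h3 _), h4.trans (mul_le_mul_right h1 _)⟩

/-- The Gauss map carries the surface area measure weighted by the curvature to the spherical
measure. -/
theorem sphereContactMeasure_eq (h : IsSymmC2PlusBody K) (hn : 1 ≤ n) :
    sphereContactMeasure K = curvatureMeasure K := by
  have hm : MeasurableSet (frontier K) := isClosed_frontier.measurableSet
  have hcpt : IsCompact (frontier K) :=
    h.isCompact.of_isClosed_subset isClosed_frontier h.isClosed.frontier_subset
  refine le_antisymm (measure_le_of_locally_le hcpt hm ?_ fun c hc x hx => ?_)
    (measure_le_of_locally_le hcpt hm ?_ fun c hc x hx => ?_)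
  · rw [sphereContactMeasure, Measure.map_apply h.continuous_contact_sphere.measurable hm.compl]
    convert measure_empty (μ := sphereMeasure n)
    refine eq_empty_of_forall_notMem fun v hv => hv (h.contact_mem (by simp))
  · obtain ⟨r, hr, H⟩ := h.exists_ball_measure_comparison hn hx hc
    exact ⟨r, hr, fun A hA hAK => (H A hA hAK).1⟩
  · rw [curvatureMeasure]
    refine withDensity_absolutelyContinuous _ _ ?_
    rw [surfaceMeasure, Measure.restrict_apply hm.compl, compl_inter_self, measure_empty]
  · obtain ⟨r, hr, H⟩ := h.exists_ball_measure_comparison hn hx hc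
    exact ⟨r, hr, fun A hA hAK => (H A hA hAK).2⟩

/-- The integrand on the sphere, transported to the boundary by the Gauss map. -/
theorem sphereIntegrand_outerNormal (h : IsSymmC2PlusBody K) {x : EuclideanSpace ℝ (Fin n)}
    (hx : x ∈ frontier K) :
    gaussCurvature K x * sphereIntegrand K (outerNormal K x) = -boundaryIntegrand K x := by
  have hu := norm_outerNormal h.isC2Plus.c2 h.isClosed h.convex hx
  rw [sphereIntegrand, curvatureFn_eq, h.supportFn_eq hu, h.contact_outerNormal hx,
    boundaryIntegrand, ← mul_neg, ← Real.log_inv, inv_div, div_eq_mul_inv _ (gaussCurvature K x)]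
  ring

theorem continuousOn_outerNormal (h : IsSymmC2PlusBody K) :
    ContinuousOn (outerNormal K) (frontier K) :=
  CentroidBody.continuousOn_outerNormal h.isC2Plus.c2 h.isClosed h.convex

/-- The spherical integral is first an integral against the pushforward under the inverse Gauss map;
this measure has density κ with respect to surface area, and κ is the factor that turns one
integrand into minus the other. -/
theorem integral_sphereIntegrand (h : IsSymmC2PlusBody K) (hn : 1 ≤ n) :
    Integrable (boundaryIntegrand K) (surfaceMeasure K) ∧
    ∫ u : Metric.sphere (0 : EuclideanSpace ℝ (Fin n)) 1, sphereIntegrand K u ∂(sphereMeasure n) =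
      -∫ x, boundaryIntegrand K x ∂(surfaceMeasure K) := by
  have hm : MeasurableSet (frontier K) := isClosed_frontier.measurableSet
  have hfin := isFiniteMeasure_sphereMeasure n
  have hcontact := h.continuous_contact_sphere.measurable
  set F : EuclideanSpace ℝ (Fin n) → ℝ := fun x => sphereIntegrand K (outerNormal K x) with hF
  have hFc : ContinuousOn F (frontier K) :=
    h.continuousOn_sphereIntegrand.comp h.continuousOn_outerNormal fun x hx => by
      simpa using norm_outerNormal h.isC2Plus.c2 h.isClosed h.convex hx
  -- F is known to be continuous only on ∂K; its measurability uses that the measure is concentrated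
  -- there.
  have hsupp : (sphereContactMeasure K).restrict (frontier K) = sphereContactMeasure K := by
    refine Measure.restrict_eq_self_of_ae_mem ?_
    exact (ae_map_iff (p := (· ∈ frontier K)) hcontact.aemeasurable hm).2
      (Eventually.of_forall fun v => h.contact_mem (by simp))
  have hFm : AEStronglyMeasurable F (sphereContactMeasure K) := by
    rw [← hsupp]
    exact hFc.aestronglyMeasurable hm
  have hval : ∀ v : Metric.sphere (0 : EuclideanSpace ℝ (Fin n)) 1,
      F (contact K v) = sphereIntegrand K v := fun v => by
    simp only [hF]
    rw [h.outerNormal_contact (by simp)]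
  have hint : Integrable F (sphereContactMeasure K) := by
    rw [sphereContactMeasure, integrable_map_measure hFm hcontact.aemeasurable]
    refine (integrable_sphere_of_continuousOn h.continuousOn_sphereIntegrand).congr
      (Eventually.of_forall fun v => (hval v).symm)
  have hκm : AEMeasurable (fun x => (gaussCurvature K x).toNNReal) (surfaceMeasure K) :=
    (h.continuousOn_gaussCurvature.aemeasurable hm).real_toNNReal
  have hcm : curvatureMeasure K =
      (surfaceMeasure K).withDensity fun x => ((gaussCurvature K x).toNNReal : ℝ≥0∞) := rfl
  have hae : (fun x => (gaussCurvature K x).toNNReal • F x) =ᵐ[surfaceMeasure K]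
      fun x => -boundaryIntegrand K x := by
    filter_upwards [ae_restrict_mem hm] with x hx
    rw [NNReal.smul_def, Real.coe_toNNReal _ (h.isC2Plus.curvature_pos x hx).le, smul_eq_mul,
      h.sphereIntegrand_outerNormal hx]
  constructor
  · rw [h.sphereContactMeasure_eq hn, hcm,
      integrable_withDensity_iff_integrable_smul₀ hκm] at hint
    simpa using (hint.congr hae).neg
  · calc _ = ∫ v : Metric.sphere (0 : EuclideanSpace ℝ (Fin n)) 1, F (contact K v)
          ∂(sphereMeasure n) := integral_congr_ae (Eventually.of_forall fun v => (hval v).symm)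
      _ = ∫ x, F x ∂(sphereContactMeasure K) := (integral_map hcontact.aemeasurable hFm).symm
      _ = ∫ x, (gaussCurvature K x).toNNReal • F x ∂(surfaceMeasure K) := by
          rw [h.sphereContactMeasure_eq hn, hcm, integral_withDensity_eq_integral_smul₀ hκm]
      _ = _ := by rw [integral_congr_ae hae, integral_neg]

end IsSymmC2PlusBody

end ChangeOfVariables

end CentroidBody

end

theorem theorem4p1 (n : ℕ) (hn : 1 ≤ n) (K : ConvexBody (EuclideanSpace ℝ (Fin n)))
    (hint : (interior (K : Set (EuclideanSpace ℝ (Fin n)))).Nonempty)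
    (hsymm : ∀ x ∈ K, -x ∈ K)
    (hvol : volume (K : Set (EuclideanSpace ℝ (Fin n))) = 1)
    (hC2 : IsC2Plus (K : Set (EuclideanSpace ℝ (Fin n)))) :
    -- the volumes and the integrals below are finite
    (volume (polarBody (K : Set (EuclideanSpace ℝ (Fin n)))) ≠ ⊤ ∧
      (∀ p : ℝ, 1 ≤ p → volume (polarBody (Zp p (K : Set (EuclideanSpace ℝ (Fin n))))) ≠ ⊤) ∧
      Integrable (fun u : Metric.sphere (0 : EuclideanSpace ℝ (Fin n)) 1 =>
        sphereIntegrand (K : Set (EuclideanSpace ℝ (Fin n))) u) (sphereMeasure n) ∧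
      Integrable (boundaryIntegrand (K : Set (EuclideanSpace ℝ (Fin n))))
        (surfaceMeasure (K : Set (EuclideanSpace ℝ (Fin n))))) ∧
    -- (i)
    Tendsto (fun p : ℝ => p / Real.log p *
        (volume.real (polarBody (Zp p (K : Set (EuclideanSpace ℝ (Fin n))))) -
          volume.real (polarBody (K : Set (EuclideanSpace ℝ (Fin n))))))
      atTop
      (𝓝 ((n : ℝ) * (n + 1) / 2 *
        volume.real (polarBody (K : Set (EuclideanSpace ℝ (Fin n)))))) ∧
    -- (ii)
    Tendsto (fun p : ℝ => p *
        (volume.real (polarBody (Zp p (K : Set (EuclideanSpace ℝ (Fin n))))) -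
          volume.real (polarBody (K : Set (EuclideanSpace ℝ (Fin n)))) -
          (n : ℝ) * (n + 1) / (2 * p) * Real.log p *
            volume.real (polarBody (Zp p (K : Set (EuclideanSpace ℝ (Fin n)))))))
      atTop
      (𝓝 (-(1 / 2) * ∫ u : Metric.sphere (0 : EuclideanSpace ℝ (Fin n)) 1,
        sphereIntegrand (K : Set (EuclideanSpace ℝ (Fin n))) u ∂(sphereMeasure n))) ∧
    Tendsto (fun p : ℝ => p *
        (volume.real (polarBody (Zp p (K : Set (EuclideanSpace ℝ (Fin n))))) -
          volume.real (polarBody (K : Set (EuclideanSpace ℝ (Fin n)))) -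
          (n : ℝ) * (n + 1) / (2 * p) * Real.log p *
            volume.real (polarBody (K : Set (EuclideanSpace ℝ (Fin n))))))
      atTop
      (𝓝 (-(1 / 2) * ∫ u : Metric.sphere (0 : EuclideanSpace ℝ (Fin n)) 1,
        sphereIntegrand (K : Set (EuclideanSpace ℝ (Fin n))) u ∂(sphereMeasure n))) ∧
    -(1 / 2) * (∫ u : Metric.sphere (0 : EuclideanSpace ℝ (Fin n)) 1,
        sphereIntegrand (K : Set (EuclideanSpace ℝ (Fin n))) u ∂(sphereMeasure n)) =
      1 / 2 * ∫ x, boundaryIntegrand (K : Set (EuclideanSpace ℝ (Fin n))) x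
        ∂(surfaceMeasure (K : Set (EuclideanSpace ℝ (Fin n)))) := by
  have h : IsSymmC2PlusBody (K : Set (EuclideanSpace ℝ (Fin n))) :=
    ⟨K.isCompact, K.convex, hint, hsymm, hC2⟩
  obtain ⟨hbd, heq⟩ := h.integral_sphereIntegrand hn
  refine ⟨⟨(h.volume_polarBody hn).1, fun p hp => (h.volume_polarBody_Zp hn hp).1,
    integrable_sphere_of_continuousOn h.continuousOn_sphereIntegrand, hbd⟩,
    h.tendsto_volume_first_order hn, h.tendsto_volume_deviation_Zp hn,
    h.tendsto_volume_deviation hn, ?_⟩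
  rw [heq]
  ring
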